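/- **Models.** Fix $T\ge 2$, $d\ge 0$ and an integer $\mathcal K\ge 1$. An observation is $w=(y,x)$ with $y\in\mathbb R^T$, $x=(x_1,\dots,x_T)\in(\mathbb R^d)^T$. Let $\phi$ be the standard normal density. The component density $f(w;\theta)$, $\theta\in\mathbb R^q$, is one of the following ($\mathcal K=1$ gives normal errors, $\mathcal K\ge2$ normal-mixture errors; $\tau_{\mathcal K}=1-\sum_{k<\mathcal K}\tau_k$): * conditionally independent: $f(w;\theta)=\prod_{t=1}^T\sum_{k=1}^{\mathcal K}\tau_k\frac1\sigma\phi\big(\frac{y_t-\mu_k-x_t^\top\beta}{\sigma}\big)$, $\theta=(\tau,\mu,\sigma^2,\beta)$; * dynamic: $f(w;\theta)=\Big(\sum_{k}\tau_k\frac1{\sigma_1}\phi\big(\frac{y_1-\mu_{1,k}-x_1^\top\beta_1}{\sigma_1}\big)\Big)\prod_{t=2}^T\sum_{k}\tau_k\frac1\sigma\phi\big(\frac{y_t-\mu_k-\rho y_{t-1}-x_t^\top\beta}{\sigma}\big)$, $\theta=(\tau,\mu_1,\mu,\sigma_1^2,\sigma^2,\beta_1,\beta,\rho)$. Let $\Theta\subseteq\mathbb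 R^q$ be a set of parameters $\theta$ with positive variances and nonnegative inner weights $\tau_1,\dots,\tau_{\mathcal K}$. For $M\ge1$ put $\vartheta_M=(\alpha_1,\dots,\alpha_{M-1},\theta_1,\dots,\theta_M)$, $\alpha_M=1-\sum_{k<M}\alpha_k$, $g_M(w;\vartheta_M)=\sum_{k=1}^M\alpha_kf(w;\theta_k)$; $\Theta_{\vartheta_M}$ is the set of $\vartheta_M$ with all $\alpha_k\ge0$ and $\theta_k\in\Theta$; $k_M=\dim\vartheta_M=M-1+Mq$. For constants $c_1,c_2,c_3>0$ let $\Theta_{\alpha,c_1}=\{\alpha:\alpha_j\in[c_1,1-c_1]\ (j<M),\ \sum_{j<M}\alpha_j\le1-c_1\}$, and let $\bar\Theta_{\vartheta_M}(c)$ be the set of $\vartheta_M\in\Theta_{\vartheta_M}$ with $\alpha\in\Theta_{\alpha,c_1}$, $\min_j\sigma_j^2\ge c_2\sum_k\alpha_k\sigma_k^2$, $\sum_k\alpha_k\sigma_k^2\ge c_3$ (in the dynamic model also for $\sigma_{1,\cdot}^2$). Let $1\le M_0<\overline M$. $W_1,W_2,\dots$ are i.i.d. copies of $W=(Y,X)$,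 where $X$ has some law and, given $X=x$, $Y$ has density $g_{M_0}(\cdot,x;\vartheta^*_{M_0})$; $\vartheta^*_{M_0}=(\alpha^*,\theta_1^*,\dots,\theta_{M_0}^*)$, and $E$ denotes expectation under this law. Write $g^*=g_{M_0}(\cdot;\vartheta^*_{M_0})$, $f_h=f(\cdot;\theta_h^*)$, $\ell_n^M(\vartheta)=\sum_{i\le n}\log g_M(W_i;\vartheta)$, $Q^M(\vartheta)=E\log g_M(W;\vartheta)$, and $\Theta^*_{\vartheta_M}=\{\vartheta\in\Theta_{\vartheta_M}:g_M(W;\vartheta)=g^*(W)\text{ a.s.}\}$. Let $\hat\vartheta_M$ be any maximizer of $\ell_n^M$ over $\bar\Theta_{\vartheta_M}(c)$, and $\widehat M_{PL}$ any maximizer of $\ell_n^M(\hat\vartheta_M)-p_{n,k_M}$ over $M\in\{1,\dots,\overline M\}$. **Assumptions.** 1. In each $\theta_h^*$ all inner weights are positive and the inner means $\mu_k$ (in the dynamic model also the $\mu_{1,k}$) are pairwise distinct. 2. $X$ has finite second moments; for $h\le M_0$ and $b\ne\beta_h^*$, $\Pr(X_t^\top b\ne X_t^\top\beta_h^*\text{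 for some }t)>0$; for $M_0<M\le\overline M$, $\Theta^*_{\vartheta_M}\cap\bar\Theta_{\vartheta_M}(c)\neq\emptyset$ and $\bar\Theta_{\vartheta_M}(c)$ is compact. 3. Components are identified: for $M_0<M\le\overline M$ and $\vartheta\in\Theta^*_{\vartheta_M}\cap\bar\Theta_{\vartheta_M}(c)$, every $\theta_k$ is one of $\theta_1^*,\dots,\theta_{M_0}^*$. 4. For $M=1,\dots,M_0$ there is $\vartheta_M^*$ (for $M=M_0$ the true parameter) such that: $\vartheta_M^*$ maximizes $Q^M$ over $\Theta_{\vartheta_M}$, uniquely up to relabelling of the components; $\Theta_{\vartheta_M}$ is compact and $\vartheta_M^*$ is interior to it; $E[\nabla\log g_M\nabla\log g_M^\top]$ at $\vartheta_M^*$ is finite and non-singular; $E[\nabla^2\log g_M]$ is finite and has constant rank in a neighbourhood of $\vartheta_M^*$; and $Q^{M+1}(\vartheta^*_{M+1})>Q^M(\vartheta^*_M)$ for $M<M_0$. 5. For all $n>1$, $k\ge1$: $p_{n,k+1}\ge p_{n,k}>0$; $p_{n,k}\to\infty$ and $p_{n,k}/n\to0$ as $n\to\infty$; $\lim_n p_{n,k'}/p_{n,k}>1$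 (possibly $+\infty$) for $1\le k<k'\le k_{\overline M}$. 6. (Generalized DQM expansion.) For every $M\in\{M_0+1,\dots,\overline M\}$ and every partition of $\{1,\dots,M\}$ into consecutive nonempty blocks $T_1,\dots,T_{M_0}$, the following holds. Put $\beta_h=\sum_{k\in T_h}\alpha_k$, $\tau_k=\alpha_k/\beta_h$ for $k\in T_h$, let $k_h=\min T_h$, and reparameterize by $\psi=(\beta_1,\dots,\beta_{M_0-1},\nu_1,\dots,\nu_{M_0},\lambda)$, $\lambda=(\lambda_\ell)_{\ell\in T_h\setminus\{k_h\},\,h\le M_0}$, via $\theta_{k_h}=\nu_h-\sum_{\ell\in T_h\setminus\{k_h\}}\tau_\ell\lambda_\ell$, $\theta_\ell=\nu_h+\tau_{k_h}\lambda_\ell$; $\psi^*=(\alpha^*,\theta^*,0)$. Let $\Theta_{\tau,c_1}$ be the set of $\tau$ that come from $\alpha\in\Theta_{\alpha,c_1}$ and $\Theta_\psi$ the set of $\psi$ for which $(\psi,\tau)$ describes a point of $\Theta_{\vartheta_M}$ for some $\tau\in\Theta_{\tau,c_1}$. Let $p_h$ be the least $p$ with $\sum_{r=2}^p\binom{q+r-1}{r}\ge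 q(|T_h|-1)$. Let $t_{\psi\tau}$ be the vector with entries $\beta_h-\alpha_h^*$ ($h<M_0$), $\nu_h-\theta_h^*$, and, for each $h$ and $2\le p\le p_h$, the distinct entries of the symmetric tensor $\sum_{k\in T_h}\tau_k(\theta_k-\nu_h)^{\otimes p}$. Let $s(w)$ be the vector with entries $(f_h-f_{M_0})/g^*$ ($h<M_0$), $\alpha_h^*\nabla_\theta f_h/g^*$, and, correspondingly, $\frac{m_I}{p!}\,\alpha_h^*\,\partial_\theta^If_h/g^*$ for the multi-indices $I$ of order $p$, where $m_I$ is the number of orderings of $I$. Define $r_{\psi\tau}$ by $g_M(w;\psi,\tau)/g^*(w)-1=t_{\psi\tau}^\top s(w)+r_{\psi\tau}(w)$, let $N_\epsilon=\{\psi\in\Theta_\psi:\sup_{\tau\in\Theta_{\tau,c_1}}\|t_{\psi\tau}\|<\epsilon\}$ and $\nu_n(h)=n^{-1/2}\sum_{i\le n}(h(W_i)-Eh(W))$. Then $\psi\to\psi^*$ as $\sup_\tau\|t_{\psi\tau}\|\to0$, and for some $\delta,\epsilon>0$: (a) $E\|s(W)\|^{2+\delta}<\infty$; (b) $n^{-1}\sum_{i\le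 n}s(W_i)s(W_i)^\top\to\mathcal I=E[ss^\top]$ in probability, and $\mathcal I$ is finite and non-singular; (c) $E\sup|r_{\psi\tau}(W)/(\|t_{\psi\tau}\|\|\psi-\psi^*\|)|^2<\infty$; (d) $\sup\,\nu_n(r_{\psi\tau})/(\|t_{\psi\tau}\|\|\psi-\psi^*\|)=O_p(1)$; (e) $\|\nu_n(s)\|=O_p(1)$. The suprema in (c), (d) are over $\psi\in N_\epsilon$ and $\tau\in\Theta_{\tau,c_1}$ such that $(\psi,\tau)$ describes a point of $\Theta_{\vartheta_M}$, with $0/0=0$. **Conclusion.** For every $M\in\{M_0+1,\dots,\overline M\}$, $\ell_n^M(\hat\vartheta_M)-\ell_n^{M_0}(\hat\vartheta_{M_0})=O_p(1)$, and $\widehat M_{PL}\to M_0$ in probability as $n\to\infty$. -/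

import Mathlib

open MeasureTheory ProbabilityTheory Filter Topology

noncomputable section

namespace PanelMixture

/-! ### Weights, observations and component densities -/

/-- The full weight vector `(a₁, …, a_{M-1}, 1 - ∑ aᵢ)` determined by its first `M - 1` entries. -/
def fullWeights {M : ℕ} (a : Fin (M - 1) → ℝ) (k : Fin M) : ℝ :=
  if h : (k : ℕ) < M - 1 then a ⟨k, h⟩ else 1 - ∑ i, a i

/-- One observation `w = (y, x)`: outcomes `y₁, …, y_T` and covariates `x₁, …, x_T ∈ ℝᵈ`. -/
abbrev Obs (T d : ℕ) : Type := (Fin T → ℝ) × (Fin T → Fin d → ℝ)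

/-- The normal density `σ⁻¹ φ((y - m) / σ)` with mean `m` and variance `v = σ²`. -/
def normalPdf (m v y : ℝ) : ℝ :=
  (√v)⁻¹ * ((√(2 * Real.pi))⁻¹ * Real.exp (-((y - m) / √v) ^ 2 / 2))

/-- The data of a parametric family of component densities `f(w; θ)`, `θ ∈ ℝ^ι`. The theorem is
about the two concrete families `staticFamily` and `dynamicFamily` below. -/
structure ComponentFamily (T d : ℕ) where
  /-- coordinates of the component parameter `θ` -/
  ι : Type
  [fintypeι : Fintype ι]
  [decEqι : DecidableEq ι]
  /-- the component density `f(w; θ)` -/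
  density : EuclideanSpace ℝ ι → Obs T d → ℝ
  /-- the values of `θ` that are meaningful (positive variances, inner weights in the simplex) -/
  domain : Set (EuclideanSpace ℝ ι)
  /-- number of variance parameters in `θ` -/
  numVar : ℕ
  /-- the variance parameters in `θ` -/
  variance : Fin numVar → EuclideanSpace ℝ ι → ℝ
  /-- the regression coefficient `β` in `θ` -/
  slope : EuclideanSpace ℝ ι → Fin d → ℝ
  /-- positive inner weights and pairwise distinct inner means -/
  innerRegular : EuclideanSpace ℝ ι → Prop

attribute [instance] ComponentFamily.fintypeι ComponentFamily.decEqι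

/-- Coordinates of `θ = (τ, μ, σ², β)` in the conditionally independent model. -/
inductive StaticCoord (d K : ℕ) : Type
  | tau (k : Fin (K - 1))
  | mu (k : Fin K)
  | sigmaSq
  | beta (i : Fin d)
  deriving DecidableEq, Fintype

/-- Coordinates of `θ = (τ, μ₁, μ, σ₁², σ², β₁, β, ρ)` in the dynamic model. -/
inductive DynamicCoord (d K : ℕ) : Type
  | tau (k : Fin (K - 1))
  | muInit (k : Fin K)
  | mu (k : Fin K)
  | sigmaSqInit
  | sigmaSq
  | betaInit (i : Fin d)
  | beta (i : Fin d)
  | rho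
  deriving DecidableEq, Fintype

/-- The conditionally independent model: given `x`, the density of `y` is
`∏ₜ ∑ₖ τₖ σ⁻¹ φ((yₜ - μₖ - xₜᵀβ) / σ)`. For `K = 1` this is the normal model. -/
def staticFamily (T d K : ℕ) : ComponentFamily T d where
  ι := StaticCoord d K
  density θ w := ∏ t, ∑ k : Fin K, fullWeights (fun i => θ (.tau i)) k *
    normalPdf (θ (.mu k) + ∑ i, w.2 t i * θ (.beta i)) (θ .sigmaSq) (w.1 t)
  domain := {θ | (∀ k : Fin K, 0 ≤ fullWeights (fun i => θ (.tau i)) k) ∧ 0 < θ .sigmaSq}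
  numVar := 1
  variance _ θ := θ .sigmaSq
  slope θ i := θ (.beta i)
  innerRegular θ := (∀ k : Fin K, 0 < fullWeights (fun i => θ (.tau i)) k) ∧
    ∀ k l : Fin K, k ≠ l → θ (.mu k) ≠ θ (.mu l)

/-- The first-order Markov model: given `x`, the density of `y` is
`(∑ₖ τₖ σ₁⁻¹ φ((y₁ - μ₁ₖ - x₁ᵀβ₁) / σ₁)) ∏_{t ≥ 2} ∑ₖ τₖ σ⁻¹ φ((yₜ - μₖ - ρ y_{t-1} - xₜᵀβ) / σ)`.
For `K = 1` this is the normal autoregressive model. -/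
def dynamicFamily (T d K : ℕ) : ComponentFamily T d where
  ι := DynamicCoord d K
  density θ w := ∏ t : Fin T, ∑ k : Fin K, fullWeights (fun i => θ (.tau i)) k *
    if (t : ℕ) = 0 then
      normalPdf (θ (.muInit k) + ∑ i, w.2 t i * θ (.betaInit i)) (θ .sigmaSqInit) (w.1 t)
    else
      normalPdf (θ (.mu k) + θ .rho * w.1 ⟨(t : ℕ) - 1, (Nat.sub_le _ _).trans_lt t.2⟩
        + ∑ i, w.2 t i * θ (.beta i)) (θ .sigmaSq) (w.1 t)
  domain := {θ | (∀ k : Fin K, 0 ≤ fullWeights (fun i => θ (.tau i)) k) ∧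
    0 < θ .sigmaSqInit ∧ 0 < θ .sigmaSq}
  numVar := 2
  variance v θ := if v = 0 then θ .sigmaSqInit else θ .sigmaSq
  slope θ i := θ (.beta i)
  innerRegular θ := (∀ k : Fin K, 0 < fullWeights (fun i => θ (.tau i)) k) ∧
    (∀ k l : Fin K, k ≠ l → θ (.mu k) ≠ θ (.mu l)) ∧
    ∀ k l : Fin K, k ≠ l → θ (.muInit k) ≠ θ (.muInit l)

/-- The two kinds of models. -/
inductive ModelKind : Type
  | conditionallyIndependent
  | dynamicMarkov

/-- The component family of each kind with `K` inner normal components. -/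
def family (T d K : ℕ) : ModelKind → ComponentFamily T d
  | .conditionallyIndependent => staticFamily T d K
  | .dynamicMarkov => dynamicFamily T d K

variable {T d : ℕ} (F : ComponentFamily T d)

/-! ### The mixture model, its parameter spaces and its likelihood -/

/-- `ϑ_M = (α₁, …, α_{M-1}, θ₁, …, θ_M)`. -/
abbrev MixParam (M : ℕ) : Type := EuclideanSpace ℝ (Fin (M - 1) ⊕ Fin M × F.ι)

/-- `k_M = dim ϑ_M`. -/
def numParams (M : ℕ) : ℕ := Fintype.card (Fin (M - 1) ⊕ Fin M × F.ι)

variable {F}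

/-- The mixing proportion `α_k`, with `α_M = 1 - ∑_{k < M} α_k`. -/
def weight {M : ℕ} (ϑ : MixParam F M) (k : Fin M) : ℝ := fullWeights (fun i => ϑ (.inl i)) k

/-- The component parameter `θ_k`. -/
def comp {M : ℕ} (ϑ : MixParam F M) (k : Fin M) : EuclideanSpace ℝ F.ι :=
  WithLp.toLp 2 fun a => ϑ (.inr (k, a))

/-- `g_M(w; ϑ) = ∑ₖ αₖ f(w; θₖ)`. -/
def mixDensity {M : ℕ} (ϑ : MixParam F M) (w : Obs T d) : ℝ :=
  ∑ k, weight ϑ k * F.density (comp ϑ k) w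

/-- `Θ_{ϑ_M}`: proportions in the simplex and `θ_k ∈ Θ` for each `k`. -/
def paramSpace (Θ : Set (EuclideanSpace ℝ F.ι)) (M : ℕ) : Set (MixParam F M) :=
  {ϑ | (∀ k, 0 ≤ weight ϑ k) ∧ ∀ k, comp ϑ k ∈ Θ}

/-- `Θ_{α,c₁} = {α : α_j ∈ [c₁, 1 - c₁], ∑_{j < M} α_j ≤ 1 - c₁}`. -/
def alphaSpace (c₁ : ℝ) (M : ℕ) : Set (Fin (M - 1) → ℝ) :=
  {a | (∀ i, a i ∈ Set.Icc c₁ (1 - c₁)) ∧ ∑ i, a i ≤ 1 - c₁}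

/-- The constants `c = (c₁, c₂, c₃)` of the restricted parameter space. -/
structure Constants where
  c₁ : ℝ
  c₂ : ℝ
  c₃ : ℝ
  c₁_pos : 0 < c₁
  c₂_pos : 0 < c₂
  c₃_pos : 0 < c₃

/-- The restricted space `Θ̄_{ϑ_M}(c)`: `α ∈ Θ_{α,c₁}`, `min_j σ_j² ≥ c₂ ∑ₖ αₖ σₖ²` and
`∑ₖ αₖ σₖ² ≥ c₃`, the latter two for each variance parameter of the model. -/
def restrictedSpace (Θ : Set (EuclideanSpace ℝ F.ι)) (c : Constants) (M : ℕ) :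
    Set (MixParam F M) :=
  {ϑ | ϑ ∈ paramSpace Θ M ∧ (fun i => ϑ (.inl i)) ∈ alphaSpace c.c₁ M ∧
    ∀ v, (∀ j, c.c₂ * ∑ k, weight ϑ k * F.variance v (comp ϑ k) ≤ F.variance v (comp ϑ j)) ∧
      c.c₃ ≤ ∑ k, weight ϑ k * F.variance v (comp ϑ k)}

/-- The law of an observation: `X` has law `PX`, and given `X = x` the outcome vector has Lebesgue
density `g_M(· | x; ϑ)`. -/
def dataLaw (PX : Measure (Fin T → Fin d → ℝ)) {M : ℕ} (ϑ : MixParam F M) : Measure (Obs T d) :=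
  ((volume : Measure (Fin T → ℝ)).prod PX).withDensity fun w => ENNReal.ofReal (mixDensity ϑ w)

/-- `W₁, W₂, …` is a random sample from the mixture with parameter `ϑ`. -/
structure IsSample {Ω : Type*} [MeasurableSpace Ω] (μ : Measure Ω)
    (PX : Measure (Fin T → Fin d → ℝ)) {M : ℕ} (ϑ : MixParam F M) (W : ℕ → Ω → Obs T d) :
    Prop where
  measurable : ∀ i, Measurable (W i)
  law : ∀ i, μ.map (W i) = dataLaw PX ϑ
  indep : iIndepFun W μ

/-- The log-likelihood `ℓ_n^M(ϑ) = ∑_{i ≤ n} log g_M(W_i; ϑ)`. -/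
def logLik {Ω : Type*} (W : ℕ → Ω → Obs T d) {M : ℕ} (n : ℕ) (ω : Ω) (ϑ : MixParam F M) : ℝ :=
  ∑ i ∈ Finset.range n, Real.log (mixDensity ϑ (W i ω))

/-- `Q^M(ϑ) = E log g_M(W; ϑ)` for `W` with law `P`. -/
def expLogLik (P : Measure (Obs T d)) {M : ℕ} (ϑ : MixParam F M) : ℝ :=
  ∫ w, Real.log (mixDensity ϑ w) ∂P

/-- The two parameters agree up to relabelling of the components. -/
def SameUpToLabels {M : ℕ} (ϑ ϑ' : MixParam F M) : Prop :=
  ∃ σ : Equiv.Perm (Fin M), ∀ k, weight ϑ (σ k) = weight ϑ' k ∧ comp ϑ (σ k) = comp ϑ' k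

/-- `X_n = O_p(1)`. -/
def IsOpOne {Ω : Type*} [MeasurableSpace Ω] (μ : Measure Ω) (X : ℕ → Ω → ℝ) : Prop :=
  ∀ η : ℝ, 0 < η → ∃ C : ℝ, ∀ᶠ n in atTop, μ {ω | C < |X n ω|} ≤ ENNReal.ofReal η

/-- `sup_{p ∈ S} X_n(p)` is bounded above in probability. It is used for suprema that are
nonnegative, for which this is `sup_{p ∈ S} X_n(p) = O_p(1)`. -/
def IsOpOneSup {Ω A : Type*} [MeasurableSpace Ω] (μ : Measure Ω) (S : Set A)
    (X : ℕ → Ω → A → ℝ) : Prop :=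
  ∀ η : ℝ, 0 < η → ∃ C : ℝ, ∀ᶠ n in atTop,
    μ {ω | ∃ p ∈ S, C < X n ω p} ≤ ENNReal.ofReal η

/-- The empirical process `ν_n(h) = n^{-1/2} ∑_{i ≤ n} (h(W_i) - E h(W))`, `W` with law `P`. -/
def empProc {Ω : Type*} (W : ℕ → Ω → Obs T d) (P : Measure (Obs T d)) (h : Obs T d → ℝ)
    (n : ℕ) (ω : Ω) : ℝ :=
  (√(n : ℝ))⁻¹ * ∑ i ∈ Finset.range n, (h (W i ω) - ∫ w, h w ∂P)

/-! ### Identification, consistency, regularity and penalty assumptions -/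

/-- Positive inner weights and distinct inner means in every true component. -/
def InnerCondition {M₀ : ℕ} (ϑs : MixParam F M₀) : Prop := ∀ h, F.innerRegular (comp ϑs h)

/-- `Θ*_{ϑ_M}`, up to null sets: the `ϑ ∈ Θ_{ϑ_M}` that reproduce the true density. -/
def trueSet (Θ : Set (EuclideanSpace ℝ F.ι)) (PX : Measure (Fin T → Fin d → ℝ)) {M₀ : ℕ}
    (ϑs : MixParam F M₀) (M : ℕ) : Set (MixParam F M) :=
  {ϑ | ϑ ∈ paramSpace Θ M ∧ ∀ᵐ w ∂(dataLaw PX ϑs), mixDensity ϑ w = mixDensity ϑs w}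

/-- Identification of the components: for `M₀ < M ≤ M̄`, a parameter in `Θ̄_{ϑ_M}(c)` reproduces
the true density only by replicating true components. -/
def ComponentsIdentified (Θ : Set (EuclideanSpace ℝ F.ι)) (PX : Measure (Fin T → Fin d → ℝ))
    (c : Constants) {M₀ : ℕ} (ϑs : MixParam F M₀) (Mbar : ℕ) : Prop :=
  ∀ M, M₀ < M → M ≤ Mbar → ∀ ϑ ∈ trueSet Θ PX ϑs M ∩ restrictedSpace Θ c M,
    ∀ k, ∃ h, comp ϑ k = comp ϑs h

/-- The assumption for consistency of the maximum likelihood estimator. -/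
structure ConsistencyCondition (Θ : Set (EuclideanSpace ℝ F.ι))
    (PX : Measure (Fin T → Fin d → ℝ)) (c : Constants) {M₀ : ℕ} (ϑs : MixParam F M₀)
    (Mbar : ℕ) : Prop where
  secondMoment : ∀ t i, Integrable (fun x : Fin T → Fin d → ℝ => x t i ^ 2) PX
  slopeIdentified : ∀ h, ∀ b : Fin d → ℝ, b ≠ F.slope (comp ϑs h) →
    0 < PX {x | ∃ t, ∑ i, x t i * b i ≠ ∑ i, x t i * F.slope (comp ϑs h) i}
  nonempty : ∀ M, M₀ < M → M ≤ Mbar → (trueSet Θ PX ϑs M ∩ restrictedSpace Θ c M).Nonempty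
  compact : ∀ M, M₀ < M → M ≤ Mbar → IsCompact (restrictedSpace Θ c M)

/-- The `a`-th partial derivative of `log g_M(w; ·)` at `ϑ`. -/
def scoreLog {M : ℕ} (ϑ : MixParam F M) (w : Obs T d) (a : Fin (M - 1) ⊕ Fin M × F.ι) : ℝ :=
  fderiv ℝ (fun v : MixParam F M => Real.log (mixDensity v w)) ϑ (EuclideanSpace.single a 1)

/-- The second partial derivative of `log g_M(w; ·)` at `ϑ` in the coordinates `a`, `b`. -/
def hessLog {M : ℕ} (ϑ : MixParam F M) (w : Obs T d) (a b : Fin (M - 1) ⊕ Fin M × F.ι) : ℝ :=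
  iteratedFDeriv ℝ 2 (fun v : MixParam F M => Real.log (mixDensity v w)) ϑ
    ![EuclideanSpace.single a 1, EuclideanSpace.single b 1]

/-- `B^M(ϑ) = E[∇ log g_M ∇ log g_Mᵀ]`. -/
def matB (P : Measure (Obs T d)) {M : ℕ} (ϑ : MixParam F M) :
    Matrix (Fin (M - 1) ⊕ Fin M × F.ι) (Fin (M - 1) ⊕ Fin M × F.ι) ℝ :=
  fun a b => ∫ w, scoreLog ϑ w a * scoreLog ϑ w b ∂P

/-- `A^M(ϑ) = E[∇² log g_M]`. -/
def matA (P : Measure (Obs T d)) {M : ℕ} (ϑ : MixParam F M) :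
    Matrix (Fin (M - 1) ⊕ Fin M × F.ι) (Fin (M - 1) ⊕ Fin M × F.ι) ℝ :=
  fun a b => ∫ w, hessLog ϑ w a b ∂P

/-- The regularity assumption on the models with `M ≤ M₀` components; `ϑs M` is `ϑ*_M`. -/
structure RegularityCondition (Θ : Set (EuclideanSpace ℝ F.ι)) (P : Measure (Obs T d))
    (M₀ : ℕ) (ϑs : (M : ℕ) → MixParam F M) : Prop where
  isMax : ∀ M, 1 ≤ M → M ≤ M₀ → ∀ ϑ ∈ paramSpace Θ M, expLogLik P ϑ ≤ expLogLik P (ϑs M)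
  unique : ∀ M, 1 ≤ M → M ≤ M₀ → ∀ ϑ ∈ paramSpace Θ M,
    expLogLik P ϑ = expLogLik P (ϑs M) → SameUpToLabels ϑ (ϑs M)
  compact : ∀ M, 1 ≤ M → M ≤ M₀ → IsCompact (paramSpace Θ M)
  mem_interior : ∀ M, 1 ≤ M → M ≤ M₀ → ϑs M ∈ interior (paramSpace Θ M)
  integrable_score : ∀ M, 1 ≤ M → M ≤ M₀ → ∀ a b,
    Integrable (fun w => scoreLog (ϑs M) w a * scoreLog (ϑs M) w b) P
  nonsingular : ∀ M, 1 ≤ M → M ≤ M₀ → (matB P (ϑs M)).det ≠ 0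
  constantRank : ∀ M, 1 ≤ M → M ≤ M₀ → ∃ r : ℕ, ∃ U : Set (MixParam F M), IsOpen U ∧ ϑs M ∈ U ∧
    ∀ ϑ ∈ U, (∀ a b, Integrable (fun w => hessLog ϑ w a b) P) ∧ (matA P ϑ).rank = r
  increasing : ∀ M, 1 ≤ M → M < M₀ → 0 < expLogLik P (ϑs (M + 1)) - expLogLik P (ϑs M)

/-- The assumption on the penalties `p n k`, for numbers of parameters `k` with relevant upper
bound `kmax`. -/
structure PenaltyCondition (p : ℕ → ℕ → ℝ) (kmax : ℕ) : Prop where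
  mono : ∀ n k, 1 < n → 1 ≤ k → p n k ≤ p n (k + 1)
  pos : ∀ n k, 1 < n → 1 ≤ k → 0 < p n k
  tendsto : ∀ k, 1 ≤ k → Tendsto (fun n => p n k) atTop atTop
  littleO : ∀ k, 1 ≤ k → Tendsto (fun n => p n k / (n : ℝ)) atTop (𝓝 0)
  ratio : ∀ k k', 1 ≤ k → k < k' → k' ≤ kmax → ∃ L : EReal, 1 < L ∧
    Tendsto (fun n => ((p n k' / p n k : ℝ) : EReal)) atTop (𝓝 L)

/-! ### The reparameterization attached to an ordered partition -/

/-- An ordered partition of `{1, …, M}` into `M₀` nonempty consecutive blocks, given by the map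
that sends `k` to the block that contains it. -/
structure BlockPartition (M M₀ : ℕ) where
  block : Fin M → Fin M₀
  monotone : Monotone block
  surjective : Function.Surjective block

variable {M M₀ : ℕ}

/-- The elements of `{1, …, M}` that are not the first element of their block. -/
abbrev NonFirst (j : BlockPartition M M₀) : Type :=
  {k : Fin M // ∃ k' : Fin M, k' < k ∧ j.block k' = j.block k}

/-- `Θ_{τ,c₁}`: the within-block proportions `τ_k = α_k / ∑_{k' in the block of k} α_{k'}` that
come from some `α ∈ Θ_{α,c₁}`. -/
def tauSpace (c₁ : ℝ) (j : BlockPartition M M₀) : Set (Fin M → ℝ) :=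
  {τ | ∃ a ∈ alphaSpace c₁ M, ∀ k, τ k =
    fullWeights a k / ∑ k' with j.block k' = j.block k, fullWeights a k'}

variable (F) in
/-- `ψ = (β, ν, λ)`: block proportions `β₁, …, β_{M₀-1}`, block means `ν₁, …, ν_{M₀}`, and one
`λ_k` for every `k` that is not the first element of its block. -/
abbrev Psi (j : BlockPartition M M₀) : Type :=
  EuclideanSpace ℝ (Fin (M₀ - 1) ⊕ (Fin M₀ × F.ι) ⊕ (NonFirst j × F.ι))

/-- `τ_{h,1}`: the within-block proportion of the first element of block `h`. -/
def firstTau (j : BlockPartition M M₀) (τ : Fin M → ℝ) (h : Fin M₀) : ℝ :=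
  ∑ k with j.block k = h ∧ ∀ k' < k, j.block k' ≠ j.block k, τ k

/-- `θ̃_k - ν_h` for `k` in block `h`: it is `τ_{h,1} λ_k` when `k` is not the first element of the
block, and `-∑_ℓ τ_ℓ λ_ℓ` (`ℓ` over the other elements of the block) when it is. -/
def deviation (j : BlockPartition M M₀) (ψ : Psi F j) (τ : Fin M → ℝ) (k : Fin M) (a : F.ι) : ℝ :=
  if hk : ∃ k' : Fin M, k' < k ∧ j.block k' = j.block k then
    firstTau j τ (j.block k) * ψ (.inr (.inr (⟨k, hk⟩, a)))
  else
    -∑ l : NonFirst j, if j.block l = j.block k then τ l * ψ (.inr (.inr (l, a))) else 0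

/-- The mixture parameter with `α_k = β_h τ_k` and `θ_k = θ̃_k`, for `k` in block `h`. -/
def toParam (j : BlockPartition M M₀) (ψ : Psi F j) (τ : Fin M → ℝ) : MixParam F M :=
  WithLp.toLp 2 <| Sum.elim
    (fun i => fullWeights (fun i' => ψ (.inl i'))
        (j.block ⟨i, i.2.trans_le (Nat.sub_le _ _)⟩) * τ ⟨i, i.2.trans_le (Nat.sub_le _ _)⟩)
    (fun ka => ψ (.inr (.inl (j.block ka.1, ka.2))) + deviation j ψ τ ka.1 ka.2)

/-- `ψ* = (α*, θ*, 0)`. -/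
def psiStar (j : BlockPartition M M₀) (ϑs : MixParam F M₀) : Psi F j :=
  WithLp.toLp 2 <| Sum.elim (fun i => ϑs (.inl i))
    (Sum.elim (fun ha => ϑs (.inr ha)) (fun _ => 0))

variable (F) in
/-- The order `p_h`: the least `p` such that the numbers of distinct partial derivatives (in `θ`)
of the orders `2, …, p` add up to at least `dim λ_h = (|T_h| - 1) dim θ`. -/
def expansionOrder (j : BlockPartition M M₀) (h : Fin M₀) : ℕ :=
  sInf {p | Fintype.card {k : NonFirst j // j.block k = h} * Fintype.card F.ι ≤
    ∑ r ∈ Finset.Icc 2 p, Fintype.card (Sym F.ι r)}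

variable (F) in
/-- Index set of the score vector: proportions, first derivatives at each `θ*_h`, and for each `h`
the distinct partial derivatives of orders `2, …, p_h`, listed by unordered multi-indices. -/
abbrev ScoreIndex (j : BlockPartition M M₀) : Type :=
  Fin (M₀ - 1) ⊕ (Fin M₀ × F.ι) ⊕
    (Σ h : Fin M₀, Σ p : Finset.Icc 2 (expansionOrder F j h), Sym F.ι (p : ℕ))

/-- The vector `t_{ψτ}`: `β - α*`, `ν - θ*`, and, for each block `h` and order `2 ≤ p ≤ p_h`, the
distinct entries of the tensor `∑_{k ∈ T_h} τ_k (θ̃_k - ν_h)^{⊗p}`. In terms of `λ_h` this tensor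
is `∑ γ_{ℓ₁…ℓ_p}(τ_h) λ_{ℓ₁} ⊗ ⋯ ⊗ λ_{ℓ_p}`, where
`γ_{ℓ₁…ℓ_p}(τ_h) = (-1)^p τ_{h,1} τ_{ℓ₁} ⋯ τ_{ℓ_p} + 𝟙{ℓ₁ = ⋯ = ℓ_p} τ_{h,1}^p τ_{ℓ₁}`. -/
def tVec (j : BlockPartition M M₀) (ϑs : MixParam F M₀) (ψ : Psi F j) (τ : Fin M → ℝ) :
    EuclideanSpace ℝ (ScoreIndex F j) :=
  WithLp.toLp 2 <| Sum.elim (fun i => ψ (.inl i) - ϑs (.inl i)) <| Sum.elim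
    (fun ha => ψ (.inr (.inl ha)) - ϑs (.inr ha))
    (fun hpI => ∑ k with j.block k = hpI.1,
      τ k * ((hpI.2.2 : Multiset F.ι).map (deviation j ψ τ k)).prod)

/-- The partial derivative of order `p` of `f(w; ·)` at `θ` with multi-index `I`. -/
def partialDeriv (θ : EuclideanSpace ℝ F.ι) (w : Obs T d) {p : ℕ} (I : Sym F.ι p) : ℝ :=
  iteratedFDeriv ℝ p (fun v => F.density v w) θ fun i =>
    EuclideanSpace.single ((I : Multiset F.ι).toList.get (i.cast (by simp))) 1

/-- The score vector `s(w)`: `(f_h - f_{M₀}) / g` for `h < M₀`, `α*_h ∂_a f_h / g`, and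
`α*_h (p!)⁻¹ × (frequency of I) × ∂^I f_h / g` for the multi-indices `I` of order `2 ≤ p ≤ p_h`,
where `f_h = f(w; θ*_h)` and `g` is the true density. -/
def sVec (j : BlockPartition M M₀) (ϑs : MixParam F M₀) (w : Obs T d) :
    EuclideanSpace ℝ (ScoreIndex F j) :=
  WithLp.toLp 2 <| Sum.elim
    (fun i => (F.density (comp ϑs ⟨i, i.2.trans_le (Nat.sub_le _ _)⟩) w -
      F.density (comp ϑs ⟨M₀ - 1, by have := i.2; omega⟩) w) / mixDensity ϑs w) <| Sum.elim
    (fun ha => weight ϑs ha.1 *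
      fderiv ℝ (fun v => F.density v w) (comp ϑs ha.1) (EuclideanSpace.single ha.2 1) /
        mixDensity ϑs w)
    (fun hpI => weight ϑs hpI.1 * ((hpI.2.1 : ℕ).factorial : ℝ)⁻¹ *
      ((hpI.2.2 : Multiset F.ι).countPerms : ℝ) * partialDeriv (comp ϑs hpI.1) w hpI.2.2 /
        mixDensity ϑs w)

/-- The remainder `r_{ψτ} = l_{ψτ} - 1 - t_{ψτ}ᵀ s`, where `l_{ψτ} = g_M(w; ψ, τ) / g(w)` is the
density ratio. -/
def remainder (j : BlockPartition M M₀) (ϑs : MixParam F M₀) (ψ : Psi F j) (τ : Fin M → ℝ)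
    (w : Obs T d) : ℝ :=
  mixDensity (toParam j ψ τ) w / mixDensity ϑs w - 1 - ∑ a, tVec j ϑs ψ τ a * sVec j ϑs w a

/-- `r_{ψτ} / (‖t_{ψτ}‖ ‖ψ - ψ*‖)`, with value `0` where the denominator vanishes. -/
def relRemainder (j : BlockPartition M M₀) (ϑs : MixParam F M₀) (ψ : Psi F j) (τ : Fin M → ℝ)
    (w : Obs T d) : ℝ :=
  remainder j ϑs ψ τ w / (‖tVec j ϑs ψ τ‖ * ‖ψ - psiStar j ϑs‖)

/-- `Θ_ψ`: the `ψ` that belong to some `ϑ ∈ Θ_{ϑ_M}` with within-block proportions in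
`Θ_{τ,c₁}`. -/
def psiSpace (Θ : Set (EuclideanSpace ℝ F.ι)) (c₁ : ℝ) (j : BlockPartition M M₀) :
    Set (Psi F j) :=
  {ψ | ∃ τ ∈ tauSpace c₁ j, toParam j ψ τ ∈ paramSpace Θ M}

/-- `N_ε = {ψ ∈ Θ_ψ : sup_{τ ∈ Θ_{τ,c₁}} ‖t_{ψτ}‖ < ε}`; the set `Θ_{τ,c₁}` is compact, so the
supremum is attained. -/
def nbhd (Θ : Set (EuclideanSpace ℝ F.ι)) (c₁ : ℝ) (j : BlockPartition M M₀)
    (ϑs : MixParam F M₀) (ε : ℝ) : Set (Psi F j) :=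
  {ψ | ψ ∈ psiSpace Θ c₁ j ∧ ∀ τ ∈ tauSpace c₁ j, ‖tVec j ϑs ψ τ‖ < ε}

/-- The pairs `(ψ, τ)` with `ψ ∈ N_ε` and `τ ∈ Θ_{τ,c₁}` that describe a point of `Θ_{ϑ_M}`. -/
def nbhdPairs (Θ : Set (EuclideanSpace ℝ F.ι)) (c₁ : ℝ) (j : BlockPartition M M₀)
    (ϑs : MixParam F M₀) (ε : ℝ) : Set (Psi F j × (Fin M → ℝ)) :=
  {q | q.1 ∈ nbhd Θ c₁ j ϑs ε ∧ q.2 ∈ tauSpace c₁ j ∧ toParam j q.1 q.2 ∈ paramSpace Θ M}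

/-- The information matrix `E[s sᵀ]`. -/
def infoMatrix (P : Measure (Obs T d)) (j : BlockPartition M M₀) (ϑs : MixParam F M₀) :
    Matrix (ScoreIndex F j) (ScoreIndex F j) ℝ :=
  fun a b => ∫ w, sVec j ϑs w a * sVec j ϑs w b ∂P

/-- The assumption on the expansion `l_{ψτ} - 1 = t_{ψτ}ᵀ s + r_{ψτ}` for the partition `j`. -/
structure ExpansionCondition {Ω : Type*} [MeasurableSpace Ω] (μ : Measure Ω)
    (W : ℕ → Ω → Obs T d) (P : Measure (Obs T d)) (Θ : Set (EuclideanSpace ℝ F.ι)) (c₁ : ℝ)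
    (ϑs : MixParam F M₀) (j : BlockPartition M M₀) : Prop where
  psi_tendsto : ∀ η : ℝ, 0 < η → ∃ ζ : ℝ, 0 < ζ ∧
    ∀ ψ ∈ nbhd Θ c₁ j ϑs ζ, ‖ψ - psiStar j ϑs‖ < η
  moment : ∃ C δ : ℝ, 0 < C ∧ 0 < δ ∧
    ∫⁻ w, ENNReal.ofReal (‖sVec j ϑs w‖ ^ (2 + δ)) ∂P < ENNReal.ofReal C
  info_converges : ∀ a b, TendstoInMeasure μ
    (fun (n : ℕ) ω => (n : ℝ)⁻¹ * ∑ i ∈ Finset.range n, sVec j ϑs (W i ω) a * sVec j ϑs (W i ω) b)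
    atTop (fun _ => infoMatrix P j ϑs a b)
  info_finite : ∀ a b, Integrable (fun w => sVec j ϑs w a * sVec j ϑs w b) P
  info_nonsingular : (infoMatrix P j ϑs).det ≠ 0
  remainder_bound : ∃ ε : ℝ, 0 < ε ∧
    -- `E sup |r / (‖t‖ ‖ψ - ψ*‖)|² < ∞`, as domination by an integrable function
    (∃ G : Obs T d → ℝ, Integrable G P ∧
      ∀ᵐ w ∂P, ∀ q ∈ nbhdPairs Θ c₁ j ϑs ε, |relRemainder j ϑs q.1 q.2 w| ^ 2 ≤ G w) ∧
    -- `sup ν_n(r) / (‖t‖ ‖ψ - ψ*‖) = O_p(1)`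
    IsOpOneSup μ (nbhdPairs Θ c₁ j ϑs ε)
      (fun n ω q => empProc W P (relRemainder j ϑs q.1 q.2) n ω)
  score_bound : IsOpOne μ fun n ω =>
    ‖(WithLp.toLp 2 fun a => empProc W P (fun w => sVec j ϑs w a) n ω :
      EuclideanSpace ℝ (ScoreIndex F j))‖

/-! ### Estimators -/

/-- `θhat n ω` maximizes the log-likelihood of the `M`-component model over `Θ̄_{ϑ_M}(c)`. -/
def IsMLE {Ω : Type*} (W : ℕ → Ω → Obs T d) (Θ : Set (EuclideanSpace ℝ F.ι)) (c : Constants)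
    (θhat : ℕ → Ω → MixParam F M) : Prop :=
  ∀ n ω, θhat n ω ∈ restrictedSpace Θ c M ∧
    ∀ ϑ ∈ restrictedSpace Θ c M, logLik W n ω ϑ ≤ logLik W n ω (θhat n ω)

/-- `Mhat n ω` maximizes `ℓ_n^M(ϑ̂_M) - p_{n,k_M}` over `M ∈ {1, …, M̄}`. -/
def IsPenalizedArgmax {Ω : Type*} (W : ℕ → Ω → Obs T d) (p : ℕ → ℕ → ℝ) (Mbar : ℕ)
    (θhat : (M : ℕ) → ℕ → Ω → MixParam F M) (Mhat : ℕ → Ω → ℕ) : Prop :=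
  ∀ n ω, 1 ≤ Mhat n ω ∧ Mhat n ω ≤ Mbar ∧ ∀ M, 1 ≤ M → M ≤ Mbar →
    logLik W n ω (θhat M n ω) - p n (numParams F M) ≤
      logLik W n ω (θhat (Mhat n ω) n ω) - p n (numParams F (Mhat n ω))

end PanelMixture

end

/-!
Let `ℓ*` be the log-likelihood of the true parameter. All log-likelihoods are compared with `ℓ*`,
and both claims follow from three facts about the maximized log-likelihood of the model with `M`
components: it falls short of `ℓ*` by a multiple of `n` if `M < M₀` (`logLik_underfitted`), and it
exceeds `ℓ*` by a nonnegative amount that is bounded in probability if `M = M₀`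
(`logLik_trueOrder_bounded`) or `M > M₀` (`logLik_overfitted_bounded`). Penalties of order `o(n)`
then rule out `M < M₀`, and penalties whose differences tend to infinity rule out `M > M₀`.

Away from the parameters that reproduce the true density `g*`, the argument is Wald's
(`logLik_separated`). It uses `log (g / g*) ≤ 2 log ((g + g*) / (2 g*))`: the right side is bounded
below, has negative mean unless `g = g*` almost surely, and has an integrable envelope on small
neighbourhoods because densities are locally bounded and `∫ √g* < ∞`. For the two families the
latter holds since the square root of a normal density is a multiple of a normal density, so that
products of such terms can be integrated one outcome at a time (`lintegral_normalProduct_le`). For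
`M < M₀` there is no parameter with `g = g*`, because the maximal expected log-likelihood strictly
increases up to `M₀`.

Near those parameters, the expansion `g / g* - 1 = tᵀ s + r` is used (`logLik_bounded_near`).
Since `E (g / g* - 1) ≤ 0`, the sum of the terms `g / g* - 1` over the sample is at most `√n ‖t‖`
times a factor bounded in probability; the remainder of `log` contributes at most a negative
multiple of `∑ min ((tᵀ s + r) ^ 2, 1)`, hence of `n ‖t‖ ^ 2`, as the information matrix is
nonsingular and `r` is small relative to `‖t‖`. A function `B √n ‖t‖ - c n ‖t‖ ^ 2` is bounded by a
constant.

It remains to see that a maximizer lies in the region of the expansion. The nonsingular information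
matrix makes the true component densities linearly independent (`weights_eq_of_mixture_eq`), so a
parameter that reproduces `g*` with true components distributes each true weight over the replicas
of its component. After sorting the components by replica this gives a partition, and nearby
parameters have coordinates `(ψ, τ)` with `ψ ∈ N_ε` (`exists_mem_nbhdPairs`). For `M = M₀` the same
expansion, of a larger model, is used at points with `λ = 0`.
-/


noncomputable section

namespace PanelMixture

/-! ### Events of large probability -/

section HighProb

variable {Ω : Type*} [MeasurableSpace Ω] {μ : Measure Ω}

/-- The events `E n` fail with (outer) probability at most `η` for all large `n`. Outer measure is
used throughout because the estimators are not assumed to be measurable. -/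
def HighProb (μ : Measure Ω) (η : ℝ) (E : ℕ → Ω → Prop) : Prop :=
  ∀ᶠ n in atTop, μ {ω | ¬ E n ω} ≤ ENNReal.ofReal η

lemma HighProb.mono {η : ℝ} {E E' : ℕ → Ω → Prop} (h : HighProb μ η E)
    (hE : ∀ᶠ n in atTop, ∀ ω, E n ω → E' n ω) : HighProb μ η E' := by
  filter_upwards [h, hE] with n hn hEn
  exact (measure_mono (Set.ofPred_subset_ofPred.2 fun ω => mt (hEn ω))).trans hn

lemma HighProb.and {η η' : ℝ} (hη : 0 ≤ η) (hη' : 0 ≤ η') {E E' : ℕ → Ω → Prop}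
    (h : HighProb μ η E) (h' : HighProb μ η' E') :
    HighProb μ (η + η') fun n ω => E n ω ∧ E' n ω := by
  filter_upwards [h, h'] with n hn hn'
  rw [ENNReal.ofReal_add hη hη']
  refine le_trans (measure_mono ?_) ((measure_union_le _ _).trans (add_le_add hn hn'))
  intro ω hω
  by_cases hE : E n ω
  · exact Or.inr fun h => hω ⟨hE, h⟩
  · exact Or.inl hE

lemma HighProb.forall_fintype {κ : Type*} [Fintype κ] {η : ℝ} (hη : 0 ≤ η)
    {E : κ → ℕ → Ω → Prop} (h : ∀ i, HighProb μ (η / Fintype.card κ) (E i)) :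
    HighProb μ η fun n ω => ∀ i, E i n ω := by
  have h' : ∀ᶠ n in atTop, ∀ i, μ {ω | ¬ E i n ω} ≤ ENNReal.ofReal (η / Fintype.card κ) :=
    eventually_all.2 h
  filter_upwards [h'] with n hn
  have hsub : {ω | ¬ ∀ i, E i n ω} ⊆ ⋃ i, {ω | ¬ E i n ω} := by
    intro ω hω
    simpa using hω
  refine (measure_mono hsub).trans ((measure_iUnion_fintype_le μ _).trans ?_)
  refine (Finset.sum_le_sum fun i _ => hn i).trans ?_
  rw [Finset.sum_const, nsmul_eq_mul, Finset.card_univ, ← ENNReal.ofReal_natCast,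
    ← ENNReal.ofReal_mul (Nat.cast_nonneg _)]
  apply ENNReal.ofReal_le_ofReal
  rcases isEmpty_or_nonempty κ with hκ | hκ
  · simpa using hη
  · rw [mul_div_cancel₀]
    exact_mod_cast Fintype.card_ne_zero

lemma HighProb.of_ae {η : ℝ} {E : ℕ → Ω → Prop} (h : ∀ᵐ ω ∂μ, ∀ n, E n ω) :
    HighProb μ η E := by
  refine Eventually.of_forall fun n => ?_
  have : μ {ω | ¬ E n ω} = 0 := h.mono fun ω hω => hω n
  simp [this]

lemma HighProb.of_tendstoInMeasure {X : ℕ → Ω → ℝ} {a : ℝ}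
    (h : TendstoInMeasure μ X atTop fun _ => a) {κ : ℝ} (hκ : 0 < κ) {η : ℝ} (hη : 0 < η) :
    HighProb μ η fun n ω => |X n ω - a| < κ := by
  have h1 := tendstoInMeasure_iff_dist.1 h κ hκ
  have h2 := (ENNReal.tendsto_nhds_zero.1 h1) (ENNReal.ofReal η) (by simpa using hη)
  filter_upwards [h2] with n hn
  simpa [Real.dist_eq, not_lt] using hn

end HighProb

/-! ### Averages over the sample -/

section Sample

variable {T d : ℕ} {F : ComponentFamily T d} {Ω : Type*} [MeasurableSpace Ω] {μ : Measure Ω}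
  {PX : Measure (Fin T → Fin d → ℝ)} {M : ℕ} {ϑ : MixParam F M}
  {W : ℕ → Ω → Obs T d}

lemma IsSample.isProbabilityMeasure [IsProbabilityMeasure μ] (hW : IsSample μ PX ϑ W) :
    IsProbabilityMeasure (dataLaw PX ϑ) := by
  rw [← hW.law 0]
  exact Measure.isProbabilityMeasure_map (hW.measurable 0).aemeasurable

lemma IsSample.ae_forall (hW : IsSample μ PX ϑ W) {q : Obs T d → Prop}
    (h : ∀ᵐ w ∂(dataLaw PX ϑ), q w) : ∀ᵐ ω ∂μ, ∀ i, q (W i ω) := by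
  refine ae_all_iff.2 fun i => ?_
  rw [← hW.law i] at h
  exact ae_of_ae_map (hW.measurable i).aemeasurable h

/-- The law of large numbers, as an event of large probability. -/
lemma IsSample.average_close [IsProbabilityMeasure μ] (hW : IsSample μ PX ϑ W)
    {u : Obs T d → ℝ} (hm : Measurable u) (hu : Integrable u (dataLaw PX ϑ))
    {κ : ℝ} (hκ : 0 < κ) {η : ℝ} (hη : 0 < η) :
    HighProb μ η fun n ω =>
      |(∑ i ∈ Finset.range n, u (W i ω)) / n - ∫ w, u w ∂(dataLaw PX ϑ)| < κ := by
  have hmeas : ∀ i, Measurable (fun ω => u (W i ω)) := fun i => hm.comp (hW.measurable i)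
  have hint : Integrable (fun ω => u (W 0 ω)) μ := by
    have := hu
    rw [← hW.law 0] at this
    exact this.comp_measurable (hW.measurable 0)
  have hmean : ∫ ω, u (W 0 ω) ∂μ = ∫ w, u w ∂(dataLaw PX ϑ) := by
    rw [← hW.law 0, integral_map (hW.measurable 0).aemeasurable hm.aestronglyMeasurable]
  have hlln := strong_law_ae_real (fun i ω => u (W i ω)) hint
    (fun i k hik => (hW.indep.indepFun hik).comp hm hm)
    (fun i => by
      have : IdentDistrib (W i) (W 0) μ μ :=
        ⟨(hW.measurable i).aemeasurable, (hW.measurable 0).aemeasurable, by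
          rw [hW.law i, hW.law 0]⟩
      exact this.comp hm)
  rw [hmean] at hlln
  refine HighProb.of_tendstoInMeasure (tendstoInMeasure_of_tendsto_ae (fun n => ?_) hlln) hκ hη
  exact ((Finset.measurable_fun_sum _ fun i _ => hmeas i).div_const _).aestronglyMeasurable

end Sample

/-! ### Inequalities for the logarithm -/

/-- The inequality `log √l ≤ √l - 1`, with the squared Hellinger-type term `(√l - 1) ^ 2` made
explicit. -/
lemma log_le_sub_hellinger {l : ℝ} (hl : 0 < l) :
    Real.log l ≤ l - 1 - (√l - 1) ^ 2 := by
  have h1 := Real.log_le_sub_one_of_pos (Real.sqrt_pos.2 hl)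
  rw [Real.log_sqrt hl.le] at h1
  nlinarith [Real.sq_sqrt hl.le]

/-- A quadratic upper bound for the logarithm of a density ratio `l = 1 + a + r`, in which the
main term `a` may be truncated to `b = 0`. -/
lemma log_le_quadratic {l a r b : ℝ} (hl : 0 < l) (h : l - 1 = a + r) (hb : b = a ∨ b = 0)
    (hb1 : b ^ 2 ≤ 1) : Real.log l ≤ (l - 1) - (b ^ 2 / 2 - r ^ 2) / 8 := by
  refine (log_le_sub_hellinger hl).trans ?_
  have hs := Real.sq_sqrt hl.le
  have hs0 := Real.sqrt_nonneg l
  set u := √l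
  have hx : (u - 1) * (u + 1) = a + r := by rw [← h, ← hs]; ring
  have key : (b ^ 2 / 2 - r ^ 2) / 8 ≤ (u - 1) ^ 2 := by
    have hb2 : b ^ 2 / 2 - r ^ 2 ≤ (a + r) ^ 2 := by
      rcases hb with rfl | rfl
      · nlinarith [sq_nonneg (b + 2 * r)]
      · nlinarith [sq_nonneg (a + r), sq_nonneg r]
    rcases le_total u (3 / 2) with hu | hu
    · rw [← hx] at hb2
      have : (u + 1) ^ 2 ≤ 8 := by nlinarith
      have h3 : ((u - 1) * (u + 1)) ^ 2 ≤ 8 * (u - 1) ^ 2 := by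
        nlinarith [mul_le_mul_of_nonneg_left this (sq_nonneg (u - 1))]
      linarith
    · nlinarith [sq_nonneg r]
  linarith

lemma log_one_add_le_two_mul_sqrt {z : ℝ} (hz : 0 ≤ z) : Real.log (1 + z) ≤ 2 * √z := by
  have h1 := Real.log_le_sub_one_of_pos (Real.sqrt_pos.2 (by linarith : 0 < 1 + z))
  rw [Real.log_sqrt (by linarith)] at h1
  have h2 : √(1 + z) ≤ 1 + √z := by
    rw [Real.sqrt_le_left (by positivity)]
    nlinarith [Real.sq_sqrt hz, Real.sqrt_nonneg z]
  linarith

/-! ### Normal densities and iterated integration -/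

lemma sum_fullWeights {M : ℕ} (hM : 1 ≤ M) (a : Fin (M - 1) → ℝ) : ∑ k, fullWeights a k = 1 := by
  obtain ⟨m, rfl⟩ : ∃ m, M = m + 1 := ⟨M - 1, by omega⟩
  rw [Fin.sum_univ_castSucc]
  have h1 : ∀ i : Fin m, fullWeights a i.castSucc = a i := fun i => by
    have : (i : ℕ) < m + 1 - 1 := i.2
    simp [fullWeights]
  have h2 : fullWeights a (Fin.last m) = 1 - ∑ i, a i := by
    simp [fullWeights]
  rw [h2, Finset.sum_congr rfl fun i _ => h1 i]
  exact add_sub_cancel _ _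

lemma continuous_fullWeights {M : ℕ} (k : Fin M) :
    Continuous fun a : Fin (M - 1) → ℝ => fullWeights a k := by
  unfold fullWeights
  split_ifs <;> fun_prop

lemma contDiff_fullWeights {M : ℕ} (k : Fin M) (n : WithTop ℕ∞) :
    ContDiff ℝ n fun a : Fin (M - 1) → ℝ => fullWeights a k := by
  unfold fullWeights
  split_ifs <;> fun_prop

lemma normalPdf_pos {m v y : ℝ} (hv : 0 < v) : 0 < normalPdf m v y := by
  unfold normalPdf
  positivity

lemma normalPdf_le {m v y b : ℝ} (hb : 0 < b) (hv : b ≤ v) : normalPdf m v y ≤ (√b)⁻¹ := by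
  unfold normalPdf
  have h1 : (√v)⁻¹ ≤ (√b)⁻¹ := by gcongr
  have h2 : (√(2 * Real.pi))⁻¹ ≤ 1 := by
    apply inv_le_one_of_one_le₀
    rw [Real.one_le_sqrt]
    linarith [Real.pi_gt_three]
  have h3 : Real.exp (-((y - m) / √v) ^ 2 / 2) ≤ 1 := by
    rw [Real.exp_le_one_iff]
    nlinarith [sq_nonneg ((y - m) / √v)]
  calc (√v)⁻¹ * ((√(2 * Real.pi))⁻¹ * Real.exp (-((y - m) / √v) ^ 2 / 2))
      ≤ (√b)⁻¹ * (1 * 1) := by gcongr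
    _ = (√b)⁻¹ := by ring

lemma normalPdf_eq_gaussianPDFReal {m v : ℝ} (hv : 0 < v) (y : ℝ) :
    normalPdf m v y = gaussianPDFReal m v.toNNReal y := by
  unfold normalPdf gaussianPDFReal
  have hs := Real.sq_sqrt hv.le
  have h1 : √(2 * Real.pi * v) = √v * √(2 * Real.pi) := by
    rw [mul_comm, Real.sqrt_mul hv.le]
  rw [Real.coe_toNNReal v hv.le]
  rw [h1, mul_inv, mul_assoc, div_pow, hs]
  congr 3
  ring

lemma lintegral_normalPdf {m v : ℝ} (hv : 0 < v) :
    ∫⁻ y, ENNReal.ofReal (normalPdf m v y) = 1 := by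
  simp_rw [normalPdf_eq_gaussianPDFReal hv]
  refine lintegral_gaussianPDFReal_eq_one m ?_
  simpa using hv

/-- The square root of a normal density is a multiple of the normal density with twice the
variance. -/
lemma sqrt_normalPdf {m v : ℝ} (hv : 0 < v) (y : ℝ) :
    √(normalPdf m v y) =
      (√((√v)⁻¹ * (√(2 * Real.pi))⁻¹) / ((√(2 * v))⁻¹ * (√(2 * Real.pi))⁻¹)) *
        normalPdf m (2 * v) y := by
  unfold normalPdf
  rw [← mul_assoc, Real.sqrt_mul (by positivity), ← Real.exp_half, ← mul_assoc (√(2 * v))⁻¹,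
    ← mul_assoc, div_mul_cancel₀ _ (by positivity)]
  congr 2
  rw [div_pow, div_pow, Real.sq_sqrt hv.le, Real.sq_sqrt (by positivity)]
  field_simp

lemma sqrt_sum_le {κ : Type*} (s : Finset κ) (f : κ → ℝ) (hf : ∀ i, 0 ≤ f i) :
    √(∑ i ∈ s, f i) ≤ ∑ i ∈ s, √(f i) := by
  classical
  induction s using Finset.induction_on with
  | empty => simp
  | insert a s ha ih =>
    rw [Finset.sum_insert ha, Finset.sum_insert ha]
    refine le_trans ?_ (add_le_add_right ih _)
    have h1 := Real.sq_sqrt (hf a)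
    have h2 := Real.sq_sqrt (Finset.sum_nonneg fun i (_ : i ∈ s) => hf i)
    rw [Real.sqrt_le_left (by positivity)]
    nlinarith [mul_nonneg (Real.sqrt_nonneg (f a)) (Real.sqrt_nonneg (∑ i ∈ s, f i))]

lemma sqrt_prod_eq {κ : Type*} (s : Finset κ) (f : κ → ℝ) (hf : ∀ i, 0 ≤ f i) :
    √(∏ i ∈ s, f i) = ∏ i ∈ s, √(f i) := by
  classical
  induction s using Finset.induction_on with
  | empty => simp
  | insert a s ha ih =>
    rw [Finset.prod_insert ha, Finset.prod_insert ha, Real.sqrt_mul (hf a), ih]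

/-- A product of conditional densities, the `t`-th depending on the coordinates up to `t`, is
integrated one coordinate at a time, the largest index first. -/
lemma lmarginal_prod_le {T : ℕ} (H : Fin T → (Fin T → ℝ) → ENNReal) (C : Fin T → ENNReal)
    (hm : ∀ t, Measurable (H t))
    (hdep : ∀ t i, t < i → ∀ y u, H t (Function.update y i u) = H t y)
    (hint : ∀ t y, ∫⁻ u, H t (Function.update y t u) ≤ C t) (s : Finset (Fin T)) :
    ∀ y, lmarginal (fun _ => (volume : Measure ℝ)) s (fun y => ∏ t ∈ s, H t y) y
      ≤ ∏ t ∈ s, C t := by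
  induction s using Finset.induction_on_max with
  | empty => intro y; simp
  | insert a s ha ih =>
    intro y
    have has : a ∉ s := fun h => lt_irrefl _ (ha a h)
    have hmeas : ∀ s : Finset (Fin T), Measurable fun y => ∏ t ∈ s, H t y :=
      fun s => Finset.measurable_fun_prod _ fun t _ => hm t
    rw [lmarginal_insert' _ (hmeas _) has]
    have hle : (fun y => ∫⁻ u, ∏ t ∈ insert a s, H t (Function.update y a u))
        ≤ fun y => C a * ∏ t ∈ s, H t y := by
      intro y
      have h1 : ∀ u, ∏ t ∈ insert a s, H t (Function.update y a u) =
          H a (Function.update y a u) * ∏ t ∈ s, H t y := fun u => by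
        rw [Finset.prod_insert has]
        congr 1
        exact Finset.prod_congr rfl fun t ht => hdep t a (ha t ht) y u
      have hma : Measurable fun u => H a (Function.update y a u) :=
        (hm a).comp (measurable_update y)
      simp_rw [h1]
      rw [lintegral_mul_const _ hma]
      exact mul_le_mul_left (hint a y) _
    refine (lmarginal_mono hle y).trans ?_
    rw [Finset.prod_insert has]
    have h2 : lmarginal (fun _ => (volume : Measure ℝ)) s (fun y => C a * ∏ t ∈ s, H t y) y
        = C a * lmarginal (fun _ => (volume : Measure ℝ)) s (fun y => ∏ t ∈ s, H t y) y := by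
      unfold lmarginal
      rw [lintegral_const_mul]
      exact (hmeas s).comp (by fun_prop)
    rw [h2]
    exact mul_le_mul_right (ih y) _

lemma lintegral_prod_le {T : ℕ} (H : Fin T → (Fin T → ℝ) → ENNReal) (C : Fin T → ENNReal)
    (hm : ∀ t, Measurable (H t))
    (hdep : ∀ t i, t < i → ∀ y u, H t (Function.update y i u) = H t y)
    (hint : ∀ t y, ∫⁻ u, H t (Function.update y t u) ≤ C t) :
    ∫⁻ y, ∏ t, H t y ≤ ∏ t, C t := by
  rw [volume_pi, lintegral_eq_lmarginal_univ 0]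
  exact lmarginal_prod_le H C hm hdep hint Finset.univ 0

/-! ### Products of normal mixtures -/

section NormalProduct

variable {T d K : ℕ}

/-- `∏ₜ ∑ₖ bₜₖ N(yₜ; mₜₖ(w), vₜ)`: the common shape of the two component densities. -/
def normalProduct (b : Fin T → Fin K → ℝ) (m : Fin T → Fin K → Obs T d → ℝ) (v : Fin T → ℝ)
    (w : Obs T d) : ℝ :=
  ∏ t, ∑ k, b t k * normalPdf (m t k w) (v t) (w.1 t)

variable {b : Fin T → Fin K → ℝ} {m : Fin T → Fin K → Obs T d → ℝ} {v : Fin T → ℝ}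

lemma normalProduct_pos (hb : ∀ t k, 0 ≤ b t k) (hb1 : ∀ t, ∑ k, b t k = 1) (hv : ∀ t, 0 < v t)
    (w : Obs T d) : 0 < normalProduct b m v w := by
  refine Finset.prod_pos fun t _ => ?_
  have h : ∃ k ∈ Finset.univ, 0 < b t k := by
    by_contra! h
    have h0 := Finset.sum_nonpos h
    rw [hb1 t] at h0
    linarith
  obtain ⟨k, hk, hbk⟩ := h
  exact Finset.sum_pos' (fun k _ => mul_nonneg (hb t k) (normalPdf_pos (hv t)).le)
    ⟨k, hk, mul_pos hbk (normalPdf_pos (hv t))⟩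

lemma normalProduct_le (hb : ∀ t k, 0 ≤ b t k) (hb1 : ∀ t, ∑ k, b t k = 1) {c : Fin T → ℝ}
    (hc : ∀ t, 0 < c t) (hv : ∀ t, c t ≤ v t) (w : Obs T d) :
    normalProduct b m v w ≤ ∏ t, (√(c t))⁻¹ := by
  refine Finset.prod_le_prod (fun t _ => Finset.sum_nonneg fun k _ =>
    mul_nonneg (hb t k) (normalPdf_pos ((hc t).trans_le (hv t))).le) fun t _ => ?_
  calc ∑ k, b t k * normalPdf (m t k w) (v t) (w.1 t) ≤ ∑ k, b t k * (√(c t))⁻¹ :=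
        Finset.sum_le_sum fun k _ =>
          mul_le_mul_of_nonneg_left (normalPdf_le (hc t) (hv t)) (hb t k)
    _ = (√(c t))⁻¹ := by rw [← Finset.sum_mul, hb1, one_mul]

lemma measurable_normalPdf_comp {α : Type*} [MeasurableSpace α] {f g : α → ℝ} (hf : Measurable f)
    (hg : Measurable g) (c : ℝ) : Measurable fun x => normalPdf (f x) c (g x) := by
  unfold normalPdf
  fun_prop

lemma lintegral_normalProduct_le (hb : ∀ t k, 0 ≤ b t k) (hv : ∀ t, 0 < v t)
    (hm : ∀ t k, Measurable (m t k))
    (hdep : ∀ t k i, t ≤ i → ∀ y x u, m t k (Function.update y i u, x) = m t k (y, x))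
    (PX : Measure (Fin T → Fin d → ℝ)) [IsProbabilityMeasure PX] :
    ∫⁻ w, ENNReal.ofReal (normalProduct b m v w)
      ∂((volume : Measure (Fin T → ℝ)).prod PX) ≤ ∏ t, ENNReal.ofReal (∑ k, b t k) := by
  have hterm : ∀ t k w, 0 ≤ b t k * normalPdf (m t k w) (v t) (w.1 t) := fun t k w =>
    mul_nonneg (hb t k) (normalPdf_pos (hv t)).le
  have hmeas1 : ∀ t, Measurable fun w : Obs T d =>
      ∑ k, b t k * normalPdf (m t k w) (v t) (w.1 t) := fun t =>
    Finset.measurable_fun_sum _ fun k _ =>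
      (measurable_normalPdf_comp (hm t k) (by fun_prop) _).const_mul _
  have hmeas : Measurable fun w => ENNReal.ofReal (normalProduct b m v w) :=
    (Finset.measurable_fun_prod _ fun t _ => hmeas1 t).ennreal_ofReal
  rw [lintegral_prod_symm _ hmeas.aemeasurable]
  calc ∫⁻ x, (∫⁻ y, ENNReal.ofReal (normalProduct b m v (y, x))) ∂PX
      ≤ ∫⁻ _x, ∏ t, ENNReal.ofReal (∑ k, b t k) ∂PX := by
        refine lintegral_mono fun x => ?_
        have hprod : ∀ y, ENNReal.ofReal (normalProduct b m v (y, x)) =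
            ∏ t, ENNReal.ofReal (∑ k, b t k * normalPdf (m t k (y, x)) (v t) (y t)) := fun y =>
          ENNReal.ofReal_prod_of_nonneg fun t _ => Finset.sum_nonneg fun k _ => hterm t k (y, x)
        simp_rw [hprod]
        refine lintegral_prod_le _ _ (fun t => ?_) (fun t i hti y u => ?_) (fun t y => ?_)
        · exact ((hmeas1 t).comp (measurable_id.prodMk measurable_const)).ennreal_ofReal
        · simp [hdep t _ i hti.le, Function.update_of_ne hti.ne]
        · have h1 : ∀ u, ENNReal.ofReal (∑ k, b t k *
              normalPdf (m t k (Function.update y t u, x)) (v t) (Function.update y t u t)) =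
              ∑ k, ENNReal.ofReal (b t k) *
                ENNReal.ofReal (normalPdf (m t k (y, x)) (v t) u) := fun u => by
            rw [ENNReal.ofReal_sum_of_nonneg fun k _ =>
              mul_nonneg (hb t k) (normalPdf_pos (hv t)).le]
            refine Finset.sum_congr rfl fun k _ => ?_
            rw [ENNReal.ofReal_mul (hb t k), hdep t k t le_rfl, Function.update_self]
          simp_rw [h1]
          have hN : ∀ k, Measurable fun u =>
              ENNReal.ofReal (normalPdf (m t k (y, x)) (v t) u) := fun k =>
            (measurable_normalPdf_comp measurable_const measurable_id _).ennreal_ofReal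
          rw [lintegral_finsetSum _ fun k _ => (hN k).const_mul _,
            ENNReal.ofReal_sum_of_nonneg fun k _ => hb t k]
          refine Finset.sum_le_sum fun k _ => ?_
          rw [lintegral_const_mul _ (hN k), lintegral_normalPdf (hv t), mul_one]
    _ = ∏ t, ENNReal.ofReal (∑ k, b t k) := by simp

lemma lintegral_sqrt_normalProduct_lt_top (hb : ∀ t k, 0 ≤ b t k) (hv : ∀ t, 0 < v t)
    (hm : ∀ t k, Measurable (m t k))
    (hdep : ∀ t k i, t ≤ i → ∀ y x u, m t k (Function.update y i u, x) = m t k (y, x))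
    (PX : Measure (Fin T → Fin d → ℝ)) [IsProbabilityMeasure PX] :
    ∫⁻ w, ENNReal.ofReal √(normalProduct b m v w)
      ∂((volume : Measure (Fin T → ℝ)).prod PX) < ⊤ := by
  set C : Fin T → ℝ := fun t =>
    √((√(v t))⁻¹ * (√(2 * Real.pi))⁻¹) / ((√(2 * v t))⁻¹ * (√(2 * Real.pi))⁻¹) with hC
  have hle : ∀ w, √(normalProduct b m v w) ≤
      normalProduct (fun t k => √(b t k) * C t) m (fun t => 2 * v t) w := by
    intro w
    have hterm : ∀ t k, 0 ≤ b t k * normalPdf (m t k w) (v t) (w.1 t) := fun t k =>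
      mul_nonneg (hb t k) (normalPdf_pos (hv t)).le
    unfold normalProduct
    rw [sqrt_prod_eq _ _ fun t => Finset.sum_nonneg fun k _ => hterm t k]
    refine Finset.prod_le_prod (fun t _ => Real.sqrt_nonneg _) fun t _ => ?_
    refine (sqrt_sum_le _ _ fun k => hterm t k).trans (Finset.sum_le_sum fun k _ => ?_)
    rw [Real.sqrt_mul (hb t k), sqrt_normalPdf (hv t), mul_assoc]
  refine (lintegral_mono fun w => ENNReal.ofReal_le_ofReal (hle w)).trans_lt ?_
  refine (lintegral_normalProduct_le (fun t k => ?_) (fun t => ?_) hm hdep PX).trans_lt ?_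
  · positivity
  · exact mul_pos two_pos (hv t)
  · exact ENNReal.prod_lt_top fun t _ => ENNReal.ofReal_lt_top

end NormalProduct

/-! ### Analytic properties of the component densities -/

/-- What the argument uses of the component densities: they are smooth in `(θ, w)`, positive,
(sub)normalized, have an integrable square root and are locally bounded in `θ` uniformly in `w`. -/
structure ComponentFamily.IsRegular {T d : ℕ} (F : ComponentFamily T d) : Prop where
  nonempty : Nonempty F.ι
  smooth : ∀ θ ∈ F.domain, ∀ w, ContDiffAt ℝ (⊤ : ℕ∞)
    (fun z : EuclideanSpace ℝ F.ι × Obs T d => F.density z.1 z.2) (θ, w)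
  pos : ∀ θ ∈ F.domain, ∀ w, 0 < F.density θ w
  lintegral_le : ∀ θ ∈ F.domain, ∀ (PX : Measure (Fin T → Fin d → ℝ)) [IsProbabilityMeasure PX],
    ∫⁻ w, ENNReal.ofReal (F.density θ w) ∂((volume : Measure (Fin T → ℝ)).prod PX) ≤ 1
  lintegral_sqrt_lt_top : ∀ θ ∈ F.domain,
    ∀ (PX : Measure (Fin T → Fin d → ℝ)) [IsProbabilityMeasure PX],
    ∫⁻ w, ENNReal.ofReal √(F.density θ w) ∂((volume : Measure (Fin T → ℝ)).prod PX) < ⊤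
  locally_bounded : ∀ θ ∈ F.domain, ∃ C : ℝ, ∀ᶠ θ' in 𝓝[F.domain] θ, ∀ w, F.density θ' w ≤ C

section Smooth

variable {E X : Type*} [NormedAddCommGroup E] [NormedSpace ℝ E] [NormedAddCommGroup X]
  [NormedSpace ℝ X]

/-- Iterated derivatives in the first variable of a jointly smooth function are jointly smooth. -/
lemma contDiffAt_iteratedFDeriv_fst (f : E → X → ℝ) (p : ℕ) {θ : E} {w : X}
    (h : ContDiffAt ℝ (⊤ : ℕ∞) (fun z : E × X => f z.1 z.2) (θ, w)) :
    ContDiffAt ℝ (⊤ : ℕ∞) (fun z : E × X => iteratedFDeriv ℝ p (fun v => f v z.2) z.1) (θ, w) := by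
  induction p with
  | zero =>
    simp_rw [iteratedFDeriv_zero_eq_comp]
    have hL : ContDiff ℝ (⊤ : ℕ∞) (continuousMultilinearCurryFin0 ℝ E ℝ).symm :=
      LinearIsometryEquiv.contDiff _
    exact hL.contDiffAt.comp (θ, w) h
  | succ p ih =>
    simp_rw [iteratedFDeriv_succ_eq_comp_left]
    have hL : ContDiff ℝ (⊤ : ℕ∞)
        (continuousMultilinearCurryLeftEquiv ℝ (fun _ : Fin (p + 1) => E) ℝ).symm :=
      LinearIsometryEquiv.contDiff _
    refine hL.contDiffAt.comp (θ, w) ?_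
    refine ContDiffAt.fderiv (f := fun (z : E × X) v => iteratedFDeriv ℝ p (fun v => f v z.2) v)
      (g := fun z : E × X => z.1) (n := (⊤ : ℕ∞)) ?_ contDiffAt_fst (by simp)
    have : ContDiffAt ℝ (⊤ : ℕ∞) (fun z : (E × X) × E => (z.2, z.1.2)) ((θ, w), θ) := by fun_prop
    exact ContDiffAt.comp ((θ, w), θ) (g := fun z : E × X =>
      iteratedFDeriv ℝ p (fun v => f v z.2) z.1) ih this

lemma ContDiffAt.normalPdf_comp {f g h : E → ℝ} {x : E} {n : WithTop ℕ∞}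
    (hf : ContDiffAt ℝ n f x) (hg : ContDiffAt ℝ n g x) (hh : ContDiffAt ℝ n h x)
    (hx : 0 < g x) : ContDiffAt ℝ n (fun z => normalPdf (f z) (g z) (h z)) x := by
  unfold normalPdf
  have h1 : ContDiffAt ℝ n (fun z => √(g z)) x := hg.sqrt hx.ne'
  have h2 : √(g x) ≠ 0 := (Real.sqrt_pos.2 hx).ne'
  exact (h1.inv h2).mul (contDiffAt_const.mul
    ((((hh.sub hf).div h1 h2).pow 2).neg.div_const 2).exp)

end Smooth

variable {T d K : ℕ}

lemma contDiff_weights {ι : Type*} [Fintype ι] (e : Fin (K - 1) → ι) (k : Fin K)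
    (n : WithTop ℕ∞) :
    ContDiff ℝ n fun θ : EuclideanSpace ℝ ι => fullWeights (fun i => θ (e i)) k := by
  refine (contDiff_fullWeights k n).comp ?_
  fun_prop

/-- Products of normal mixtures whose means and variances depend smoothly on `θ`, the `t`-th mean
being a function of `y₁, …, y_{t-1}` and `x`, form a regular family. -/
lemma ComponentFamily.isRegular_of_normalProduct {F : ComponentFamily T d} (hι : Nonempty F.ι)
    {b : EuclideanSpace ℝ F.ι → Fin K → ℝ}
    {m : EuclideanSpace ℝ F.ι → Fin T → Fin K → Obs T d → ℝ}
    {v : EuclideanSpace ℝ F.ι → Fin T → ℝ}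
    (hdens : ∀ θ w, F.density θ w = normalProduct (fun _ => b θ) (m θ) (v θ) w)
    (hb : ∀ θ ∈ F.domain, ∀ k, 0 ≤ b θ k) (hb1 : ∀ θ, ∑ k, b θ k = 1)
    (hv : ∀ θ ∈ F.domain, ∀ t, 0 < v θ t)
    (hbs : ∀ k, ContDiff ℝ (⊤ : ℕ∞) fun θ => b θ k)
    (hms : ∀ t k, ContDiff ℝ (⊤ : ℕ∞)
      fun z : EuclideanSpace ℝ F.ι × Obs T d => m z.1 t k z.2)
    (hvs : ∀ t, ContDiff ℝ (⊤ : ℕ∞) fun θ => v θ t)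
    (hdep : ∀ θ t k i, t ≤ i → ∀ y x u,
      m θ t k (Function.update y i u, x) = m θ t k (y, x)) : F.IsRegular := by
  have hmeas : ∀ θ t k, Measurable (m θ t k) := fun θ t k =>
    ((hms t k).continuous.comp (Continuous.prodMk_right θ)).measurable
  refine ⟨hι, fun θ hθ w => ?_, fun θ hθ w => ?_, fun θ hθ PX _ => ?_, fun θ hθ PX _ => ?_,
    fun θ hθ => ?_⟩
  · simp_rw [hdens]
    refine contDiffAt_prod fun t _ => ContDiffAt.sum fun k _ =>
      (((hbs k).comp contDiff_fst).contDiffAt).mul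
        (ContDiffAt.normalPdf_comp (hms t k).contDiffAt ((hvs t).comp contDiff_fst).contDiffAt
          (by fun_prop) (hv θ hθ t))
  · rw [hdens]
    exact normalProduct_pos (fun _ => hb θ hθ) (fun _ => hb1 θ) (hv θ hθ) w
  · simp_rw [hdens]
    refine (lintegral_normalProduct_le (fun _ => hb θ hθ) (hv θ hθ) (hmeas θ)
      (hdep θ) PX).trans ?_
    simp [hb1]
  · simp_rw [hdens]
    exact lintegral_sqrt_normalProduct_lt_top (fun _ => hb θ hθ) (hv θ hθ) (hmeas θ)
      (hdep θ) PX
  · refine ⟨∏ t, (√(v θ t / 2))⁻¹, ?_⟩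
    have hlt : ∀ᶠ θ' in 𝓝 θ, ∀ t, v θ t / 2 < v θ' t := eventually_all.2 fun t =>
      (hvs t).continuous.continuousAt.eventually (lt_mem_nhds (half_lt_self (hv θ hθ t)))
    filter_upwards [self_mem_nhdsWithin, nhdsWithin_le_nhds hlt] with θ' hθ' hlt w
    rw [hdens]
    exact normalProduct_le (fun _ => hb θ' hθ') (fun _ => hb1 θ')
      (fun t => half_pos (hv θ hθ t)) (fun t => (hlt t).le) w

lemma staticFamily_isRegular (hK : 1 ≤ K) : (staticFamily T d K).IsRegular := by
  let b : EuclideanSpace ℝ (StaticCoord d K) → Fin K → ℝ :=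
    fun θ k => fullWeights (fun i => θ (.tau i)) k
  let m : EuclideanSpace ℝ (StaticCoord d K) → Fin T → Fin K → Obs T d → ℝ :=
    fun θ t k w => θ (.mu k) + ∑ i, w.2 t i * θ (.beta i)
  have hms : ∀ t k, ContDiff ℝ (⊤ : ℕ∞)
      fun z : EuclideanSpace ℝ (StaticCoord d K) × Obs T d => m z.1 t k z.2 := fun t k => by
    fun_prop
  have hvs : ∀ _ : Fin T, ContDiff ℝ (⊤ : ℕ∞)
      fun θ : EuclideanSpace ℝ (StaticCoord d K) => θ .sigmaSq := fun t => by
    fun_prop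
  exact ComponentFamily.isRegular_of_normalProduct (F := staticFamily T d K) (b := b) (m := m)
    (v := fun θ _ => θ StaticCoord.sigmaSq) ⟨StaticCoord.sigmaSq⟩ (fun θ w => rfl)
    (fun θ hθ => hθ.1) (fun θ => sum_fullWeights hK _) (fun θ hθ _ => hθ.2)
    (fun k => contDiff_weights StaticCoord.tau k _) hms hvs (fun θ t k i hti y x u => rfl)

lemma dynamicFamily_isRegular (hK : 1 ≤ K) : (dynamicFamily T d K).IsRegular := by
  let b : EuclideanSpace ℝ (DynamicCoord d K) → Fin K → ℝ :=
    fun θ k => fullWeights (fun i => θ (.tau i)) k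
  let m : EuclideanSpace ℝ (DynamicCoord d K) → Fin T → Fin K → Obs T d → ℝ :=
    fun θ t k w => if (t : ℕ) = 0 then θ (.muInit k) + ∑ i, w.2 t i * θ (.betaInit i) else
      θ (.mu k) + θ .rho * w.1 ⟨(t : ℕ) - 1, (Nat.sub_le _ _).trans_lt t.2⟩
        + ∑ i, w.2 t i * θ (.beta i)
  let v : EuclideanSpace ℝ (DynamicCoord d K) → Fin T → ℝ :=
    fun θ t => if (t : ℕ) = 0 then θ .sigmaSqInit else θ .sigmaSq
  have hms : ∀ t k, ContDiff ℝ (⊤ : ℕ∞)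
      fun z : EuclideanSpace ℝ (DynamicCoord d K) × Obs T d => m z.1 t k z.2 := fun t k => by
    simp only [m]
    split_ifs <;> fun_prop
  have hvs : ∀ t : Fin T, ContDiff ℝ (⊤ : ℕ∞)
      fun θ : EuclideanSpace ℝ (DynamicCoord d K) => v θ t := fun t => by
    simp only [v]
    split_ifs <;> fun_prop
  refine ComponentFamily.isRegular_of_normalProduct (F := dynamicFamily T d K) (b := b) (m := m)
    (v := v) ⟨DynamicCoord.sigmaSq⟩ (fun θ w => ?_) (fun θ hθ => hθ.1)
    (fun θ => sum_fullWeights hK _) (fun θ hθ t => ?_)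
    (fun k => contDiff_weights DynamicCoord.tau k _) hms hvs (fun θ t k i hti y x u => ?_)
  · simp only [dynamicFamily, normalProduct, b, m, v]
    refine Finset.prod_congr rfl fun t _ => Finset.sum_congr rfl fun k _ => ?_
    split_ifs <;> rfl
  · simp only [v]
    split_ifs
    exacts [hθ.2.1, hθ.2.2]
  · simp only [m]
    split_ifs with ht
    · rfl
    · rw [Function.update_of_ne]
      intro h
      have h1 := congrArg Fin.val h
      have h2 : (t : ℕ) ≤ i := hti
      simp only at h1
      omega

lemma family_isRegular (hK : 1 ≤ K) (kind : ModelKind) : (family T d K kind).IsRegular := by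
  cases kind
  · exact staticFamily_isRegular hK
  · exact dynamicFamily_isRegular hK

namespace ComponentFamily.IsRegular

variable {F : ComponentFamily T d} {θ : EuclideanSpace ℝ F.ι}

lemma measurable_iteratedFDeriv (hF : F.IsRegular) (hθ : θ ∈ F.domain) (p : ℕ)
    (m : Fin p → EuclideanSpace ℝ F.ι) :
    Measurable fun w => iteratedFDeriv ℝ p (fun v => F.density v w) θ m := by
  refine Continuous.measurable (continuous_iff_continuousAt.2 fun w => ?_)
  have h := (contDiffAt_iteratedFDeriv_fst F.density p (hF.smooth θ hθ w)).continuousAt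
  have h2 : ContinuousAt (fun w : Obs T d => iteratedFDeriv ℝ p (fun v => F.density v w) θ) w :=
    h.comp (f := fun w : Obs T d => (θ, w)) (by fun_prop)
  exact ((ContinuousMultilinearMap.apply ℝ (fun _ : Fin p => EuclideanSpace ℝ F.ι) ℝ
    m).continuous.continuousAt).comp h2

lemma measurable_density (hF : F.IsRegular) (hθ : θ ∈ F.domain) : Measurable (F.density θ) := by
  simpa using hF.measurable_iteratedFDeriv hθ 0 ![]

lemma measurable_fderiv (hF : F.IsRegular) (hθ : θ ∈ F.domain) (v : EuclideanSpace ℝ F.ι) :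
    Measurable fun w => fderiv ℝ (fun v => F.density v w) θ v := by
  simpa [iteratedFDeriv_one_apply] using hF.measurable_iteratedFDeriv hθ 1 ![v]

lemma continuousAt_density (hF : F.IsRegular) (hθ : θ ∈ F.domain) (w : Obs T d) :
    ContinuousAt (fun v => F.density v w) θ :=
  (hF.smooth θ hθ w).continuousAt.comp (f := fun v => (v, w)) (by fun_prop)

end ComponentFamily.IsRegular

/-! ### The mixture density -/

section Mixture

variable {T d : ℕ} {F : ComponentFamily T d} {M : ℕ} {ϑ : MixParam F M}

lemma sum_weight (hM : 1 ≤ M) (ϑ : MixParam F M) : ∑ k, weight ϑ k = 1 := sum_fullWeights hM _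

lemma paramSpace_mono {Θ Θ' : Set (EuclideanSpace ℝ F.ι)} (h : Θ ⊆ Θ') (M : ℕ) :
    paramSpace Θ M ⊆ paramSpace Θ' M := fun _ hϑ => ⟨hϑ.1, fun k => h (hϑ.2 k)⟩

lemma mixDensity_pos (hF : F.IsRegular) (hM : 1 ≤ M) (hϑ : ϑ ∈ paramSpace F.domain M)
    (w : Obs T d) : 0 < mixDensity ϑ w := by
  have h : ∃ k ∈ Finset.univ, 0 < weight ϑ k := by
    by_contra! h
    have h0 := Finset.sum_nonpos h
    rw [sum_weight hM] at h0
    linarith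
  obtain ⟨k, hk, hwk⟩ := h
  exact Finset.sum_pos' (fun k _ => mul_nonneg (hϑ.1 k) (hF.pos _ (hϑ.2 k) w).le)
    ⟨k, hk, mul_pos hwk (hF.pos _ (hϑ.2 k) w)⟩

lemma measurable_mixDensity (hF : F.IsRegular) (hϑ : ϑ ∈ paramSpace F.domain M) :
    Measurable (mixDensity ϑ) :=
  Finset.measurable_fun_sum _ fun k _ => (hF.measurable_density (hϑ.2 k)).const_mul _

lemma continuous_comp (k : Fin M) : Continuous fun ϑ : MixParam F M => comp ϑ k := by
  unfold comp
  fun_prop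

lemma continuous_weight (k : Fin M) : Continuous fun ϑ : MixParam F M => weight ϑ k := by
  unfold weight
  exact (continuous_fullWeights k).comp (by fun_prop)

lemma continuousAt_mixDensity (hF : F.IsRegular) (hϑ : ϑ ∈ paramSpace F.domain M) (w : Obs T d) :
    ContinuousAt (fun ϑ : MixParam F M => mixDensity ϑ w) ϑ := by
  refine tendsto_finsetSum _ fun k _ => ((continuous_weight k).tendsto ϑ).mul ?_
  exact (hF.continuousAt_density (hϑ.2 k) w).comp (f := fun ϑ : MixParam F M => comp ϑ k)
    (continuous_comp k).continuousAt

lemma lintegral_div_dataLaw {PX : Measure (Fin T → Fin d → ℝ)} (hF : F.IsRegular) (hM : 1 ≤ M)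
    (hϑ : ϑ ∈ paramSpace F.domain M) {f : Obs T d → ℝ} (hf : Measurable f) :
    ∫⁻ w, ENNReal.ofReal (f w / mixDensity ϑ w) ∂(dataLaw PX ϑ) =
      ∫⁻ w, ENNReal.ofReal (f w) ∂((volume : Measure (Fin T → ℝ)).prod PX) := by
  have hg := measurable_mixDensity hF hϑ
  have hq : Measurable fun w => ENNReal.ofReal (f w / mixDensity ϑ w) :=
    (hf.div hg).ennreal_ofReal
  rw [dataLaw, lintegral_withDensity_eq_lintegral_mul _ hg.ennreal_ofReal hq]
  refine lintegral_congr fun w => ?_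
  have hpos := mixDensity_pos hF hM hϑ w
  rw [Pi.mul_apply, ← ENNReal.ofReal_mul hpos.le, mul_div_cancel₀ _ hpos.ne']

variable {PX : Measure (Fin T → Fin d → ℝ)} [IsProbabilityMeasure PX]

lemma lintegral_mixDensity_le (hF : F.IsRegular) (hM : 1 ≤ M) (hϑ : ϑ ∈ paramSpace F.domain M) :
    ∫⁻ w, ENNReal.ofReal (mixDensity ϑ w) ∂((volume : Measure (Fin T → ℝ)).prod PX) ≤ 1 := by
  have h1 : ∀ w, ENNReal.ofReal (mixDensity ϑ w) =
      ∑ k, ENNReal.ofReal (weight ϑ k) * ENNReal.ofReal (F.density (comp ϑ k) w) := fun w => by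
    rw [mixDensity, ENNReal.ofReal_sum_of_nonneg fun k _ =>
      mul_nonneg (hϑ.1 k) (hF.pos _ (hϑ.2 k) w).le]
    exact Finset.sum_congr rfl fun k _ => ENNReal.ofReal_mul (hϑ.1 k)
  have hm : ∀ k, Measurable fun w => ENNReal.ofReal (F.density (comp ϑ k) w) := fun k =>
    (hF.measurable_density (hϑ.2 k)).ennreal_ofReal
  simp_rw [h1]
  rw [lintegral_finsetSum _ fun k _ => (hm k).const_mul _]
  calc ∑ k, ∫⁻ w, ENNReal.ofReal (weight ϑ k) * ENNReal.ofReal (F.density (comp ϑ k) w)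
        ∂((volume : Measure (Fin T → ℝ)).prod PX)
      ≤ ∑ k, ENNReal.ofReal (weight ϑ k) := by
        refine Finset.sum_le_sum fun k _ => ?_
        rw [lintegral_const_mul _ (hm k)]
        exact mul_le_of_le_one_right' (hF.lintegral_le _ (hϑ.2 k) PX)
    _ = 1 := by
        rw [← ENNReal.ofReal_sum_of_nonneg fun k _ => hϑ.1 k, sum_weight hM, ENNReal.ofReal_one]

lemma lintegral_sqrt_mixDensity_lt_top (hF : F.IsRegular) (hϑ : ϑ ∈ paramSpace F.domain M) :
    ∫⁻ w, ENNReal.ofReal √(mixDensity ϑ w) ∂((volume : Measure (Fin T → ℝ)).prod PX) < ⊤ := by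
  have hm : ∀ k, Measurable fun w => ENNReal.ofReal √(F.density (comp ϑ k) w) := fun k =>
    (hF.measurable_density (hϑ.2 k)).sqrt.ennreal_ofReal
  have hle : ∀ w, ENNReal.ofReal √(mixDensity ϑ w) ≤
      ∑ k, ENNReal.ofReal √(weight ϑ k) * ENNReal.ofReal √(F.density (comp ϑ k) w) := fun w => by
    refine (ENNReal.ofReal_le_ofReal (sqrt_sum_le _ _ fun k =>
      mul_nonneg (hϑ.1 k) (hF.pos _ (hϑ.2 k) w).le)).trans ?_
    rw [ENNReal.ofReal_sum_of_nonneg fun k _ => Real.sqrt_nonneg _]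
    refine Finset.sum_le_sum fun k _ => ?_
    rw [Real.sqrt_mul (hϑ.1 k), ENNReal.ofReal_mul (Real.sqrt_nonneg _)]
  refine (lintegral_mono hle).trans_lt ?_
  rw [lintegral_finsetSum _ fun k _ => (hm k).const_mul _]
  refine ENNReal.sum_lt_top.2 fun k _ => ?_
  rw [lintegral_const_mul _ (hm k)]
  exact ENNReal.mul_lt_top ENNReal.ofReal_lt_top (hF.lintegral_sqrt_lt_top _ (hϑ.2 k) PX)

/-- `1 / √g` is integrable under `g`; it is written as `√g / g`. -/
lemma integrable_inv_sqrt_mixDensity (hF : F.IsRegular) (hM : 1 ≤ M)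
    (hϑ : ϑ ∈ paramSpace F.domain M) :
    Integrable (fun w => √(mixDensity ϑ w) / mixDensity ϑ w) (dataLaw PX ϑ) := by
  have hg := measurable_mixDensity hF hϑ
  refine ⟨(hg.sqrt.div hg).aestronglyMeasurable, ?_⟩
  rw [hasFiniteIntegral_iff_ofReal (Eventually.of_forall fun w =>
    div_nonneg (Real.sqrt_nonneg _) (mixDensity_pos hF hM hϑ w).le),
    lintegral_div_dataLaw hF hM hϑ hg.sqrt]
  exact lintegral_sqrt_mixDensity_lt_top hF hϑ

variable {M₀ : ℕ} {ϑs : MixParam F M₀}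

lemma integrable_ratio (hF : F.IsRegular) (hM : 1 ≤ M) (hϑ : ϑ ∈ paramSpace F.domain M)
    (hM₀ : 1 ≤ M₀) (hs : ϑs ∈ paramSpace F.domain M₀) :
    Integrable (fun w => mixDensity ϑ w / mixDensity ϑs w) (dataLaw PX ϑs) ∧
      ∫ w, mixDensity ϑ w / mixDensity ϑs w ∂(dataLaw PX ϑs) ≤ 1 := by
  have hg := measurable_mixDensity hF hϑ
  have hgs := measurable_mixDensity hF hs
  have h0 : ∀ w, 0 ≤ mixDensity ϑ w / mixDensity ϑs w := fun w =>
    div_nonneg (mixDensity_pos hF hM hϑ w).le (mixDensity_pos hF hM₀ hs w).le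
  have hle : ∫⁻ w, ENNReal.ofReal (mixDensity ϑ w / mixDensity ϑs w) ∂(dataLaw PX ϑs) ≤ 1 := by
    rw [lintegral_div_dataLaw hF hM₀ hs hg]
    exact lintegral_mixDensity_le hF hM hϑ
  refine ⟨⟨(hg.div hgs).aestronglyMeasurable, ?_⟩, ?_⟩
  · rw [hasFiniteIntegral_iff_ofReal (Eventually.of_forall h0)]
    exact hle.trans_lt ENNReal.one_lt_top
  · rw [integral_eq_lintegral_of_nonneg_ae (Eventually.of_forall h0)
      (hg.div hgs).aestronglyMeasurable]
    exact ENNReal.toReal_le_of_le_ofReal zero_le_one (by simpa using hle)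

end Mixture

/-! ### Uniform separation of the likelihood away from the true density -/

section Wald

variable {T d : ℕ} {F : ComponentFamily T d} {M M₀ : ℕ} {ϑ₀ : MixParam F M} {ϑs : MixParam F M₀}

/-- Measurable envelopes of the mixture densities over neighbourhoods of `ϑ₀` that shrink
to `ϑ₀`. -/
lemma exists_envelope (hF : F.IsRegular) (hM : 1 ≤ M) (h₀ : ϑ₀ ∈ paramSpace F.domain M) :
    ∃ (H : ℕ → Obs T d → ℝ) (C : ℝ), (∀ k, Measurable (H k)) ∧ (∀ k w, 0 ≤ H k w) ∧
      (∀ k w, H k w ≤ C) ∧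
      (∀ k, ∀ᶠ ϑ in 𝓝[paramSpace F.domain M] ϑ₀, ∀ w, mixDensity ϑ w ≤ H k w) ∧
      ∀ w, Tendsto (fun k => H k w) atTop (𝓝 (mixDensity ϑ₀ w)) := by
  set S := paramSpace F.domain M with hS
  have hbound : ∃ C : ℝ, ∀ᶠ ϑ in 𝓝[S] ϑ₀, ∀ w, mixDensity ϑ w ≤ C := by
    choose C hC using fun k => hF.locally_bounded (comp ϑ₀ k) (h₀.2 k)
    refine ⟨∑ k, |C k|, ?_⟩
    have h1 : ∀ᶠ ϑ in 𝓝[S] ϑ₀, ∀ k, ∀ w, F.density (comp ϑ k) w ≤ C k := by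
      refine eventually_all.2 fun k => ?_
      refine (tendsto_nhdsWithin_iff.2 ⟨?_, ?_⟩ :
        Tendsto (fun ϑ : MixParam F M => comp ϑ k) (𝓝[S] ϑ₀) (𝓝[F.domain] comp ϑ₀ k)).eventually
          (hC k)
      · exact ((continuous_comp k).tendsto ϑ₀).mono_left nhdsWithin_le_nhds
      · filter_upwards [self_mem_nhdsWithin] with ϑ hϑ using hϑ.2 k
    filter_upwards [h1, self_mem_nhdsWithin] with ϑ hϑ hϑS w
    refine Finset.sum_le_sum fun k _ => ?_
    have hw1 : weight ϑ k ≤ 1 := by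
      rw [← sum_weight hM ϑ]
      exact Finset.single_le_sum (fun k _ => hϑS.1 k) (Finset.mem_univ k)
    calc weight ϑ k * F.density (comp ϑ k) w ≤ 1 * |C k| :=
          mul_le_mul hw1 ((hϑ k w).trans (le_abs_self _)) (hF.pos _ (hϑS.2 k) w).le zero_le_one
      _ = |C k| := one_mul _
  obtain ⟨C, hC⟩ := hbound
  obtain ⟨r, hr, hrC⟩ := Metric.mem_nhdsWithin_iff.1 hC
  set V : ℕ → Set (MixParam F M) := fun k => Metric.ball ϑ₀ (r / (k + 1)) ∩ S with hV
  have hVr : ∀ k, V k ⊆ Metric.ball ϑ₀ r ∩ S := fun k => by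
    refine Set.inter_subset_inter_left _ (Metric.ball_subset_ball ?_)
    exact div_le_self hr.le (by linarith [(Nat.cast_nonneg k : (0 : ℝ) ≤ k)])
  have hV0 : ∀ k, ϑ₀ ∈ V k := fun k => ⟨Metric.mem_ball_self (by positivity), h₀⟩
  -- The supremum is taken over a countable dense subset, to make it measurable.
  choose D hDV hDc hD using fun k =>
    (TopologicalSpace.IsSeparable.of_separableSpace (V k)).exists_countable_dense_subset
  set H : ℕ → Obs T d → ENNReal := fun k w => ⨆ ϑ ∈ D k, ENNReal.ofReal (mixDensity ϑ w) with hH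
  have hHle : ∀ k w (B : ℝ), (∀ ϑ ∈ V k, mixDensity ϑ w ≤ B) → H k w ≤ ENNReal.ofReal B :=
    fun k w B hB => iSup₂_le fun ϑ hϑ => ENNReal.ofReal_le_ofReal (hB ϑ (hDV k hϑ))
  have hHC : ∀ k w, H k w ≤ ENNReal.ofReal C := fun k w =>
    hHle k w C fun ϑ hϑ => hrC (hVr k hϑ) w
  have hHtop : ∀ k w, H k w ≠ ⊤ := fun k w => ((hHC k w).trans_lt ENNReal.ofReal_lt_top).ne
  have hC0 : ∀ w, 0 ≤ C := fun w =>
    (mixDensity_pos hF hM h₀ w).le.trans (hrC (hVr 0 (hV0 0)) w)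
  have hHge : ∀ k w, ∀ ϑ ∈ V k, mixDensity ϑ w ≤ (H k w).toReal := by
    intro k w ϑ hϑ
    have hc : ContinuousWithinAt (fun ϑ : MixParam F M => mixDensity ϑ w) (D k) ϑ :=
      (continuousAt_mixDensity hF hϑ.2 w).continuousWithinAt
    refine ContinuousWithinAt.closure_le (hD k hϑ) hc continuousWithinAt_const fun ϑ' hϑ' => ?_
    exact (ENNReal.ofReal_le_iff_le_toReal (hHtop k w)).1
      (le_iSup₂ (f := fun ϑ (_ : ϑ ∈ D k) => ENNReal.ofReal (mixDensity ϑ w)) ϑ' hϑ')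
  refine ⟨fun k w => (H k w).toReal, C, fun k => ?_, fun k w => ENNReal.toReal_nonneg,
    fun k w => ?_, fun k => ?_, fun w => ?_⟩
  · exact (Measurable.biSup _ (hDc k) fun ϑ hϑ =>
      (measurable_mixDensity hF (hDV k hϑ).2).ennreal_ofReal).ennreal_toReal
  · exact ENNReal.toReal_le_of_le_ofReal (hC0 w) (hHC k w)
  · filter_upwards [inter_mem_nhdsWithin S (Metric.ball_mem_nhds ϑ₀
      (by positivity : 0 < r / ((k : ℝ) + 1)))] with ϑ hϑ w using hHge k w ϑ ⟨hϑ.2, hϑ.1⟩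
  · refine tendsto_order.2 ⟨fun a ha => Eventually.of_forall fun k =>
      ha.trans_le (hHge k w ϑ₀ (hV0 k)), fun b hb => ?_⟩
    obtain ⟨b', hb', hb'b⟩ := exists_between hb
    obtain ⟨ρ, hρ, hρb⟩ := Metric.eventually_nhds_iff_ball.1
      ((continuousAt_mixDensity hF h₀ w).eventually (gt_mem_nhds hb'))
    have hlim : Tendsto (fun k : ℕ => r / ((k : ℝ) + 1)) atTop (𝓝 0) :=
      tendsto_const_nhds.div_atTop (tendsto_atTop_add_const_right _ _ tendsto_natCast_atTop_atTop)
    filter_upwards [hlim.eventually (gt_mem_nhds hρ)] with k hk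
    refine lt_of_le_of_lt (ENNReal.toReal_le_of_le_ofReal
      ((mixDensity_pos hF hM h₀ w).le.trans hb'.le) (hHle k w b' fun ϑ hϑ => ?_)) hb'b
    exact (hρb ϑ (Metric.ball_subset_ball hk.le hϑ.1)).le

/-- The contrast `log ((1 + l) / 2)` of a density ratio `l`, which is bounded below, has negative
mean unless `l = 1` almost surely. -/
lemma integral_log_half_lt_zero {P : Measure (Obs T d)} [IsProbabilityMeasure P] {l : Obs T d → ℝ}
    (hl : ∀ w, 0 < l w) (hint : Integrable l P)
    (hle : ∫ w, l w ∂P ≤ 1)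
    (hlog : Integrable (fun w => Real.log ((1 + l w) / 2)) P)
    (hne : ¬ ∀ᵐ w ∂P, l w = 1) :
    ∫ w, Real.log ((1 + l w) / 2) ∂P < 0 := by
  by_contra! h
  apply hne
  have hint2 : Integrable (fun w => (l w - 1) / 2) P :=
    (hint.sub (integrable_const 1)).div_const 2
  have hnn : ∀ w, 0 ≤ (l w - 1) / 2 - Real.log ((1 + l w) / 2) := fun w => by
    have := Real.log_le_sub_one_of_pos (by linarith [hl w] : 0 < (1 + l w) / 2)
    linarith
  have hval : ∫ w, (l w - 1) / 2 - Real.log ((1 + l w) / 2) ∂P = 0 := by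
    refine le_antisymm ?_ (integral_nonneg hnn)
    rw [integral_sub hint2 hlog, integral_div, integral_sub hint (integrable_const 1)]
    simp only [integral_const, probReal_univ, smul_eq_mul, mul_one]
    linarith
  have hae := (integral_eq_zero_iff_of_nonneg hnn (hint2.sub hlog)).1 hval
  filter_upwards [hae] with w hw
  by_contra hlw
  have h1 := Real.log_lt_sub_one_of_pos (by linarith [hl w] : 0 < (1 + l w) / 2)
    (fun h => hlw (by linarith))
  simp only [Pi.zero_apply] at hw
  linarith

variable {PX : Measure (Fin T → Fin d → ℝ)} [IsProbabilityMeasure PX]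

variable {Ω : Type*} [MeasurableSpace Ω] {μ : Measure Ω} [IsProbabilityMeasure μ]
  {W : ℕ → Ω → Obs T d}

/-- Wald's argument near one parameter `ϑ₀` that does not reproduce the true density: on a small
neighbourhood the contrast is at most an average with negative mean. -/
lemma logLik_separated_nhds (hF : F.IsRegular) (hW : IsSample μ PX ϑs W) (hM : 1 ≤ M)
    (h₀ : ϑ₀ ∈ paramSpace F.domain M) (hM₀ : 1 ≤ M₀) (hs : ϑs ∈ paramSpace F.domain M₀)
    (hne : ¬ ∀ᵐ w ∂(dataLaw PX ϑs), mixDensity ϑ₀ w = mixDensity ϑs w) :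
    ∃ V ∈ 𝓝[paramSpace F.domain M] ϑ₀, ∃ c : ℝ, 0 < c ∧ ∀ η, 0 < η →
      HighProb μ η fun n ω => ∀ ϑ ∈ V, ϑ ∈ paramSpace F.domain M →
        logLik W n ω ϑ - logLik W n ω ϑs ≤ -c * n := by
  have := hW.isProbabilityMeasure
  obtain ⟨H, C, hHm, hH0, hHC, hHV, hHlim⟩ := exists_envelope hF hM h₀
  set g := mixDensity ϑs with hg
  have hgpos : ∀ w, 0 < g w := mixDensity_pos hF hM₀ hs
  have hgm : Measurable g := measurable_mixDensity hF hs
  set u : ℕ → Obs T d → ℝ := fun k w => Real.log ((1 + H k w / g w) / 2) with hu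
  have hum : ∀ k, Measurable (u k) := fun k =>
    (((((hHm k).div hgm)).const_add 1).div_const 2).log
  set l : Obs T d → ℝ := fun w => mixDensity ϑ₀ w / g w with hl
  have hlpos : ∀ w, 0 < l w := fun w => div_pos (mixDensity_pos hF hM h₀ w) (hgpos w)
  -- Integrability of `1 / √g*` dominates the positive part of the contrast.
  set B : Obs T d → ℝ := fun w => Real.log 2 + 2 * √C * (√(g w) / g w) with hB
  have hBint : Integrable B (dataLaw PX ϑs) :=
    (integrable_const _).add ((integrable_inv_sqrt_mixDensity hF hM₀ hs).const_mul _)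
  have hlog2 : 0 ≤ Real.log 2 := Real.log_nonneg one_le_two
  have hbound : ∀ w z, 0 ≤ z → z ≤ C → |Real.log ((1 + z / g w) / 2)| ≤ B w := by
    intro w z hz hzC
    have hq : 0 ≤ z / g w := div_nonneg hz (hgpos w).le
    have h1 : √(z / g w) ≤ √C * (√(g w) / g w) := by
      rw [Real.sqrt_div' _ (hgpos w).le, Real.sqrt_div_self', mul_one_div]
      gcongr
    have h2 := log_one_add_le_two_mul_sqrt hq
    have h3 := Real.log_nonneg (by linarith : 1 ≤ 1 + z / g w)
    rw [Real.log_div (by linarith) two_ne_zero, abs_le]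
    constructor
    · have : 0 ≤ √C * (√(g w) / g w) := (Real.sqrt_nonneg _).trans h1
      simp only [hB]
      nlinarith
    · simp only [hB]
      nlinarith
  have huint : ∀ k, Integrable (u k) (dataLaw PX ϑs) := fun k =>
    hBint.mono' (hum k).aestronglyMeasurable
      (Eventually.of_forall fun w => hbound w _ (hH0 k w) (hHC k w))
  have hlC : ∀ w, mixDensity ϑ₀ w ≤ C := fun w =>
    le_of_tendsto (hHlim w) (Eventually.of_forall fun k => hHC k w)
  have hlm : Measurable l := (measurable_mixDensity hF h₀).div hgm
  have hlogint : Integrable (fun w => Real.log ((1 + l w) / 2)) (dataLaw PX ϑs) :=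
    hBint.mono' ((hlm.const_add 1).div_const 2).log.aestronglyMeasurable
      (Eventually.of_forall fun w => hbound w _ (mixDensity_pos hF hM h₀ w).le (hlC w))
  have hneg := integral_log_half_lt_zero hlpos (integrable_ratio hF hM h₀ hM₀ hs).1
    (integrable_ratio hF hM h₀ hM₀ hs).2 hlogint (fun h => hne (h.mono fun w hw => by
      rwa [hl, div_eq_one_iff_eq (hgpos w).ne'] at hw))
  have hlim : Tendsto (fun k => ∫ w, u k w ∂(dataLaw PX ϑs)) atTop
      (𝓝 (∫ w, Real.log ((1 + l w) / 2) ∂(dataLaw PX ϑs))) := by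
    refine tendsto_integral_of_dominated_convergence B
      (fun k => (hum k).aestronglyMeasurable) hBint
      (fun k => Eventually.of_forall fun w => hbound w _ (hH0 k w) (hHC k w))
      (Eventually.of_forall fun w => ?_)
    refine Tendsto.log ?_ (by linarith [hlpos w] : 0 < (1 + l w) / 2).ne'
    exact ((((hHlim w).div_const (g w))).const_add 1).div_const 2
  obtain ⟨k, hk⟩ := (hlim.eventually (gt_mem_nhds hneg)).exists
  set m := ∫ w, u k w ∂(dataLaw PX ϑs) with hm
  refine ⟨{ϑ | ∀ w, mixDensity ϑ w ≤ H k w}, hHV k, -m, by linarith, fun η hη => ?_⟩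
  refine (hW.average_close (hum k) (huint k) (half_pos (by linarith : 0 < -m)) hη).mono ?_
  filter_upwards [eventually_gt_atTop 0] with n hn ω hω ϑ hϑV hϑ
  have hn' : (0 : ℝ) < n := by exact_mod_cast hn
  have hsum : ∑ i ∈ Finset.range n, u k (W i ω) ≤ m / 2 * n := by
    rw [← div_le_iff₀ hn']
    have := (abs_lt.1 hω).2
    simp only [← hm] at this
    linarith
  have hterm : ∀ w, Real.log (mixDensity ϑ w) - Real.log (g w) ≤ 2 * u k w := by
    intro w
    have hp := mixDensity_pos hF hM hϑ w
    rw [← Real.log_div hp.ne' (hgpos w).ne']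
    have hq : 0 < mixDensity ϑ w / g w := div_pos hp (hgpos w)
    have hqH : mixDensity ϑ w / g w ≤ H k w / g w :=
      div_le_div_of_nonneg_right (hϑV w) (hgpos w).le
    have h2 : (2 : ℝ) * u k w = Real.log (((1 + H k w / g w) / 2) ^ 2) := by
      rw [Real.log_pow]
      norm_num [hu]
    rw [h2]
    refine Real.log_le_log hq ?_
    -- For a density ratio `l` this is `l ≤ ((1 + l) / 2) ^ 2`.
    nlinarith [sq_nonneg (1 - H k w / g w)]
  unfold logLik
  rw [← Finset.sum_sub_distrib]
  calc ∑ i ∈ Finset.range n, (Real.log (mixDensity ϑ (W i ω)) - Real.log (g (W i ω)))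
      ≤ ∑ i ∈ Finset.range n, 2 * u k (W i ω) := Finset.sum_le_sum fun i _ => hterm _
    _ = 2 * ∑ i ∈ Finset.range n, u k (W i ω) := by rw [Finset.mul_sum]
    _ ≤ - -m * n := by linarith

/-- On a compact parameter set, outside a set `G` that is a neighbourhood of every parameter that
reproduces the true density, the log-likelihood falls short of its value at the true parameter by
a multiple of `n`. -/
lemma logLik_separated (hF : F.IsRegular) (hW : IsSample μ PX ϑs W) (hM : 1 ≤ M)
    (hM₀ : 1 ≤ M₀) (hs : ϑs ∈ paramSpace F.domain M₀) {S G : Set (MixParam F M)}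
    (hS : IsCompact S) (hSF : S ⊆ paramSpace F.domain M)
    (hG : ∀ ϑ₀ ∈ S, (∀ᵐ w ∂(dataLaw PX ϑs), mixDensity ϑ₀ w = mixDensity ϑs w) →
      ∀ᶠ ϑ in 𝓝[S] ϑ₀, ϑ ∈ G) :
    ∃ c : ℝ, 0 < c ∧ ∀ η, 0 < η → HighProb μ η fun n ω => ∀ ϑ ∈ S, ϑ ∉ G →
      logLik W n ω ϑ - logLik W n ω ϑs ≤ -c * n := by
  suffices h : ∃ c : ℝ, 0 < c ∧ ∀ η, 0 < η → HighProb μ η fun n ω => ∀ ϑ ∈ S, ϑ ∈ S → ϑ ∉ G →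
      logLik W n ω ϑ - logLik W n ω ϑs ≤ -c * n by
    obtain ⟨c, hc, h⟩ := h
    exact ⟨c, hc, fun η hη => (h η hη).mono (Eventually.of_forall fun n ω hω ϑ hϑ =>
      hω ϑ hϑ hϑ)⟩
  refine hS.induction_on (p := fun U : Set (MixParam F M) => ∃ c : ℝ, 0 < c ∧ ∀ η, 0 < η →
    HighProb μ η fun n ω => ∀ ϑ ∈ U, ϑ ∈ S → ϑ ∉ G →
      logLik W n ω ϑ - logLik W n ω ϑs ≤ -c * n) ?_ ?_ ?_ ?_
  · exact ⟨1, one_pos, fun η _ => HighProb.of_ae (by simp)⟩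
  · rintro U V hUV ⟨c, hc, h⟩
    exact ⟨c, hc, fun η hη => (h η hη).mono (Eventually.of_forall fun n ω hω ϑ hϑ =>
      hω ϑ (hUV hϑ))⟩
  · rintro U V ⟨c, hc, h⟩ ⟨c', hc', h'⟩
    refine ⟨min c c', lt_min hc hc', fun η hη => ?_⟩
    have := HighProb.and (half_pos hη).le (half_pos hη).le (h _ (half_pos hη)) (h' _ (half_pos hη))
    rw [add_halves] at this
    refine this.mono (Eventually.of_forall fun n ω hω ϑ hϑ hϑS hϑG => ?_)
    have hn : (0 : ℝ) ≤ n := n.cast_nonneg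
    rcases hϑ with hϑ | hϑ
    · have := hω.1 ϑ hϑ hϑS hϑG
      nlinarith [min_le_left c c']
    · have := hω.2 ϑ hϑ hϑS hϑG
      nlinarith [min_le_right c c']
  · intro ϑ₀ hϑ₀
    by_cases htrue : ∀ᵐ w ∂(dataLaw PX ϑs), mixDensity ϑ₀ w = mixDensity ϑs w
    · refine ⟨_, hG ϑ₀ hϑ₀ htrue, 1, one_pos, fun η _ => HighProb.of_ae ?_⟩
      exact Eventually.of_forall fun ω n ϑ hϑ _ hϑG => absurd hϑ hϑG
    · obtain ⟨V, hV, c, hc, h⟩ := logLik_separated_nhds hF hW hM (hSF hϑ₀) hM₀ hs htrue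
      exact ⟨V, nhdsWithin_mono _ hSF hV, c, hc, fun η hη => (h η hη).mono
        (Eventually.of_forall fun n ω hω ϑ hϑ hϑS _ => hω ϑ hϑ (hSF hϑS))⟩

end Wald

/-! ### Gram matrices -/

section Gram

variable {α κ : Type*} [MeasurableSpace α] {P : Measure α} [Fintype κ]
  {s : α → EuclideanSpace ℝ κ}

lemma abs_sum_mul_le_norm (x y : EuclideanSpace ℝ κ) : |∑ a, x a * y a| ≤ ‖x‖ * ‖y‖ := by
  have h := abs_real_inner_le_norm x y
  rw [PiLp.inner_apply] at h
  simpa [mul_comm] using h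

/-- A nonsingular Gram matrix means that the entries of `s` are linearly independent modulo null
sets. -/
lemma eq_zero_of_sum_mul_ae_eq_zero [DecidableEq κ]
    (hint : ∀ a b, Integrable (fun w => s w a * s w b) P)
    (hdet : (Matrix.of fun a b => ∫ w, s w a * s w b ∂P).det ≠ 0) (t : κ → ℝ)
    (ht : ∀ᵐ w ∂P, ∑ a, t a * s w a = 0) : t = 0 := by
  refine Matrix.eq_zero_of_mulVec_eq_zero hdet (funext fun a => ?_)
  simp only [Matrix.mulVec, dotProduct, Matrix.of_apply, Pi.zero_apply]
  simp_rw [← integral_mul_const]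
  rw [← integral_finsetSum _ fun b _ => (hint a b).mul_const _]
  refine integral_eq_zero_of_ae (ht.mono fun w hw => ?_)
  calc ∑ b, s w a * s w b * t b = s w a * ∑ b, t b * s w b := by
        rw [Finset.mul_sum]
        exact Finset.sum_congr rfl fun b _ => by ring
    _ = 0 := by rw [hw, mul_zero]

lemma sq_sum_mul (t x : κ → ℝ) :
    (∑ a, t a * x a) ^ 2 = ∑ a, ∑ b, t a * t b * (x a * x b) := by
  rw [sq, Finset.sum_mul_sum]
  exact Finset.sum_congr rfl fun a _ => Finset.sum_congr rfl fun b _ => by ring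

/-- A nonsingular Gram matrix is positive definite, with a uniform lower bound. -/
lemma exists_gram_lower_bound [DecidableEq κ]
    (hint : ∀ a b, Integrable (fun w => s w a * s w b) P)
    (hdet : (Matrix.of fun a b => ∫ w, s w a * s w b ∂P).det ≠ 0) :
    ∃ c : ℝ, 0 < c ∧ ∀ t : EuclideanSpace ℝ κ,
      c * ‖t‖ ^ 2 ≤ ∑ a, ∑ b, t a * t b * ∫ w, s w a * s w b ∂P := by
  set Q : EuclideanSpace ℝ κ → ℝ := fun t => ∑ a, ∑ b, t a * t b * ∫ w, s w a * s w b ∂P with hQ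
  have hQint : ∀ t, Q t = ∫ w, (∑ a, t a * s w a) ^ 2 ∂P := fun t => by
    simp_rw [sq_sum_mul]
    rw [integral_finsetSum _ fun a _ => integrable_finsetSum _ fun b _ => (hint a b).const_mul _]
    refine Finset.sum_congr rfl fun a _ => ?_
    rw [integral_finsetSum _ fun b _ => (hint a b).const_mul _]
    exact Finset.sum_congr rfl fun b _ => by rw [integral_const_mul]
  have hQpos : ∀ t : EuclideanSpace ℝ κ, t ≠ 0 → 0 < Q t := by
    intro t ht
    rw [hQint]
    refine lt_of_le_of_ne (integral_nonneg fun w => sq_nonneg _) fun h => ht ?_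
    have hi : Integrable (fun w => (∑ a, t a * s w a) ^ 2) P := by
      simp_rw [sq_sum_mul]
      exact integrable_finsetSum _ fun a _ => integrable_finsetSum _ fun b _ =>
        (hint a b).const_mul _
    have hae := (integral_eq_zero_iff_of_nonneg (fun w => sq_nonneg _) hi).1 h.symm
    have := eq_zero_of_sum_mul_ae_eq_zero hint hdet t (hae.mono fun w hw => by simpa using hw)
    exact PiLp.ext fun a => congrFun this a
  have hQhom : ∀ (r : ℝ) (t : EuclideanSpace ℝ κ), Q (r • t) = r ^ 2 * Q t := fun r t => by
    simp only [hQ, PiLp.smul_apply, smul_eq_mul, Finset.mul_sum]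
    exact Finset.sum_congr rfl fun a _ => Finset.sum_congr rfl fun b _ => by ring
  have hQcont : Continuous Q := by
    simp only [hQ]
    fun_prop
  have key : ∃ c : ℝ, 0 < c ∧ ∀ t ∈ Metric.sphere (0 : EuclideanSpace ℝ κ) 1, c ≤ Q t := by
    rcases (Metric.sphere (0 : EuclideanSpace ℝ κ) 1).eq_empty_or_nonempty with h | h
    · exact ⟨1, one_pos, by simp [h]⟩
    · obtain ⟨t₀, ht₀, hmin⟩ := (isCompact_sphere (0 : EuclideanSpace ℝ κ) 1).exists_isMinOn h
        hQcont.continuousOn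
      refine ⟨Q t₀, hQpos t₀ fun h0 => ?_, fun t ht => hmin ht⟩
      simp [h0] at ht₀
  obtain ⟨c, hc, hmin⟩ := key
  refine ⟨c, hc, fun t => ?_⟩
  change _ ≤ Q t
  rcases eq_or_ne t 0 with rfl | ht
  · simp [hQ]
  · have hn : 0 < ‖t‖ := norm_pos_iff.2 ht
    have h1 := hmin (‖t‖⁻¹ • t) (by simp [norm_smul, hn.ne'])
    rw [hQhom, inv_pow, ← div_eq_inv_mul, le_div_iff₀ (by positivity)] at h1
    exact h1

/-- Truncating the vectors at a large norm changes the Gram matrix by little. -/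
lemma exists_truncation (hs : ∀ a, Measurable fun w => s w a)
    (hint : ∀ a b, Integrable (fun w => s w a * s w b) P) {ε : ℝ} (hε : 0 < ε) :
    ∃ A : ℝ, 0 < A ∧ ∀ a b, |∫ w, (if ‖s w‖ ≤ A then s w a * s w b else 0) ∂P
      - ∫ w, s w a * s w b ∂P| < ε := by
  have hsm : Measurable s := by
    have : Measurable fun w => (fun a => s w a : κ → ℝ) := measurable_pi_lambda _ hs
    exact (WithLp.measurable_toLp 2 (κ → ℝ)).comp this
  have hlim : ∀ a b, Tendsto (fun N : ℕ => ∫ w, (if ‖s w‖ ≤ N then s w a * s w b else 0) ∂P) atTop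
      (𝓝 (∫ w, s w a * s w b ∂P)) := by
    intro a b
    refine tendsto_integral_of_dominated_convergence (fun w => |s w a * s w b|)
      (fun N => ?_) (hint a b).abs (fun N => Eventually.of_forall fun w => ?_)
      (Eventually.of_forall fun w => ?_)
    · exact (Measurable.ite (measurableSet_le hsm.norm measurable_const)
        ((hs a).mul (hs b)) measurable_const).aestronglyMeasurable
    · split_ifs
      · exact le_rfl
      · rw [norm_zero]
        exact abs_nonneg _
    · refine tendsto_const_nhds.congr' ?_
      filter_upwards [tendsto_natCast_atTop_atTop.eventually_ge_atTop ‖s w‖] with N hN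
      rw [if_pos hN]
  have hev : ∀ᶠ N : ℕ in atTop, ∀ a b, |∫ w, (if ‖s w‖ ≤ N then s w a * s w b else 0) ∂P
      - ∫ w, s w a * s w b ∂P| < ε := by
    refine eventually_all.2 fun a => eventually_all.2 fun b => ?_
    filter_upwards [Metric.tendsto_nhds.1 (hlim a b) ε hε] with N hN
    rwa [Real.dist_eq] at hN
  obtain ⟨N, hN, hN0⟩ := (hev.and (eventually_gt_atTop 0)).exists
  exact ⟨N, by exact_mod_cast hN0, hN⟩

end Gram

/-! ### The reparameterized mixture -/

section Reparam

variable {T d : ℕ} {F : ComponentFamily T d} {M M₀ : ℕ} {j : BlockPartition M M₀}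

lemma fullWeights_of_sum_eq_one {x : Fin M → ℝ} (hx : ∑ k, x k = 1) (k : Fin M) :
    fullWeights (fun i : Fin (M - 1) => x ⟨i, i.2.trans_le (Nat.sub_le _ _)⟩) k = x k := by
  obtain ⟨m, rfl⟩ : ∃ m, M = m + 1 := ⟨M - 1, by have := k.2; omega⟩
  rw [Fin.sum_univ_castSucc] at hx
  unfold fullWeights
  split_ifs with h
  · rfl
  · have hk : k = Fin.last m := Fin.ext (by
      have := k.2
      simp only [Fin.val_last]
      omega)
    rw [hk, ← hx]
    exact sub_eq_of_eq_add' rfl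

lemma fullWeights_castLE (a : Fin (M - 1) → ℝ) (i : Fin (M - 1)) :
    fullWeights a ⟨i, i.2.trans_le (Nat.sub_le _ _)⟩ = a i := by
  simp [fullWeights]

lemma mem_alphaSpace_iff (hM : 1 ≤ M) {c₁ : ℝ} (hc : 0 < c₁) {a : Fin (M - 1) → ℝ} :
    a ∈ alphaSpace c₁ M ↔ ∀ k, c₁ ≤ fullWeights a k := by
  constructor
  · rintro ⟨h1, h2⟩ k
    unfold fullWeights
    split_ifs
    · exact (h1 _).1
    · linarith
  · intro h
    have h1 : ∀ i, c₁ ≤ a i := fun i => by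
      have := h ⟨i, i.2.trans_le (Nat.sub_le _ _)⟩
      rwa [fullWeights_castLE] at this
    have h2 : c₁ ≤ 1 - ∑ i, a i := by
      have := h ⟨M - 1, by omega⟩
      simpa [fullWeights] using this
    refine ⟨fun i => ⟨h1 i, ?_⟩, by linarith⟩
    have := Finset.single_le_sum (fun i _ => hc.le.trans (h1 i)) (Finset.mem_univ i)
    linarith

lemma tauSpace_bounds (hM : 1 ≤ M) {c₁ : ℝ} (hc : 0 < c₁) {τ : Fin M → ℝ}
    (hτ : τ ∈ tauSpace c₁ j) :
    (∀ k, c₁ ≤ τ k) ∧ (∀ k, τ k ≤ 1) ∧ ∀ h, ∑ k with j.block k = h, τ k = 1 := by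
  obtain ⟨a, ha, hτa⟩ := hτ
  rw [mem_alphaSpace_iff hM hc] at ha
  have h0 : ∀ k, 0 ≤ fullWeights a k := fun k => hc.le.trans (ha k)
  have hle : ∀ k, fullWeights a k ≤ ∑ k' with j.block k' = j.block k, fullWeights a k' := fun k =>
    Finset.single_le_sum (fun k' _ => h0 k') (by simp)
  have hpos : ∀ k, 0 < ∑ k' with j.block k' = j.block k, fullWeights a k' := fun k =>
    hc.trans_le ((ha k).trans (hle k))
  have hle1 : ∀ k, ∑ k' with j.block k' = j.block k, fullWeights a k' ≤ 1 := fun k => by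
    rw [← sum_fullWeights hM a]
    exact Finset.sum_le_univ_sum_of_nonneg h0
  refine ⟨fun k => ?_, fun k => ?_, fun h => ?_⟩
  · rw [hτa, le_div_iff₀ (hpos k)]
    nlinarith [ha k, hle1 k]
  · rw [hτa, div_le_one (hpos k)]
    exact hle k
  · obtain ⟨k₀, rfl⟩ := j.surjective h
    have : ∀ k ∈ Finset.univ.filter (fun k => j.block k = j.block k₀), τ k =
        fullWeights a k / ∑ k' with j.block k' = j.block k₀, fullWeights a k' := by
      intro k hk
      rw [hτa, (Finset.mem_filter.1 hk).2]
    rw [Finset.sum_congr rfl this, ← Finset.sum_div, div_self (hpos k₀).ne']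

lemma sum_block_mul {τ : Fin M → ℝ} (hτ : ∀ h, ∑ k with j.block k = h, τ k = 1) (x : Fin M₀ → ℝ) :
    ∑ k, x (j.block k) * τ k = ∑ h, x h := by
  rw [← Finset.sum_fiberwise_of_maps_to (s := Finset.univ) (t := Finset.univ) (g := j.block)
    (fun k _ => Finset.mem_univ _)]
  refine Finset.sum_congr rfl fun h _ => ?_
  rw [Finset.sum_congr rfl fun k hk => by rw [(Finset.mem_filter.1 hk).2], ← Finset.mul_sum, hτ,
    mul_one]

lemma weight_toParam (hM₀ : 1 ≤ M₀) {τ : Fin M → ℝ}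
    (hτ : ∀ h, ∑ k with j.block k = h, τ k = 1) (ψ : Psi F j) (k : Fin M) :
    weight (toParam j ψ τ) k = fullWeights (fun i => ψ (.inl i)) (j.block k) * τ k := by
  have h1 : ∑ k, fullWeights (fun i => ψ (.inl i)) (j.block k) * τ k = 1 := by
    rw [sum_block_mul hτ fun h => fullWeights (fun i => ψ (.inl i)) h, sum_fullWeights hM₀]
  exact fullWeights_of_sum_eq_one h1 k

/-- The set of orders that defines `expansionOrder` is nonempty, because there is a partial
derivative of every order; the value is therefore not the default `sInf ∅ = 0`. -/
lemma two_le_expansionOrder (hι : Nonempty F.ι) {h : Fin M₀} (k : NonFirst j)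
    (hk : j.block k = h) : 2 ≤ expansionOrder F j h := by
  set N := Fintype.card {k : NonFirst j // j.block k = h} * Fintype.card F.ι with hN
  have hN0 : 0 < N := Nat.mul_pos (Fintype.card_pos_iff.2 ⟨⟨k, hk⟩⟩) Fintype.card_pos
  have hne : {p | N ≤ ∑ r ∈ Finset.Icc 2 p, Fintype.card (Sym F.ι r)}.Nonempty := by
    refine ⟨N + 1, ?_⟩
    have h1 : ∀ r ∈ Finset.Icc 2 (N + 1), 1 ≤ Fintype.card (Sym F.ι r) := fun r _ =>
      Fintype.card_pos_iff.2 ⟨Sym.replicate r hι.some⟩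
    have := Finset.card_nsmul_le_sum _ _ 1 h1
    simpa using this
  have hmem := Nat.sInf_mem hne
  by_contra! hlt
  have hempty : Finset.Icc 2 (expansionOrder F j h) = ∅ := Finset.Icc_eq_empty (by omega)
  change N ≤ ∑ r ∈ Finset.Icc 2 (expansionOrder F j h), Fintype.card (Sym F.ι r) at hmem
  rw [hempty, Finset.sum_empty] at hmem
  omega

lemma deviation_eq_zero_of_no_nonFirst {ψ : Psi F j} {τ : Fin M → ℝ} {k : Fin M}
    (h : ∀ l : NonFirst j, j.block l ≠ j.block k) (a : F.ι) : deviation j ψ τ k a = 0 := by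
  unfold deviation
  split_ifs with hk
  · exact absurd rfl (h ⟨k, hk⟩)
  · rw [neg_eq_zero]
    exact Finset.sum_eq_zero fun l _ => if_neg (h l)

/-- The second-order entries of `t_{ψτ}` already control all deviations within the blocks. -/
lemma deviation_eq_zero_of_tVec (hι : Nonempty F.ι) {ϑs : MixParam F M₀} {ψ : Psi F j}
    {τ : Fin M → ℝ} (hτ : ∀ k, 0 < τ k) (ht : tVec j ϑs ψ τ = 0) (k : Fin M) (a : F.ι) :
    deviation j ψ τ k a = 0 := by
  by_cases hex : ∃ l : NonFirst j, j.block l = j.block k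
  · obtain ⟨l, hl⟩ := hex
    have h2 := two_le_expansionOrder hι l hl
    have h := congrArg (fun t : EuclideanSpace ℝ (ScoreIndex F j) => t (.inr (.inr
      ⟨j.block k, ⟨2, Finset.mem_Icc.2 ⟨le_rfl, h2⟩⟩, Sym.replicate 2 a⟩))) ht
    simp only [tVec, Sum.elim_inr, PiLp.zero_apply, Sym.coe_replicate, Multiset.map_replicate,
      Multiset.prod_replicate] at h
    have h3 := (Finset.sum_eq_zero_iff_of_nonneg fun k' _ =>
      mul_nonneg (hτ k').le (sq_nonneg (deviation j ψ τ k' a))).1 h k (by simp)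
    simpa [(hτ k).ne'] using h3
  · push Not at hex
    exact deviation_eq_zero_of_no_nonFirst hex a

lemma tVec_psiStar (ϑs : MixParam F M₀) (τ : Fin M → ℝ) : tVec j ϑs (psiStar j ϑs) τ = 0 := by
  have hdev : ∀ k a, deviation j (psiStar j ϑs) τ k a = 0 := fun k a => by
    simp [deviation, psiStar]
  refine PiLp.ext fun i => ?_
  rcases i with i | i | ⟨h, ⟨p, hp⟩, I⟩
  · simp [tVec, psiStar]
  · simp [tVec, psiStar]
  · simp only [tVec, Sum.elim_inr, PiLp.zero_apply]
    refine Finset.sum_eq_zero fun k _ => ?_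
    have h1 : (I : Multiset F.ι).map (deviation j (psiStar j ϑs) τ k) = Multiset.replicate p 0 := by
      rw [Multiset.eq_replicate]
      refine ⟨by simp, fun b hb => ?_⟩
      obtain ⟨a, -, rfl⟩ := Multiset.mem_map.1 hb
      exact hdev k a
    have hp2 := (Finset.mem_Icc.1 hp).1
    rw [h1, Multiset.prod_replicate, zero_pow (by omega), mul_zero]

/-- If `t_{ψτ} = 0`, all components of a block equal the true one and the weights of the blocks are
the true weights. -/
lemma mixDensity_toParam_of_tVec_eq_zero (hι : Nonempty F.ι) (hM₀ : 1 ≤ M₀) {ϑs : MixParam F M₀}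
    {ψ : Psi F j} {τ : Fin M → ℝ} (hτ : ∀ k, 0 < τ k)
    (hτ1 : ∀ h, ∑ k with j.block k = h, τ k = 1) (ht : tVec j ϑs ψ τ = 0) (w : Obs T d) :
    mixDensity (toParam j ψ τ) w = mixDensity ϑs w := by
  have hβ : (fun i => ψ (.inl i)) = fun i => ϑs (.inl i) := funext fun i => by
    have := congrArg (fun t : EuclideanSpace ℝ (ScoreIndex F j) => t (.inl i)) ht
    simpa [tVec, sub_eq_zero] using this
  have hν : ∀ h a, ψ (.inr (.inl (h, a))) = ϑs (.inr (h, a)) := fun h a => by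
    have := congrArg (fun t : EuclideanSpace ℝ (ScoreIndex F j) => t (.inr (.inl (h, a)))) ht
    simpa [tVec, sub_eq_zero] using this
  have hcomp : ∀ k, comp (toParam j ψ τ) k = comp ϑs (j.block k) := fun k => by
    refine PiLp.ext fun a => ?_
    simp [comp, toParam, deviation_eq_zero_of_tVec hι hτ ht, hν]
  unfold mixDensity
  rw [← sum_block_mul hτ1 fun h => weight ϑs h * F.density (comp ϑs h) w]
  refine Finset.sum_congr rfl fun k _ => ?_
  rw [weight_toParam hM₀ hτ1, hcomp, hβ]
  simp only [weight]
  ring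

/-- Where `‖t‖ ‖ψ - ψ*‖` vanishes, the relative remainder is zero by convention; the remainder is
zero there as well, since `t = 0` forces the mixture to have the true density. -/
lemma remainder_eq (hι : Nonempty F.ι) (hM₀ : 1 ≤ M₀) {ϑs : MixParam F M₀}
    (hpos : ∀ w, 0 < mixDensity ϑs w)
    {ψ : Psi F j} {τ : Fin M → ℝ} (hτ : ∀ k, 0 < τ k)
    (hτ1 : ∀ h, ∑ k with j.block k = h, τ k = 1) (w : Obs T d) :
    remainder j ϑs ψ τ w =
      ‖tVec j ϑs ψ τ‖ * ‖ψ - psiStar j ϑs‖ * relRemainder j ϑs ψ τ w := by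
  by_cases h : ‖tVec j ϑs ψ τ‖ * ‖ψ - psiStar j ϑs‖ = 0
  · have ht : tVec j ϑs ψ τ = 0 := by
      rcases mul_eq_zero.1 h with h | h
      · exact norm_eq_zero.1 h
      · rw [sub_eq_zero.1 (norm_eq_zero.1 h)]
        exact tVec_psiStar ϑs τ
    rw [h, zero_mul, remainder, mixDensity_toParam_of_tVec_eq_zero hι hM₀ hτ hτ1 ht, ht,
      div_self (hpos w).ne']
    simp
  · rw [relRemainder, mul_div_cancel₀ _ h]

lemma measurable_sVec (hF : F.IsRegular) {ϑs : MixParam F M₀} (hs : ϑs ∈ paramSpace F.domain M₀)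
    (a : ScoreIndex F j) : Measurable fun w => sVec j ϑs w a := by
  have hg := measurable_mixDensity hF hs
  rcases a with i | ⟨h, a⟩ | ⟨h, ⟨p, hp⟩, I⟩
  · exact ((hF.measurable_density (hs.2 _)).sub (hF.measurable_density (hs.2 _))).div hg
  · exact ((hF.measurable_fderiv (hs.2 h) _).const_mul _).div hg
  · exact ((hF.measurable_iteratedFDeriv (hs.2 h) p _).const_mul _).div hg

end Reparam

/-! ### The likelihood ratio near the true parameter -/

/-- The deterministic core of the quadratic expansion: a linear term of order `√n T` is
compensated by a negative quadratic term of order `n T ^ 2`. -/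
lemma sum_log_le_of_quadratic {n : ℕ} {l a r b : ℕ → ℝ} {t B c : ℝ} (hc : 0 < c)
    (hl : ∀ i < n, 0 < l i) (h : ∀ i < n, l i - 1 = a i + r i) (hb : ∀ i < n, b i = a i ∨ b i = 0)
    (hb1 : ∀ i < n, b i ^ 2 ≤ 1)
    (hlin : ∑ i ∈ Finset.range n, (l i - 1) ≤ √n * t * B)
    (hquad : n * (c / 2) * t ^ 2 ≤ ∑ i ∈ Finset.range n, b i ^ 2)
    (hrem : ∑ i ∈ Finset.range n, r i ^ 2 ≤ n * (c / 8) * t ^ 2) :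
    ∑ i ∈ Finset.range n, Real.log (l i) ≤ 16 * B ^ 2 / c := by
  have h1 : ∑ i ∈ Finset.range n, Real.log (l i) ≤ ∑ i ∈ Finset.range n,
      ((l i - 1) - (b i ^ 2 / 2 - r i ^ 2) / 8) := Finset.sum_le_sum fun i hi => by
    have hi := Finset.mem_range.1 hi
    exact log_le_quadratic (hl i hi) (h i hi) (hb i hi) (hb1 i hi)
  have h3 : ∑ i ∈ Finset.range n, ((l i - 1) - (b i ^ 2 / 2 - r i ^ 2) / 8) =
      ∑ i ∈ Finset.range n, (l i - 1) - ((∑ i ∈ Finset.range n, b i ^ 2) / 2 -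
        ∑ i ∈ Finset.range n, r i ^ 2) / 8 := by
    rw [Finset.sum_sub_distrib, ← Finset.sum_div, Finset.sum_sub_distrib (fun i => b i ^ 2 / 2),
      ← Finset.sum_div]
  rw [h3] at h1
  have hn : √(n : ℝ) ^ 2 = n := Real.sq_sqrt n.cast_nonneg
  have h2 : √n * t * B - n * (c / 64) * t ^ 2 ≤ 16 * B ^ 2 / c := by
    have h4 : n * (c / 64) * t ^ 2 = c / 64 * (√n * t) ^ 2 := by
      rw [mul_pow, hn]
      ring
    rw [le_div_iff₀ hc, h4]
    nlinarith [sq_nonneg (c * √n * t / 8 - 4 * B)]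
  linarith

section Expansion

variable {T d : ℕ} {F : ComponentFamily T d} {M M₀ : ℕ} {j : BlockPartition M M₀}
  {ϑs : MixParam F M₀} {PX : Measure (Fin T → Fin d → ℝ)} [IsProbabilityMeasure PX]
  {Ω : Type*} {W : ℕ → Ω → Obs T d}

/-- The linear term: density ratios have mean at most `1`, so the sum of their deviations from `1`
is bounded by the empirical process. -/
lemma sum_ratio_sub_one_le (hF : F.IsRegular) (hM₀ : 1 ≤ M₀) (hM : 1 ≤ M)
    (hs : ϑs ∈ paramSpace F.domain M₀) [IsProbabilityMeasure (dataLaw PX ϑs)]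
    (hsint : ∀ a, Integrable (fun w => sVec j ϑs w a) (dataLaw PX ϑs))
    {ψ : Psi F j} {τ : Fin M → ℝ} (hϑ : toParam j ψ τ ∈ paramSpace F.domain M)
    (hτ : ∀ k, 0 < τ k) (hτ1 : ∀ h, ∑ k with j.block k = h, τ k = 1)
    {n : ℕ} {ω : Ω} {C₁ C₂ : ℝ} (hC₂ : 0 ≤ C₂)
    (h1 : ‖(WithLp.toLp 2 fun a => empProc W (dataLaw PX ϑs) (fun w => sVec j ϑs w a) n ω :
      EuclideanSpace ℝ (ScoreIndex F j))‖ ≤ C₁)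
    (h2 : empProc W (dataLaw PX ϑs) (relRemainder j ϑs ψ τ) n ω ≤ C₂)
    (hψ : ‖ψ - psiStar j ϑs‖ ≤ 1) :
    ∑ i ∈ Finset.range n, (mixDensity (toParam j ψ τ) (W i ω) / mixDensity ϑs (W i ω) - 1)
      ≤ √n * ‖tVec j ϑs ψ τ‖ * (C₁ + C₂) := by
  set P := dataLaw PX ϑs with hP
  set t := tVec j ϑs ψ τ with ht
  set R := relRemainder j ϑs ψ τ with hR
  set D := ‖t‖ * ‖ψ - psiStar j ϑs‖ with hD
  set l : Obs T d → ℝ := fun w => mixDensity (toParam j ψ τ) w / mixDensity ϑs w with hl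
  obtain ⟨hlint, hlle⟩ := integrable_ratio (PX := PX) hF hM hϑ hM₀ hs
  have hdec : ∀ w, l w - 1 = ∑ a, t a * sVec j ϑs w a + D * R w := fun w => by
    rw [← remainder_eq hF.nonempty hM₀ (mixDensity_pos hF hM₀ hs) hτ hτ1]
    simp only [remainder, hl, ht]
    ring
  have hsum : Integrable (fun w => ∑ a, t a * sVec j ϑs w a) P :=
    integrable_finsetSum _ fun a _ => (hsint a).const_mul _
  have hl1 : Integrable (fun w => l w - 1) P := hlint.sub (integrable_const 1)
  have hRint : Integrable (fun w => D * R w) P := by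
    refine (hl1.sub hsum).congr (Eventually.of_forall fun w => ?_)
    simp only [Pi.sub_apply, hdec w]
    ring
  have hmean : ∑ a, t a * ∫ w, sVec j ϑs w a ∂P + D * ∫ w, R w ∂P ≤ 0 := by
    have e : ∫ w, (l w - 1) ∂P = ∑ a, t a * ∫ w, sVec j ϑs w a ∂P + D * ∫ w, R w ∂P := by
      simp_rw [hdec]
      rw [integral_add hsum hRint, integral_finsetSum _ fun a _ => (hsint a).const_mul _,
        integral_const_mul]
      simp_rw [integral_const_mul]
    rw [← e, integral_sub hlint (integrable_const 1)]
    simp only [integral_const, probReal_univ, smul_eq_mul, mul_one]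
    linarith
  rcases Nat.eq_zero_or_pos n with rfl | hn
  · simp
  have hsqrt : 0 < √(n : ℝ) := Real.sqrt_pos.2 (by exact_mod_cast hn)
  have hemp : ∀ h : Obs T d → ℝ, √n * empProc W P h n ω =
      ∑ i ∈ Finset.range n, h (W i ω) - n * ∫ w, h w ∂P := fun h => by
    rw [empProc, ← mul_assoc, mul_inv_cancel₀ hsqrt.ne', one_mul, Finset.sum_sub_distrib]
    simp
  have hkey : ∑ i ∈ Finset.range n, (l (W i ω) - 1) =
      √n * (∑ a, t a * empProc W P (fun w => sVec j ϑs w a) n ω + D * empProc W P R n ω)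
        + n * (∑ a, t a * ∫ w, sVec j ϑs w a ∂P + D * ∫ w, R w ∂P) := by
    have e1 : √n * (∑ a, t a * empProc W P (fun w => sVec j ϑs w a) n ω + D * empProc W P R n ω)
        = ∑ a, t a * (√n * empProc W P (fun w => sVec j ϑs w a) n ω)
          + D * (√n * empProc W P R n ω) := by
      rw [mul_add, Finset.mul_sum]
      congr 1
      · exact Finset.sum_congr rfl fun a _ => by ring
      · ring
    rw [e1]
    simp_rw [hemp, hdec, Finset.sum_add_distrib, mul_sub, Finset.sum_sub_distrib, Finset.mul_sum]
    rw [Finset.sum_comm, mul_add, Finset.mul_sum]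
    have e2 : ∀ a, t a * (n * ∫ w, sVec j ϑs w a ∂P) = n * (t a * ∫ w, sVec j ϑs w a ∂P) :=
      fun a => by ring
    simp_rw [e2]
    ring
  have hν : ∑ a, t a * empProc W P (fun w => sVec j ϑs w a) n ω ≤ ‖t‖ * C₁ :=
    (le_abs_self _).trans ((abs_sum_mul_le_norm t (WithLp.toLp 2 fun a =>
      empProc W P (fun w => sVec j ϑs w a) n ω)).trans
        (mul_le_mul_of_nonneg_left h1 (norm_nonneg _)))
  have hD0 : 0 ≤ D := mul_nonneg (norm_nonneg _) (norm_nonneg _)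
  have hD1 : D ≤ ‖t‖ := mul_le_of_le_one_right (norm_nonneg _) hψ
  have hνR : D * empProc W P R n ω ≤ ‖t‖ * C₂ :=
    (mul_le_mul_of_nonneg_left h2 hD0).trans (mul_le_mul_of_nonneg_right hD1 hC₂)
  have hn0 : (0 : ℝ) ≤ n := n.cast_nonneg
  change ∑ i ∈ Finset.range n, (l (W i ω) - 1) ≤ _
  rw [hkey]
  nlinarith [mul_nonpos_of_nonneg_of_nonpos hn0 hmean,
    mul_le_mul_of_nonneg_left (add_le_add hν hνR) hsqrt.le]

/-- The quadratic term: the truncated empirical Gram matrix is close to the information matrix. -/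
lemma sum_sq_truncated_ge {κ : Type*} [Fintype κ] {s : Obs T d → EuclideanSpace ℝ κ}
    {I : κ → κ → ℝ} {c A : ℝ} {n : ℕ} {ω : Ω}
    (hI : ∀ t : EuclideanSpace ℝ κ, c * ‖t‖ ^ 2 ≤ ∑ a, ∑ b, t a * t b * I a b)
    (hclose : ∀ a b, |(∑ i ∈ Finset.range n, if ‖s (W i ω)‖ ≤ A then
      s (W i ω) a * s (W i ω) b else 0) / n - I a b| ≤ c / (2 * (Fintype.card κ ^ 2 + 1)))
    (hc : 0 < c) (t : EuclideanSpace ℝ κ) :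
    n * (c / 2) * ‖t‖ ^ 2 ≤ ∑ i ∈ Finset.range n,
      (if ‖s (W i ω)‖ ≤ A then ∑ a, t a * s (W i ω) a else 0) ^ 2 := by
  rcases Nat.eq_zero_or_pos n with rfl | hn
  · simp
  have hn' : (0 : ℝ) < n := by exact_mod_cast hn
  set E : κ → κ → ℝ := fun a b => (∑ i ∈ Finset.range n, if ‖s (W i ω)‖ ≤ A then
      s (W i ω) a * s (W i ω) b else 0) / n with hE
  have h1 : ∑ i ∈ Finset.range n, (if ‖s (W i ω)‖ ≤ A then ∑ a, t a * s (W i ω) a else 0) ^ 2 =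
      n * ∑ a, ∑ b, t a * t b * E a b := by
    have e : ∀ i, (if ‖s (W i ω)‖ ≤ A then ∑ a, t a * s (W i ω) a else 0) ^ 2 =
        ∑ a, ∑ b, t a * t b * (if ‖s (W i ω)‖ ≤ A then s (W i ω) a * s (W i ω) b else 0) := by
      intro i
      split_ifs
      · exact sq_sum_mul _ _
      · simp
    simp_rw [e, hE]
    rw [Finset.sum_comm, Finset.mul_sum]
    refine Finset.sum_congr rfl fun a _ => ?_
    rw [Finset.sum_comm, Finset.mul_sum]
    refine Finset.sum_congr rfl fun b _ => ?_
    rw [← Finset.mul_sum]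
    field_simp
  have hta : ∀ a, |t a| ≤ ‖t‖ := fun a => by
    simpa using PiLp.norm_apply_le t a
  have h2 : ∑ a, ∑ b, t a * t b * I a b - c / 2 * ‖t‖ ^ 2 ≤ ∑ a, ∑ b, t a * t b * E a b := by
    have e1 : ∀ a b, t a * t b * I a b - t a * t b * E a b ≤
        ‖t‖ ^ 2 * (c / (2 * (Fintype.card κ ^ 2 + 1))) := by
      intro a b
      calc t a * t b * I a b - t a * t b * E a b ≤ |t a * t b * I a b - t a * t b * E a b| :=
            le_abs_self _
        _ = |t a| * |t b| * |E a b - I a b| := by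
            rw [← mul_sub, abs_mul, abs_mul, abs_sub_comm]
        _ ≤ ‖t‖ * ‖t‖ * (c / (2 * (Fintype.card κ ^ 2 + 1))) := by
            gcongr
            exacts [hta a, hta b, hclose a b]
        _ = _ := by ring
    have e2 : ∑ a, ∑ b, (t a * t b * I a b - t a * t b * E a b) ≤
        ∑ _a : κ, ∑ _b : κ, ‖t‖ ^ 2 * (c / (2 * (Fintype.card κ ^ 2 + 1))) :=
      Finset.sum_le_sum fun a _ => Finset.sum_le_sum fun b _ => e1 a b
    simp only [Finset.sum_sub_distrib, Finset.sum_const, Finset.card_univ, nsmul_eq_mul] at e2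
    have e3 : (Fintype.card κ : ℝ) * (Fintype.card κ *
        (‖t‖ ^ 2 * (c / (2 * ((Fintype.card κ : ℝ) ^ 2 + 1))))) ≤ c / 2 * ‖t‖ ^ 2 := by
      have : (Fintype.card κ : ℝ) ^ 2 / ((Fintype.card κ : ℝ) ^ 2 + 1) ≤ 1 := by
        rw [div_le_one (by positivity)]
        linarith
      calc _ = c / 2 * ‖t‖ ^ 2 * ((Fintype.card κ : ℝ) ^ 2 / ((Fintype.card κ : ℝ) ^ 2 + 1)) := by
            field_simp
        _ ≤ c / 2 * ‖t‖ ^ 2 * 1 := by gcongr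
        _ = _ := mul_one _
    linarith
  rw [h1, mul_assoc]
  refine mul_le_mul_of_nonneg_left ?_ hn'.le
  have := hI t
  linarith

lemma nbhdPairs_mono {Θ : Set (EuclideanSpace ℝ F.ι)} {c₁ ε ε' : ℝ} (h : ε ≤ ε') :
    nbhdPairs Θ c₁ j ϑs ε ⊆ nbhdPairs Θ c₁ j ϑs ε' := fun _ hq =>
  ⟨⟨hq.1.1, fun τ hτ => (hq.1.2 τ hτ).trans_le h⟩, hq.2⟩

variable [MeasurableSpace Ω] {μ : Measure Ω} [IsProbabilityMeasure μ]

/-- Under the expansion condition the log-likelihood ratio is bounded above in probability,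
uniformly over a neighbourhood `N_ε`. -/
theorem logLik_bounded_near (hF : F.IsRegular) (hW : IsSample μ PX ϑs W) (hM₀ : 1 ≤ M₀)
    (hM : 1 ≤ M) {Θ : Set (EuclideanSpace ℝ F.ι)} (hΘ : Θ ⊆ F.domain)
    (hs : ϑs ∈ paramSpace F.domain M₀) {c₁ : ℝ} (hc₁ : 0 < c₁)
    (hExp : ExpansionCondition μ W (dataLaw PX ϑs) Θ c₁ ϑs j) :
    ∃ ε : ℝ, 0 < ε ∧ ∀ η, 0 < η → ∃ C : ℝ, HighProb μ η fun n ω =>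
      ∀ q ∈ nbhdPairs Θ c₁ j ϑs ε,
        logLik W n ω (toParam j q.1 q.2) - logLik W n ω ϑs ≤ C := by
  have := hW.isProbabilityMeasure
  set P := dataLaw PX ϑs with hP
  have hsm := measurable_sVec (j := j) hF hs
  obtain ⟨c, hc, hI⟩ := exists_gram_lower_bound hExp.info_finite hExp.info_nonsingular
  have hsint : ∀ a, Integrable (fun w => sVec j ϑs w a) P := fun a => by
    have h2 : MemLp (fun w => sVec j ϑs w a) 2 P :=
      (memLp_two_iff_integrable_sq (hsm a).aestronglyMeasurable).2 (by
        simpa only [sq] using hExp.info_finite a a)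
    exact h2.integrable one_le_two
  set N : ℝ := (Fintype.card (ScoreIndex F j) : ℝ) ^ 2 + 1 with hN
  have hN0 : 0 < N := by positivity
  have hκ : 0 < c / (4 * N) := by positivity
  obtain ⟨A, hA, hAclose⟩ := exists_truncation hsm hExp.info_finite hκ
  obtain ⟨ε₁, hε₁, ⟨G₀, hG₀, hRG₀⟩, hRsup⟩ := hExp.remainder_bound
  -- A measurable version of the dominating function.
  obtain ⟨G, hGm, hG, hRG⟩ : ∃ G : Obs T d → ℝ, Measurable G ∧ Integrable G P ∧
      ∀ᵐ w ∂P, ∀ q ∈ nbhdPairs Θ c₁ j ϑs ε₁, |relRemainder j ϑs q.1 q.2 w| ^ 2 ≤ G w := by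
    refine ⟨hG₀.1.mk G₀, hG₀.1.stronglyMeasurable_mk.measurable, hG₀.congr hG₀.1.ae_eq_mk, ?_⟩
    filter_upwards [hRG₀, hG₀.1.ae_eq_mk] with w hw he q hq
    rw [← he]
    exact hw q hq
  set B := |∫ w, G w ∂P| + 1 with hB
  have hB0 : 0 < B := by positivity
  -- With `‖ψ - ψ*‖ < ζ` the squared remainders are a small fraction of the quadratic term.
  set ζ := min 1 √(c / (8 * B)) with hζ
  have hζ0 : 0 < ζ := lt_min one_pos (Real.sqrt_pos.2 (by positivity))
  have hζB : ζ ^ 2 * B ≤ c / 8 := by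
    have h1 : ζ ^ 2 ≤ c / (8 * B) := by
      have := Real.sq_sqrt (show 0 ≤ c / (8 * B) by positivity)
      rw [← this]
      exact pow_le_pow_left₀ hζ0.le (min_le_right _ _) 2
    calc ζ ^ 2 * B ≤ c / (8 * B) * B := mul_le_mul_of_nonneg_right h1 hB0.le
      _ = c / 8 := by field_simp
  obtain ⟨ζ', hζ'0, hζ'⟩ := hExp.psi_tendsto ζ hζ0
  -- The bound `‖t‖ ≤ A⁻¹` keeps the truncated linear terms in `[-1, 1]`.
  refine ⟨min ε₁ (min ζ' A⁻¹), lt_min hε₁ (lt_min hζ'0 (inv_pos.2 hA)), fun η hη => ?_⟩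
  obtain ⟨C₁, hC₁⟩ := hExp.score_bound (η / 4) (by positivity)
  obtain ⟨C₂, hC₂⟩ := hRsup (η / 4) (by positivity)
  refine ⟨16 * (C₁ + max C₂ 0) ^ 2 / c, ?_⟩
  have hE1 : HighProb μ (η / 4) fun n ω => ∀ ab : ScoreIndex F j × ScoreIndex F j,
      |(∑ i ∈ Finset.range n, if ‖sVec j ϑs (W i ω)‖ ≤ A then
        sVec j ϑs (W i ω) ab.1 * sVec j ϑs (W i ω) ab.2 else 0) / n
        - ∫ w, (if ‖sVec j ϑs w‖ ≤ A then sVec j ϑs w ab.1 * sVec j ϑs w ab.2 else 0) ∂P|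
        < c / (4 * N) := by
    refine HighProb.forall_fintype (by positivity) fun ab => ?_
    have hnorm : Measurable fun w => ‖sVec j ϑs w‖ :=
      ((WithLp.measurable_toLp 2 _).comp (measurable_pi_lambda _ hsm)).norm
    have hset : MeasurableSet {w | ‖sVec j ϑs w‖ ≤ A} := measurableSet_le hnorm measurable_const
    have hm : Measurable fun w =>
        if ‖sVec j ϑs w‖ ≤ A then sVec j ϑs w ab.1 * sVec j ϑs w ab.2 else 0 :=
      Measurable.ite hset ((hsm _).mul (hsm _)) measurable_const
    have hcard : 0 < Fintype.card (ScoreIndex F j × ScoreIndex F j) :=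
      Fintype.card_pos_iff.2 ⟨ab⟩
    refine hW.average_close hm ?_ hκ (by positivity)
    exact (hExp.info_finite ab.1 ab.2).indicator hset |>.congr (Eventually.of_forall fun w => by
      simp [Set.indicator_apply])
  have hE2 := hW.average_close hGm hG one_pos (show 0 < η / 8 by positivity)
  have hE3 : HighProb μ (η / 8) fun _ ω => ∀ i, ∀ q ∈ nbhdPairs Θ c₁ j ϑs ε₁,
      |relRemainder j ϑs q.1 q.2 (W i ω)| ^ 2 ≤ G (W i ω) :=
    HighProb.of_ae ((hW.ae_forall hRG).mono fun ω hω _ => hω)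
  have hE4 : HighProb μ (η / 4) fun n ω => ‖(WithLp.toLp 2 fun a =>
      empProc W P (fun w => sVec j ϑs w a) n ω : EuclideanSpace ℝ (ScoreIndex F j))‖ ≤ C₁ := by
    simpa [HighProb] using hC₁
  have hE5 : HighProb μ (η / 4) fun n ω => ∀ q ∈ nbhdPairs Θ c₁ j ϑs ε₁,
      empProc W P (relRemainder j ϑs q.1 q.2) n ω ≤ C₂ := by
    simpa only [HighProb, not_forall, not_le, exists_prop] using hC₂
  have hall := (hE1.and (by positivity) (by positivity) (hE4.and (by positivity) (by positivity)
    hE5)).and (by positivity) (by positivity) (hE2.and (by positivity) (by positivity) hE3)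
  have hηsum : η / 4 + (η / 4 + η / 4) + (η / 8 + η / 8) = η := by ring
  rw [hηsum] at hall
  refine hall.mono ?_
  filter_upwards [eventually_gt_atTop 0] with n hn ω
  rintro ⟨⟨h1, h4, h5⟩, h2, h3⟩ q hq
  have hn' : (0 : ℝ) < n := by exact_mod_cast hn
  have hq₁ : q ∈ nbhdPairs Θ c₁ j ϑs ε₁ := nbhdPairs_mono (min_le_left _ _) hq
  have hqζ : q ∈ nbhdPairs Θ c₁ j ϑs ζ' :=
    nbhdPairs_mono ((min_le_right _ _).trans (min_le_left _ _)) hq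
  have htA : ‖tVec j ϑs q.1 q.2‖ ≤ A⁻¹ :=
    ((hq.1.2 q.2 hq.2.1).trans_le ((min_le_right _ _).trans (min_le_right _ _))).le
  have hψ := hζ' q.1 hqζ.1
  obtain ⟨hτc, -, hτ1⟩ := tauSpace_bounds hM hc₁ hq.2.1
  have hτ : ∀ k, 0 < q.2 k := fun k => hc₁.trans_le (hτc k)
  have hϑ : toParam j q.1 q.2 ∈ paramSpace F.domain M := paramSpace_mono hΘ M hq.2.2
  have hgpos := mixDensity_pos hF hM₀ hs
  have hlik : logLik W n ω (toParam j q.1 q.2) - logLik W n ω ϑs = ∑ i ∈ Finset.range n,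
      Real.log (mixDensity (toParam j q.1 q.2) (W i ω) / mixDensity ϑs (W i ω)) := by
    unfold logLik
    rw [← Finset.sum_sub_distrib]
    exact Finset.sum_congr rfl fun i _ =>
      (Real.log_div (mixDensity_pos hF hM hϑ _).ne' (hgpos _).ne').symm
  rw [hlik]
  set t := tVec j ϑs q.1 q.2 with ht
  refine sum_log_le_of_quadratic (t := ‖t‖) (B := C₁ + max C₂ 0) (c := c)
    (a := fun i => ∑ a, t a * sVec j ϑs (W i ω) a)
    (r := fun i => remainder j ϑs q.1 q.2 (W i ω))
    (b := fun i => if ‖sVec j ϑs (W i ω)‖ ≤ A then ∑ a, t a * sVec j ϑs (W i ω) a else 0)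
    hc (fun i _ => div_pos (mixDensity_pos hF hM hϑ _) (hgpos _)) (fun i _ => ?_) (fun i _ => ?_)
    (fun i _ => ?_) ?_ ?_ ?_
  · simp only [remainder, ht]
    ring
  · beta_reduce
    split_ifs <;> simp
  · beta_reduce
    split_ifs with hsA
    · have h6 : |∑ a, t a * sVec j ϑs (W i ω) a| ≤ 1 := by
        refine (abs_sum_mul_le_norm t _).trans ?_
        calc ‖t‖ * ‖sVec j ϑs (W i ω)‖ ≤ A⁻¹ * A := by gcongr
          _ = 1 := inv_mul_cancel₀ hA.ne'
      exact (sq_le_one_iff_abs_le_one _).2 h6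
    · norm_num
  · exact sum_ratio_sub_one_le hF hM₀ hM hs hsint hϑ hτ hτ1 (le_max_right _ _) h4
      ((h5 q hq₁).trans (le_max_left _ _)) (hψ.le.trans (min_le_left _ _))
  · refine sum_sq_truncated_ge hI (fun a b => ?_) hc t
    have e1 := (h1 (a, b)).le
    have e2 := (hAclose a b).le
    have e3 : c / (2 * (Fintype.card (ScoreIndex F j) ^ 2 + 1)) = c / (4 * N) + c / (4 * N) := by
      rw [hN]
      field_simp
      ring
    rw [e3]
    exact (abs_sub_le _ _ _).trans (add_le_add e1 e2)
  · have hGsum : ∑ i ∈ Finset.range n, G (W i ω) ≤ n * B := by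
      have e1 := (abs_lt.1 h2).2
      have e2 : (∑ i ∈ Finset.range n, G (W i ω)) / n ≤ B := by
        have := le_abs_self (∫ w, G w ∂P)
        simp only [hB]
        linarith
      rwa [div_le_iff₀ hn', mul_comm] at e2
    calc ∑ i ∈ Finset.range n, remainder j ϑs q.1 q.2 (W i ω) ^ 2
        ≤ ∑ i ∈ Finset.range n, (‖t‖ ^ 2 * ζ ^ 2) * G (W i ω) := by
          refine Finset.sum_le_sum fun i _ => ?_
          have e1 := h3 i q hq₁
          rw [sq_abs] at e1
          rw [remainder_eq hF.nonempty hM₀ hgpos hτ hτ1, mul_pow, mul_pow]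
          gcongr
      _ = ‖t‖ ^ 2 * ζ ^ 2 * ∑ i ∈ Finset.range n, G (W i ω) := by rw [Finset.mul_sum]
      _ ≤ ‖t‖ ^ 2 * ζ ^ 2 * (n * B) := by gcongr
      _ = n * ‖t‖ ^ 2 * (ζ ^ 2 * B) := by ring
      _ ≤ n * ‖t‖ ^ 2 * (c / 8) := by gcongr
      _ = n * (c / 8) * ‖t‖ ^ 2 := by ring

end Expansion

/-! ### Parameters near the true density in the coordinates of a partition -/

section LocalCoordinates

variable {T d : ℕ} {F : ComponentFamily T d} {M M₀ : ℕ} {j : BlockPartition M M₀}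
  {ϑs : MixParam F M₀}

lemma firstTau_eq {τ : Fin M → ℝ} {k : Fin M}
    (hk : ¬ ∃ k' : Fin M, k' < k ∧ j.block k' = j.block k) :
    firstTau j τ (j.block k) = τ k := by
  unfold firstTau
  push Not at hk
  have : (Finset.univ.filter fun k₁ : Fin M => j.block k₁ = j.block k ∧
      ∀ k' < k₁, j.block k' ≠ j.block k₁) = {k} := by
    refine Finset.eq_singleton_iff_unique_mem.2 ⟨by simpa using hk, fun k₁ hk₁ => ?_⟩
    obtain ⟨-, h1, h2⟩ := Finset.mem_filter.1 hk₁
    rcases lt_trichotomy k₁ k with h | h | h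
    · exact absurd h1 (hk k₁ h)
    · exact h
    · exact absurd h1.symm (h2 k h)
  rw [this, Finset.sum_singleton]

lemma exists_first (j : BlockPartition M M₀) (h : Fin M₀) :
    ∃ k, j.block k = h ∧ ¬ ∃ k' : Fin M, k' < k ∧ j.block k' = j.block k := by
  obtain ⟨k₀, hk₀⟩ := j.surjective h
  have hne : (Finset.univ.filter fun k => j.block k = h).Nonempty := ⟨k₀, by simpa using hk₀⟩
  have hmem := (Finset.mem_filter.1 (Finset.min'_mem _ hne)).2
  refine ⟨Finset.min' _ hne, hmem, ?_⟩
  rintro ⟨k', hlt, hk'⟩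
  exact absurd (Finset.min'_le _ k' (by simpa using hk'.trans hmem)) (not_le.2 hlt)

/-- The coordinates `(β, ν, λ)` of the mixture with block proportions `β`, within-block proportions
`τ` and component parameters `θ`. -/
def coordinates (j : BlockPartition M M₀) (β : Fin (M₀ - 1) → ℝ) (τ : Fin M → ℝ)
    (θ : Fin M → EuclideanSpace ℝ F.ι) : Psi F j :=
  WithLp.toLp 2 <| Sum.elim β <| Sum.elim
    (fun ha => ∑ k with j.block k = ha.1, τ k * θ k ha.2)
    (fun la => (θ la.1 la.2 - ∑ k with j.block k = j.block la.1, τ k * θ k la.2) /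
      firstTau j τ (j.block la.1))

lemma deviation_coordinates {β : Fin (M₀ - 1) → ℝ} {τ : Fin M → ℝ}
    {θ : Fin M → EuclideanSpace ℝ F.ι} (hτ : ∀ k, 0 < τ k)
    (hτ1 : ∀ h, ∑ k with j.block k = h, τ k = 1) (k : Fin M) (a : F.ι) :
    deviation j (coordinates j β τ θ) τ k a =
      θ k a - ∑ k' with j.block k' = j.block k, τ k' * θ k' a := by
  have hfirst : ∀ h, 0 < firstTau j τ h := fun h => by
    obtain ⟨k, rfl, hk⟩ := exists_first j h
    rw [firstTau_eq hk]
    exact hτ k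
  unfold deviation
  split_ifs with hk
  · simp only [coordinates, Sum.elim_inr]
    exact mul_div_cancel₀ _ (hfirst _).ne'
  · set ν := ∑ k' with j.block k' = j.block k, τ k' * θ k' a with hν
    -- The weighted deviations of a block add up to zero.
    have hzero : ∑ k' with j.block k' = j.block k, τ k' * (θ k' a - ν) = 0 := by
      simp_rw [mul_sub, Finset.sum_sub_distrib, ← Finset.sum_mul]
      rw [hτ1, one_mul, sub_self]
    set p : Fin M → Prop := fun k₁ => ∃ k' : Fin M, k' < k₁ ∧ j.block k' = j.block k₁ with hp
    have hsub : ∑ l : NonFirst j, (if j.block l = j.block k then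
        τ l * (coordinates j β τ θ) (.inr (.inr (l, a))) else 0) =
        (∑ k' with p k', if j.block k' = j.block k then τ k' * (θ k' a - ν) else 0) / τ k := by
      rw [Finset.sum_subtype (p := p) (Finset.univ.filter p) (by simp), Finset.sum_div]
      refine Finset.sum_congr rfl fun l _ => ?_
      split_ifs with hl
      · simp only [coordinates, Sum.elim_inr]
        rw [hl, firstTau_eq hk, mul_div_assoc]
      · simp
    have hnot : (∑ k' with ¬ p k', if j.block k' = j.block k then τ k' * (θ k' a - ν) else 0) =
        τ k * (θ k a - ν) := by
      rw [Finset.sum_eq_single_of_mem k (Finset.mem_filter.2 ⟨Finset.mem_univ k, hk⟩)]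
      · simp
      · intro k' hk' hne
        refine if_neg fun h => ?_
        have hk'p := (Finset.mem_filter.1 hk').2
        rcases lt_or_gt_of_ne hne with hlt | hlt
        · exact hk ⟨k', hlt, h⟩
        · exact hk'p ⟨k, hlt, h.symm⟩
    rw [Finset.sum_filter, ← Finset.sum_filter_add_sum_filter_not _ p, hnot] at hzero
    rw [hsub, eq_neg_of_add_eq_zero_left hzero, neg_div, neg_neg, mul_div_cancel_left₀ _ (hτ k).ne']

lemma comp_toParam_coordinates {β : Fin (M₀ - 1) → ℝ} {τ : Fin M → ℝ}
    {θ : Fin M → EuclideanSpace ℝ F.ι} (hτ : ∀ k, 0 < τ k)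
    (hτ1 : ∀ h, ∑ k with j.block k = h, τ k = 1) (k : Fin M) :
    comp (toParam j (coordinates j β τ θ) τ) k = θ k := by
  refine PiLp.ext fun a => ?_
  simp only [comp, toParam, Sum.elim_inr, deviation_coordinates hτ hτ1]
  simp [coordinates]

lemma norm_le_card_mul {κ : Type*} [Fintype κ] (x : EuclideanSpace ℝ κ) {B : ℝ}
    (hB : ∀ a, |x a| ≤ B) : ‖x‖ ≤ Fintype.card κ * B := by
  rw [EuclideanSpace.norm_eq]
  refine (sqrt_sum_le _ _ fun a => sq_nonneg _).trans ?_
  calc ∑ a, √(‖x a‖ ^ 2) ≤ ∑ _a : κ, B := Finset.sum_le_sum fun a _ => by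
        rw [Real.sqrt_sq (norm_nonneg _)]
        exact hB a
    _ = Fintype.card κ * B := by simp

/-- The deviations are small with `λ`, uniformly in `τ`; the within-block proportions `τ` need not
be those from which `λ` was computed. -/
lemma abs_deviation_le {ψ : Psi F j} {τ : Fin M → ℝ} {B : ℝ} (hB : 0 ≤ B)
    (hτ0 : ∀ k, 0 ≤ τ k) (hτ1 : ∀ k, τ k ≤ 1)
    (hψ : ∀ l a, |ψ (.inr (.inr (l, a)))| ≤ B) (k : Fin M) (a : F.ι) :
    |deviation j ψ τ k a| ≤ (M + 1) * B := by
  have hfirst : ∀ h, |firstTau j τ h| ≤ 1 := fun h => by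
    obtain ⟨k, rfl, hk⟩ := exists_first j h
    rw [firstTau_eq hk, abs_of_nonneg (hτ0 k)]
    exact hτ1 k
  have hM : (0 : ℝ) ≤ M := M.cast_nonneg
  unfold deviation
  split_ifs with hk
  · rw [abs_mul]
    have := mul_le_mul (hfirst (j.block k)) (hψ ⟨k, hk⟩ a) (abs_nonneg _) zero_le_one
    nlinarith
  · rw [abs_neg]
    have hcard : (Fintype.card (NonFirst j) : ℝ) ≤ M := by
      have := Fintype.card_subtype_le fun k : Fin M =>
        ∃ k' : Fin M, k' < k ∧ j.block k' = j.block k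
      rw [Fintype.card_fin] at this
      exact_mod_cast this
    refine (Finset.abs_sum_le_sum_abs _ _).trans ?_
    calc ∑ l : NonFirst j, |if j.block l = j.block k then τ l * ψ (.inr (.inr (l, a))) else 0|
        ≤ ∑ _l : NonFirst j, B := Finset.sum_le_sum fun l _ => by
          split_ifs
          · rw [abs_mul, abs_of_nonneg (hτ0 _)]
            have := mul_le_mul (hτ1 l) (hψ l a) (abs_nonneg _) zero_le_one
            linarith
          · simpa using hB
      _ = Fintype.card (NonFirst j) * B := by simp
      _ ≤ (M + 1) * B := by nlinarith

/-- A mixture whose block proportions are close to `α*` and whose components are close to the true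
component of their block is described by a pair `(ψ, τ)` with `ψ ∈ N_ε`. -/
lemma exists_mem_nbhdPairs (hM : 1 ≤ M) (hM₀ : 1 ≤ M₀) {Θ : Set (EuclideanSpace ℝ F.ι)} {c₁ : ℝ}
    (hc₁ : 0 < c₁) (j : BlockPartition M M₀) (ϑs : MixParam F M₀) {ε : ℝ} (hε : 0 < ε) :
    ∃ δ : ℝ, 0 < δ ∧ ∀ (β : Fin (M₀ - 1) → ℝ) (τ : Fin M → ℝ) (θ : Fin M → EuclideanSpace ℝ F.ι),
      (∀ h, 0 ≤ fullWeights β h) → τ ∈ tauSpace c₁ j → (∀ k, θ k ∈ Θ) →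
      (∀ i, |β i - ϑs (.inl i)| < δ) → (∀ k a, |θ k a - ϑs (.inr (j.block k, a))| < δ) →
      ∃ q ∈ nbhdPairs Θ c₁ j ϑs ε, ∀ w, mixDensity (toParam j q.1 q.2) w =
        ∑ k, fullWeights β (j.block k) * τ k * F.density (θ k) w := by
  set B : ℝ := 1 + (M + 1) * (2 / c₁) with hB
  have hM0 : (0 : ℝ) ≤ M := M.cast_nonneg
  have hB1 : 1 ≤ B := by
    have : 0 ≤ (M + 1) * (2 / c₁) := by positivity
    linarith
  have hB0 : 0 < B := by linarith
  set D : ℝ := (Fintype.card (ScoreIndex F j) : ℝ) with hD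
  have hD0 : 0 ≤ D := Nat.cast_nonneg _
  refine ⟨min B⁻¹ (ε / (B * (D + 1))), lt_min (inv_pos.2 hB0) (by positivity), ?_⟩
  intro β τ θ hβ hτ hθ hβδ hθδ
  set δ := min B⁻¹ (ε / (B * (D + 1))) with hδ
  have hδ0 : 0 < δ := lt_min (inv_pos.2 hB0) (by positivity)
  have hBδ1 : B * δ ≤ 1 := by
    calc B * δ ≤ B * B⁻¹ := mul_le_mul_of_nonneg_left (min_le_left _ _) hB0.le
      _ = 1 := mul_inv_cancel₀ hB0.ne'
  have hBδε : D * (B * δ) < ε := by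
    calc D * (B * δ) ≤ D * (B * (ε / (B * (D + 1)))) := by
          gcongr
          exact min_le_right _ _
      _ = ε * (D / (D + 1)) := by field_simp
      _ < ε * 1 := by
          gcongr
          rw [div_lt_one (by positivity)]
          linarith
      _ = ε := mul_one ε
  obtain ⟨hτc, hτle, hτ1⟩ := tauSpace_bounds hM hc₁ hτ
  have hτ0 : ∀ k, 0 < τ k := fun k => hc₁.trans_le (hτc k)
  set ψ := coordinates j β τ θ with hψ
  have hcomp := comp_toParam_coordinates (j := j) (β := β) (θ := θ) hτ0 hτ1
  have hweight : ∀ k, weight (toParam j ψ τ) k = fullWeights β (j.block k) * τ k := fun k => by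
    rw [weight_toParam hM₀ hτ1]
    simp [hψ, coordinates]
  have hmem : toParam j ψ τ ∈ paramSpace Θ M := by
    refine ⟨fun k => ?_, fun k => ?_⟩
    · rw [hweight]
      exact mul_nonneg (hβ _) (hτ0 k).le
    · rw [hcomp]
      exact hθ k
  have hν : ∀ h a, |∑ k with j.block k = h, τ k * θ k a - ϑs (.inr (h, a))| ≤ δ := by
    intro h a
    have e : ∑ k with j.block k = h, τ k * θ k a - ϑs (.inr (h, a)) =
        ∑ k with j.block k = h, τ k * (θ k a - ϑs (.inr (h, a))) := by
      simp_rw [mul_sub, Finset.sum_sub_distrib, ← Finset.sum_mul]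
      rw [hτ1, one_mul]
    rw [e]
    refine (Finset.abs_sum_le_sum_abs _ _).trans ?_
    calc ∑ k with j.block k = h, |τ k * (θ k a - ϑs (.inr (h, a)))|
        ≤ ∑ k with j.block k = h, τ k * δ := Finset.sum_le_sum fun k hk => by
          rw [abs_mul, abs_of_pos (hτ0 k), ← (Finset.mem_filter.1 hk).2]
          exact mul_le_mul_of_nonneg_left (hθδ k a).le (hτ0 k).le
      _ = δ := by rw [← Finset.sum_mul, hτ1, one_mul]
  have hlam : ∀ l a, |ψ (.inr (.inr (l, a)))| ≤ 2 * δ / c₁ := by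
    intro l a
    obtain ⟨k, hk, hkf⟩ := exists_first j (j.block l)
    have hft : c₁ ≤ firstTau j τ (j.block l) := by
      rw [← hk, firstTau_eq hkf]
      exact hτc k
    simp only [hψ, coordinates, Sum.elim_inr]
    rw [abs_div, abs_of_pos (hc₁.trans_le hft)]
    have h1 : |θ l a - ∑ k with j.block k = j.block l, τ k * θ k a| ≤ 2 * δ := by
      have h2 := abs_sub_le (θ l a) (ϑs (.inr (j.block l, a)))
        (∑ k with j.block k = j.block l, τ k * θ k a)
      have h3 := hν (j.block l) a
      rw [abs_sub_comm] at h3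
      linarith [hθδ l a]
    exact div_le_div₀ (by positivity) h1 hc₁ hft
  have hnb : ψ ∈ nbhd Θ c₁ j ϑs ε := by
    refine ⟨⟨τ, hτ, hmem⟩, fun τ' hτ' => ?_⟩
    obtain ⟨hτ'c, hτ'le, hτ'1⟩ := tauSpace_bounds hM hc₁ hτ'
    have hτ'0 : ∀ k, 0 ≤ τ' k := fun k => hc₁.le.trans (hτ'c k)
    have hdev : ∀ k a, |deviation j ψ τ' k a| ≤ B * δ := fun k a => by
      refine (abs_deviation_le (by positivity) hτ'0 hτ'le hlam k a).trans ?_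
      have : (M + 1) * (2 * δ / c₁) = (B - 1) * δ := by
        rw [hB]
        ring
      rw [this]
      nlinarith
    refine (norm_le_card_mul _ (B := B * δ) fun i => ?_).trans_lt hBδε
    rcases i with i | ⟨h, a⟩ | ⟨h, ⟨p, hp⟩, I⟩
    · simp only [tVec, Sum.elim_inl, hψ, coordinates]
      nlinarith [hβδ i]
    · simp only [tVec, Sum.elim_inl, Sum.elim_inr, hψ, coordinates]
      nlinarith [hν h a]
    · simp only [tVec, Sum.elim_inr]
      have hp2 := (Finset.mem_Icc.1 hp).1
      have hprod : ∀ k, |((I : Multiset F.ι).map (deviation j ψ τ' k)).prod| ≤ B * δ := by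
        intro k
        have h1 : |((I : Multiset F.ι).map (deviation j ψ τ' k)).prod| ≤ (B * δ) ^ p := by
          have habs := map_multiset_prod (absHom : ℝ →*₀ ℝ)
            ((I : Multiset F.ι).map (deviation j ψ τ' k))
          rw [Multiset.map_map] at habs
          refine habs.trans_le ?_
          refine (Multiset.prod_map_le_prod_map₀ _ (fun _ => B * δ) (fun a _ => abs_nonneg _)
            (fun a _ => hdev k a)).trans ?_
          simp
        exact h1.trans (pow_le_of_le_one (by positivity) hBδ1 (by omega))
      refine (Finset.abs_sum_le_sum_abs _ _).trans ?_
      calc ∑ k with j.block k = h, |τ' k * ((I : Multiset F.ι).map (deviation j ψ τ' k)).prod|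
          ≤ ∑ k with j.block k = h, τ' k * (B * δ) := Finset.sum_le_sum fun k _ => by
            rw [abs_mul, abs_of_nonneg (hτ'0 k)]
            exact mul_le_mul_of_nonneg_left (hprod k) (hτ'0 k)
        _ = B * δ := by rw [← Finset.sum_mul, hτ'1, one_mul]
  refine ⟨(ψ, τ), ⟨hnb, hτ, hmem⟩, fun w => ?_⟩
  unfold mixDensity
  exact Finset.sum_congr rfl fun k _ => by rw [hweight, hcomp]

end LocalCoordinates

/-! ### Identification of the true components -/

section Identification

variable {T d : ℕ} {F : ComponentFamily T d} {M M₀ : ℕ} {ϑs : MixParam F M₀}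

instance : Finite (BlockPartition M M₀) :=
  Finite.of_injective BlockPartition.block fun j j' h => by
    cases j
    cases j'
    congr

lemma nonempty_blockPartition (hM₀ : 1 ≤ M₀) (hM : M₀ < M) : Nonempty (BlockPartition M M₀) :=
  ⟨{ block := fun k => ⟨min k (M₀ - 1), by omega⟩
     monotone := fun k k' h => by
      have h' : (k : ℕ) ≤ k' := h
      exact Fin.mk_le_mk.2 (min_le_min_right _ h')
     surjective := fun h => ⟨⟨h, h.2.trans hM⟩, Fin.ext (by
      have := h.2
      simp only
      omega)⟩ }⟩

lemma sum_mul_sub_last (hM₀ : 1 ≤ M₀) {x : Fin M₀ → ℝ} (hx : ∑ h, x h = 0) (f : Fin M₀ → ℝ) :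
    ∑ i : Fin (M₀ - 1), x ⟨i, i.2.trans_le (Nat.sub_le _ _)⟩ *
      (f ⟨i, i.2.trans_le (Nat.sub_le _ _)⟩ - f ⟨M₀ - 1, by omega⟩) = ∑ h, x h * f h := by
  obtain ⟨m, rfl⟩ : ∃ m, M₀ = m + 1 := ⟨M₀ - 1, by omega⟩
  rw [Fin.sum_univ_castSucc] at hx ⊢
  have hlast : x (Fin.last m) = -∑ i : Fin m, x i.castSucc := by linarith
  rw [hlast, neg_mul, Finset.sum_mul]
  simp_rw [mul_sub, Finset.sum_sub_distrib]
  rfl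

variable {PX : Measure (Fin T → Fin d → ℝ)} {j : BlockPartition M M₀}

/-- If the information matrix is nonsingular then no true component has weight zero, since its
first-order scores would vanish. -/
lemma weight_ne_zero_of_infoMatrix (hι : Nonempty F.ι) {P : Measure (Obs T d)}
    (hdet : (infoMatrix P j ϑs).det ≠ 0) (h : Fin M₀) : weight ϑs h ≠ 0 := by
  intro h0
  refine hdet (Matrix.det_eq_zero_of_row_eq_zero (.inr (.inl (h, hι.some))) fun b => ?_)
  simp [infoMatrix, sVec, h0]

/-- If the information matrix is nonsingular then the true component densities are linearly
independent: a mixture of them that equals the true density has the true weights. -/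
lemma weights_eq_of_mixture_eq (hM₀ : 1 ≤ M₀) {P : Measure (Obs T d)}
    (hint : ∀ a b, Integrable (fun w => sVec j ϑs w a * sVec j ϑs w b) P)
    (hdet : (infoMatrix P j ϑs).det ≠ 0) {β : Fin M₀ → ℝ} (hβ : ∑ h, β h = 1)
    (hae : ∀ᵐ w ∂P, ∑ h, β h * F.density (comp ϑs h) w = mixDensity ϑs w) (h : Fin M₀) :
    β h = weight ϑs h := by
  set x : Fin M₀ → ℝ := fun h => β h - weight ϑs h with hx
  have hx0 : ∑ h, x h = 0 := by
    simp only [hx, Finset.sum_sub_distrib, hβ, sum_weight hM₀, sub_self]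
  have ht := eq_zero_of_sum_mul_ae_eq_zero hint hdet
    (Sum.elim (fun i => x ⟨i, i.2.trans_le (Nat.sub_le _ _)⟩) 0) (hae.mono fun w hw => ?_)
  · have hxi : ∀ i : Fin (M₀ - 1), x ⟨i, i.2.trans_le (Nat.sub_le _ _)⟩ = 0 := fun i =>
      congrFun ht (.inl i)
    have hsum := fullWeights_of_sum_eq_one hβ h
    have hβ' : (fun i : Fin (M₀ - 1) => β ⟨i, i.2.trans_le (Nat.sub_le _ _)⟩) =
        fun i => ϑs (.inl i) := funext fun i => by
      have := sub_eq_zero.1 (hxi i)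
      rw [this, weight, fullWeights_castLE]
    rw [← hsum, hβ']
    rfl
  · simp only [Fintype.sum_sum_type, Sum.elim_inl, Sum.elim_inr, Pi.zero_apply, zero_mul,
      Finset.sum_const_zero, add_zero, sVec]
    simp_rw [mul_div_assoc', ← Finset.sum_div]
    rw [sum_mul_sub_last hM₀ hx0 fun h => F.density (comp ϑs h) w]
    simp only [hx, sub_mul, Finset.sum_sub_distrib]
    rw [hw]
    simp [mixDensity]

lemma sum_mul_comp_block {f : EuclideanSpace ℝ F.ι → ℝ} {ϑ : MixParam F M} {b : Fin M → Fin M₀}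
    (hb : ∀ k, comp ϑ k = comp ϑs (b k)) :
    ∑ k, weight ϑ k * f (comp ϑ k) =
      ∑ h, (∑ k with b k = h, weight ϑ k) * f (comp ϑs h) := by
  rw [← Finset.sum_fiberwise_of_maps_to (s := Finset.univ) (t := Finset.univ) (g := b)
    (fun k _ => Finset.mem_univ _)]
  refine Finset.sum_congr rfl fun h _ => ?_
  rw [Finset.sum_mul]
  exact Finset.sum_congr rfl fun k hk => by rw [hb, (Finset.mem_filter.1 hk).2]

/-- A parameter that reproduces the true density with replicated true components splits each true
weight among the replicates of that component. -/
lemma exists_block_of_trueSet (hM : 1 ≤ M) (hM₀ : 1 ≤ M₀) (hι : Nonempty F.ι)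
    {P : Measure (Obs T d)}
    (hint : ∀ a b, Integrable (fun w => sVec j ϑs w a * sVec j ϑs w b) P)
    (hdet : (infoMatrix P j ϑs).det ≠ 0) {ϑ : MixParam F M}
    (hae : ∀ᵐ w ∂P, mixDensity ϑ w = mixDensity ϑs w)
    (hcomp : ∀ k, ∃ h, comp ϑ k = comp ϑs h) :
    ∃ b : Fin M → Fin M₀, (∀ k, comp ϑ k = comp ϑs (b k)) ∧
      (∀ h, ∑ k with b k = h, weight ϑ k = weight ϑs h) ∧ Function.Surjective b := by
  choose b hb using hcomp
  have hw : ∀ h, ∑ k with b k = h, weight ϑ k = weight ϑs h := by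
    refine weights_eq_of_mixture_eq hM₀ hint hdet ?_ (hae.mono fun w hw => ?_)
    · rw [Finset.sum_fiberwise_of_maps_to (fun k _ => Finset.mem_univ _), sum_weight hM]
    · rw [← sum_mul_comp_block (f := fun θ => F.density θ w) hb]
      exact hw
  refine ⟨b, hb, hw, fun h => ?_⟩
  by_contra! hne
  refine weight_ne_zero_of_infoMatrix hι hdet h ?_
  rw [← hw h, Finset.sum_eq_zero fun k hk => absurd (Finset.mem_filter.1 hk).2 (hne k)]

/-- The true parameter satisfies the restrictions of `Θ̄`, so that the maximizer over `Θ̄` in the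
model with `M₀` components has a likelihood at least that of the true parameter. -/
lemma true_mem_restrictedSpace (hM : 1 ≤ M) (hM₀ : 1 ≤ M₀) {Θ : Set (EuclideanSpace ℝ F.ι)}
    {c : Constants} (hs : ϑs ∈ paramSpace Θ M₀) {ϑ : MixParam F M}
    (hϑ : ϑ ∈ restrictedSpace Θ c M) {b : Fin M → Fin M₀}
    (hb : ∀ k, comp ϑ k = comp ϑs (b k))
    (hw : ∀ h, ∑ k with b k = h, weight ϑ k = weight ϑs h) (hsurj : Function.Surjective b) :
    ϑs ∈ restrictedSpace Θ c M₀ := by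
  obtain ⟨hϑp, hα, hvar⟩ := hϑ
  refine ⟨hs, (mem_alphaSpace_iff hM₀ c.c₁_pos).2 fun h => ?_, fun v => ?_⟩
  · change _ ≤ weight ϑs h
    obtain ⟨k, hk⟩ := hsurj h
    rw [← hw h]
    exact ((mem_alphaSpace_iff hM c.c₁_pos).1 hα k).trans
      (Finset.single_le_sum (fun k' _ => hϑp.1 k') (by simpa using hk))
  · have e := sum_mul_comp_block (f := F.variance v) hb
    simp_rw [hw] at e
    rw [← e]
    refine ⟨fun h => ?_, (hvar v).2⟩
    obtain ⟨k, rfl⟩ := hsurj h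
    rw [← hb]
    exact (hvar v).1 k

/-- Near a parameter that replicates the true components, every parameter in `Θ̄` is, up to the
order of its components, described by a pair `(ψ, τ)` of some partition. -/
lemma eventually_exists_nbhdPairs (hM : 1 ≤ M) (hM₀ : 1 ≤ M₀) {Θ : Set (EuclideanSpace ℝ F.ι)}
    {c : Constants} {ε : BlockPartition M M₀ → ℝ} (hε : ∀ j, 0 < ε j) {ϑ₀ : MixParam F M}
    {b : Fin M → Fin M₀} (hb : ∀ k, comp ϑ₀ k = comp ϑs (b k))
    (hw : ∀ h, ∑ k with b k = h, weight ϑ₀ k = weight ϑs h) (hsurj : Function.Surjective b) :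
    ∀ᶠ ϑ in 𝓝[restrictedSpace Θ c M] ϑ₀, ∃ j, ∃ q ∈ nbhdPairs Θ c.c₁ j ϑs (ε j),
      ∀ w, mixDensity (toParam j q.1 q.2) w = mixDensity ϑ w := by
  -- Sorting the components by the true component they replicate makes the blocks consecutive.
  set σ := Tuple.sort b with hσ
  set j : BlockPartition M M₀ :=
    ⟨b ∘ σ, Tuple.monotone_sort b, hsurj.comp σ.surjective⟩ with hj
  obtain ⟨δ, hδ, hδq⟩ := exists_mem_nbhdPairs (Θ := Θ) hM hM₀ c.c₁_pos j ϑs (hε j)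
  have hev1 : ∀ᶠ ϑ : MixParam F M in 𝓝 ϑ₀, ∀ h,
      |∑ k with b k = h, weight ϑ k - weight ϑs h| < δ := by
    refine eventually_all.2 fun h => ?_
    have hc : Continuous fun ϑ : MixParam F M => |∑ k with b k = h, weight ϑ k - weight ϑs h| :=
      ((continuous_finsetSum _ fun k _ => continuous_weight k).sub continuous_const).abs
    refine hc.continuousAt.eventually (gt_mem_nhds ?_)
    beta_reduce
    rw [hw h, sub_self, abs_zero]
    exact hδ
  have hev2 : ∀ᶠ ϑ : MixParam F M in 𝓝 ϑ₀, ∀ k a,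
      |comp ϑ k a - ϑs (.inr (b k, a))| < δ := by
    refine eventually_all.2 fun k => eventually_all.2 fun a => ?_
    have hc : Continuous fun ϑ : MixParam F M => |comp ϑ k a - ϑs (.inr (b k, a))| := by
      unfold comp
      fun_prop
    refine hc.continuousAt.eventually (gt_mem_nhds ?_)
    beta_reduce
    rw [hb k]
    simpa [comp] using hδ
  filter_upwards [self_mem_nhdsWithin, nhdsWithin_le_nhds hev1, nhdsWithin_le_nhds hev2]
    with ϑ hϑ h1 h2
  obtain ⟨hϑp, hα, -⟩ := hϑ
  have hα' : ∀ k, c.c₁ ≤ weight ϑ k := (mem_alphaSpace_iff hM c.c₁_pos).1 hα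
  have hblock : ∀ h, ∑ k with j.block k = h, weight ϑ (σ k) = ∑ k with b k = h, weight ϑ k :=
    fun h => by
      simp_rw [Finset.sum_filter]
      exact Equiv.sum_comp σ fun k => if b k = h then weight ϑ k else 0
  set β : Fin M₀ → ℝ := fun h => ∑ k with b k = h, weight ϑ k with hβ
  have hβ1 : ∑ h, β h = 1 := by
    rw [hβ, Finset.sum_fiberwise_of_maps_to (fun k _ => Finset.mem_univ _), sum_weight hM]
  have hβpos : ∀ k, 0 < β (b k) := fun k => c.c₁_pos.trans_le ((hα' k).trans
    (Finset.single_le_sum (f := fun k => weight ϑ k) (fun k' _ => hϑp.1 k') (by simp)))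
  have hfull := fullWeights_of_sum_eq_one hβ1
  have hσ1 : ∑ k, weight ϑ (σ k) = 1 := by
    rw [Equiv.sum_comp σ fun k => weight ϑ k, sum_weight hM]
  have hσfull := fullWeights_of_sum_eq_one hσ1
  obtain ⟨q, hq, hqd⟩ := hδq (fun i => β ⟨i, i.2.trans_le (Nat.sub_le _ _)⟩)
    (fun k => weight ϑ (σ k) / β (b (σ k))) (fun k => comp ϑ (σ k))
    (fun h => by
      rw [hfull]
      exact Finset.sum_nonneg fun k _ => hϑp.1 k)
    ⟨fun i => weight ϑ (σ ⟨i, i.2.trans_le (Nat.sub_le _ _)⟩),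
      (mem_alphaSpace_iff hM c.c₁_pos).2 fun k => by
        rw [hσfull]
        exact hα' _, fun k => by
        simp_rw [hσfull]
        rw [hblock]
        rfl⟩
    (fun k => hϑp.2 _)
    (fun i => by
      have := h1 ⟨i, i.2.trans_le (Nat.sub_le _ _)⟩
      rwa [show weight ϑs ⟨i, i.2.trans_le (Nat.sub_le _ _)⟩ = ϑs (.inl i) from
        fullWeights_castLE _ i] at this)
    (fun k a => h2 (σ k) a)
  refine ⟨j, q, hq, fun w => ?_⟩
  rw [hqd, mixDensity, ← Equiv.sum_comp σ fun k => weight ϑ k * F.density (comp ϑ k) w]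
  refine Finset.sum_congr rfl fun k _ => ?_
  rw [hfull]
  congr 1
  exact mul_div_cancel₀ _ (hβpos (σ k)).ne'

/-- In the model with the true number of components, parameters near a relabelling of the true
parameter are described by pairs `(ψ, τ)` with `λ = 0` of any partition of a larger model. -/
lemma eventually_exists_nbhdPairs_of_sameUpToLabels (hM : 1 ≤ M) (hM₀ : 1 ≤ M₀)
    {Θ : Set (EuclideanSpace ℝ F.ι)} {c₁ : ℝ} (hc₁ : 0 < c₁) (j : BlockPartition M M₀)
    {τ : Fin M → ℝ} (hτ : τ ∈ tauSpace c₁ j) {ε : ℝ} (hε : 0 < ε) {ϑ₀ : MixParam F M₀}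
    (h₀ : SameUpToLabels ϑ₀ ϑs) :
    ∀ᶠ ϑ in 𝓝[paramSpace Θ M₀] ϑ₀, ∃ q ∈ nbhdPairs Θ c₁ j ϑs ε,
      ∀ w, mixDensity (toParam j q.1 q.2) w = mixDensity ϑ w := by
  obtain ⟨σ, hσ⟩ := h₀
  obtain ⟨δ, hδ, hδq⟩ := exists_mem_nbhdPairs (Θ := Θ) hM hM₀ hc₁ j ϑs hε
  have hev1 : ∀ᶠ ϑ : MixParam F M₀ in 𝓝 ϑ₀, ∀ h, |weight ϑ (σ h) - weight ϑs h| < δ := by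
    refine eventually_all.2 fun h => ?_
    have hc : Continuous fun ϑ : MixParam F M₀ => |weight ϑ (σ h) - weight ϑs h| :=
      ((continuous_weight _).sub continuous_const).abs
    refine hc.continuousAt.eventually (gt_mem_nhds ?_)
    beta_reduce
    rw [(hσ h).1, sub_self, abs_zero]
    exact hδ
  have hev2 : ∀ᶠ ϑ : MixParam F M₀ in 𝓝 ϑ₀, ∀ h a,
      |comp ϑ (σ h) a - ϑs (.inr (h, a))| < δ := by
    refine eventually_all.2 fun h => eventually_all.2 fun a => ?_
    have hc : Continuous fun ϑ : MixParam F M₀ => |comp ϑ (σ h) a - ϑs (.inr (h, a))| := by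
      unfold comp
      fun_prop
    refine hc.continuousAt.eventually (gt_mem_nhds ?_)
    beta_reduce
    rw [(hσ h).2]
    simpa [comp] using hδ
  filter_upwards [self_mem_nhdsWithin, nhdsWithin_le_nhds hev1, nhdsWithin_le_nhds hev2]
    with ϑ hϑ h1 h2
  have hσ1 : ∑ h, weight ϑ (σ h) = 1 := by
    rw [Equiv.sum_comp σ fun k => weight ϑ k, sum_weight hM₀]
  have hfull := fullWeights_of_sum_eq_one hσ1
  obtain ⟨q, hq, hqd⟩ := hδq (fun i => weight ϑ (σ ⟨i, i.2.trans_le (Nat.sub_le _ _)⟩)) τ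
    (fun k => comp ϑ (σ (j.block k)))
    (fun h => by
      rw [hfull]
      exact hϑ.1 _) hτ (fun k => hϑ.2 _)
    (fun i => by
      have := h1 ⟨i, i.2.trans_le (Nat.sub_le _ _)⟩
      rwa [show weight ϑs ⟨i, i.2.trans_le (Nat.sub_le _ _)⟩ = ϑs (.inl i) from
        fullWeights_castLE _ i] at this)
    (fun k a => h2 _ a)
  refine ⟨q, hq, fun w => ?_⟩
  have hτ1 := (tauSpace_bounds hM hc₁ hτ).2.2
  rw [hqd, mixDensity, ← Equiv.sum_comp σ fun k => weight ϑ k * F.density (comp ϑ k) w,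
    ← sum_block_mul hτ1]
  refine Finset.sum_congr rfl fun k _ => ?_
  rw [hfull]
  ring

end Identification

/-! ### Likelihood ratios of estimators and penalties -/

section Selection

lemma logLik_congr {T d : ℕ} {F : ComponentFamily T d} {M M' : ℕ} {Ω : Type*}
    {W : ℕ → Ω → Obs T d} {ϑ : MixParam F M} {ϑ' : MixParam F M'} {ω : Ω}
    (h : ∀ i, mixDensity ϑ (W i ω) = mixDensity ϑ' (W i ω)) (n : ℕ) :
    logLik W n ω ϑ = logLik W n ω ϑ' :=
  Finset.sum_congr rfl fun i _ => by rw [h]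

variable {T d : ℕ} {F : ComponentFamily T d} {M M₀ : ℕ} {ϑs : MixParam F M₀}
  {PX : Measure (Fin T → Fin d → ℝ)} [IsProbabilityMeasure PX]
  {Ω : Type*} [MeasurableSpace Ω] {μ : Measure Ω} [IsProbabilityMeasure μ]
  {W : ℕ → Ω → Obs T d}

/-- An estimator whose likelihood is at least that at the true parameter eventually lies in `G`,
where the likelihood ratio is bounded in probability. -/
lemma logLik_estimator_bounded (hF : F.IsRegular) (hW : IsSample μ PX ϑs W) (hM : 1 ≤ M)
    (hM₀ : 1 ≤ M₀) (hs : ϑs ∈ paramSpace F.domain M₀) {S G : Set (MixParam F M)}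
    (hS : IsCompact S) (hSF : S ⊆ paramSpace F.domain M)
    (hG : ∀ ϑ₀ ∈ S, (∀ᵐ w ∂(dataLaw PX ϑs), mixDensity ϑ₀ w = mixDensity ϑs w) →
      ∀ᶠ ϑ in 𝓝[S] ϑ₀, ϑ ∈ G)
    (hGb : ∀ η, 0 < η → ∃ C : ℝ, HighProb μ η fun n ω => ∀ ϑ ∈ G,
      logLik W n ω ϑ - logLik W n ω ϑs ≤ C)
    {θhat : ℕ → Ω → MixParam F M} (hmem : ∀ n ω, θhat n ω ∈ S)
    (hge : ∀ᵐ ω ∂μ, ∀ n, logLik W n ω ϑs ≤ logLik W n ω (θhat n ω)) {η : ℝ} (hη : 0 < η) :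
    ∃ C : ℝ, HighProb μ η fun n ω => 0 ≤ logLik W n ω (θhat n ω) - logLik W n ω ϑs ∧
      logLik W n ω (θhat n ω) - logLik W n ω ϑs ≤ C := by
  obtain ⟨c, hc, hsep⟩ := logLik_separated hF hW hM hM₀ hs hS hSF hG
  obtain ⟨C, hC⟩ := hGb (η / 4) (by positivity)
  refine ⟨C, ?_⟩
  have hall := (hC.and (by positivity) (by positivity) (hsep (η / 4) (by positivity))).and
    (by positivity) (by positivity) (HighProb.of_ae (η := η / 2) hge)
  have hηsum : η / 4 + η / 4 + η / 2 = η := by ring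
  rw [hηsum] at hall
  refine hall.mono ?_
  filter_upwards [eventually_gt_atTop 0] with n hn ω
  rintro ⟨⟨h1, h2⟩, h3⟩
  refine ⟨by linarith, ?_⟩
  by_cases hin : θhat n ω ∈ G
  · exact h1 _ hin
  · have hn' : (0 : ℝ) < n := by exact_mod_cast hn
    have := h2 _ (hmem n ω) hin
    nlinarith

/-- The penalties of two models differ by an amount that tends to infinity. -/
lemma PenaltyCondition.tendsto_sub {p : ℕ → ℕ → ℝ} {kmax : ℕ} (hp : PenaltyCondition p kmax)
    {k k' : ℕ} (hk : 1 ≤ k) (hkk' : k < k') (hk' : k' ≤ kmax) :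
    Tendsto (fun n => p n k' - p n k) atTop atTop := by
  obtain ⟨L, hL, hlim⟩ := hp.ratio k k' hk hkk' hk'
  obtain ⟨r, hr1, hrL⟩ := EReal.lt_iff_exists_real_btwn.1 hL
  have hr : 1 < r := by exact_mod_cast hr1
  have hmul : Tendsto (fun n => (r - 1) * p n k) atTop atTop :=
    (hp.tendsto k hk).const_mul_atTop (by linarith)
  refine tendsto_atTop_mono' _ ?_ hmul
  filter_upwards [hlim.eventually (lt_mem_nhds hrL), eventually_gt_atTop 1] with n hn hn1
  have hpos := hp.pos n k hn1 hk
  have hn' : r < p n k' / p n k := by exact_mod_cast hn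
  rw [lt_div_iff₀ hpos] at hn'
  linarith

end Selection

/-! ### The three comparisons with the true parameter -/

section Models

variable {T d : ℕ} {F : ComponentFamily T d} {M M₀ : ℕ}
  {PX : Measure (Fin T → Fin d → ℝ)} [IsProbabilityMeasure PX]
  {Ω : Type*} [MeasurableSpace Ω] {μ : Measure Ω} [IsProbabilityMeasure μ]
  {W : ℕ → Ω → Obs T d} {Θ : Set (EuclideanSpace ℝ F.ι)} {c : Constants}

/-- With too many components, the likelihood ratio is nonnegative and bounded in probability. -/
theorem logLik_overfitted_bounded {ϑs : MixParam F M₀} (hF : F.IsRegular)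
    (hW : IsSample μ PX ϑs W) (hM₀ : 1 ≤ M₀) (hM : M₀ < M) (hΘ : Θ ⊆ F.domain)
    (hs : ϑs ∈ paramSpace Θ M₀) (hcompact : IsCompact (restrictedSpace Θ c M))
    (hne : (trueSet Θ PX ϑs M ∩ restrictedSpace Θ c M).Nonempty)
    (hIdent : ∀ ϑ ∈ trueSet Θ PX ϑs M ∩ restrictedSpace Θ c M, ∀ k, ∃ h, comp ϑ k = comp ϑs h)
    (hExp : ∀ j : BlockPartition M M₀, ExpansionCondition μ W (dataLaw PX ϑs) Θ c.c₁ ϑs j)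
    {θhat : ℕ → Ω → MixParam F M} (hMLE : IsMLE W Θ c θhat) {η : ℝ} (hη : 0 < η) :
    ∃ C : ℝ, HighProb μ η fun n ω => 0 ≤ logLik W n ω (θhat n ω) - logLik W n ω ϑs ∧
      logLik W n ω (θhat n ω) - logLik W n ω ϑs ≤ C := by
  have hM1 : 1 ≤ M := hM₀.trans hM.le
  have hsF : ϑs ∈ paramSpace F.domain M₀ := paramSpace_mono hΘ M₀ hs
  choose ε hε hbound using fun j => logLik_bounded_near hF hW hM₀ hM1 hΘ hsF c.c₁_pos (hExp j)
  set G : Set (MixParam F M) := {ϑ | ∃ j, ∃ q ∈ nbhdPairs Θ c.c₁ j ϑs (ε j),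
    ∀ w, mixDensity (toParam j q.1 q.2) w = mixDensity ϑ w} with hG
  have := Fintype.ofFinite (BlockPartition M M₀)
  obtain ⟨j₀⟩ := nonempty_blockPartition hM₀ hM
  refine logLik_estimator_bounded (S := restrictedSpace Θ c M) (G := G) hF hW hM1 hM₀ hsF hcompact
    (fun ϑ hϑ => paramSpace_mono hΘ M hϑ.1) (fun ϑ₀ hϑ₀ hae => ?_) (fun η hη => ?_)
    (fun n ω => (hMLE n ω).1) ?_ hη
  · obtain ⟨b, hb, hw, hsurj⟩ := exists_block_of_trueSet hM1 hM₀ hF.nonempty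
      (hExp j₀).info_finite (hExp j₀).info_nonsingular hae (hIdent ϑ₀ ⟨⟨hϑ₀.1, hae⟩, hϑ₀⟩)
    exact eventually_exists_nbhdPairs hM1 hM₀ hε hb hw hsurj
  · have hcard : 0 < Fintype.card (BlockPartition M M₀) := Fintype.card_pos_iff.2 ⟨j₀⟩
    choose C hC using fun j => hbound j (η / Fintype.card (BlockPartition M M₀)) (by positivity)
    refine ⟨∑ j, |C j|, (HighProb.forall_fintype hη.le hC).mono
      (Eventually.of_forall fun n ω hω ϑ hϑ => ?_)⟩
    obtain ⟨j, q, hq, heq⟩ := hϑ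
    rw [← logLik_congr (W := W) (fun i => heq (W i ω))]
    exact (hω j q hq).trans ((le_abs_self _).trans
      (Finset.single_le_sum (fun j _ => abs_nonneg (C j)) (Finset.mem_univ j)))
  · obtain ⟨ϑ₀, htrue, hres⟩ := hne
    filter_upwards [hW.ae_forall htrue.2] with ω hω n
    rw [← logLik_congr hω]
    exact (hMLE n ω).2 ϑ₀ hres

/-- With the true number of components the likelihood ratio is bounded in probability as well. The
bound comes from the expansion of a larger model, restricted to `λ = 0`. -/
theorem logLik_trueOrder_bounded {ϑs : (M : ℕ) → MixParam F M} (hF : F.IsRegular)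
    (hW : IsSample μ PX (ϑs M₀) W) (hM₀ : 1 ≤ M₀) (hM : M₀ < M) (hΘ : Θ ⊆ F.domain)
    (hReg : RegularityCondition Θ (dataLaw PX (ϑs M₀)) M₀ ϑs)
    (hne : (trueSet Θ PX (ϑs M₀) M ∩ restrictedSpace Θ c M).Nonempty)
    (hIdent : ∀ ϑ ∈ trueSet Θ PX (ϑs M₀) M ∩ restrictedSpace Θ c M,
      ∀ k, ∃ h, comp ϑ k = comp (ϑs M₀) h)
    (hExp : ∀ j : BlockPartition M M₀,
      ExpansionCondition μ W (dataLaw PX (ϑs M₀)) Θ c.c₁ (ϑs M₀) j)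
    {θhat : ℕ → Ω → MixParam F M₀} (hMLE : IsMLE W Θ c θhat) {η : ℝ} (hη : 0 < η) :
    ∃ C : ℝ, HighProb μ η fun n ω => 0 ≤ logLik W n ω (θhat n ω) - logLik W n ω (ϑs M₀) ∧
      logLik W n ω (θhat n ω) - logLik W n ω (ϑs M₀) ≤ C := by
  have hM1 : 1 ≤ M := hM₀.trans hM.le
  have hs : ϑs M₀ ∈ paramSpace Θ M₀ := interior_subset (hReg.mem_interior M₀ hM₀ le_rfl)
  have hsF : ϑs M₀ ∈ paramSpace F.domain M₀ := paramSpace_mono hΘ M₀ hs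
  obtain ⟨j₀⟩ := nonempty_blockPartition hM₀ hM
  obtain ⟨ϑ₁, htrue, hres⟩ := hne
  obtain ⟨b, hb, hw, hsurj⟩ := exists_block_of_trueSet hM1 hM₀ hF.nonempty
    (hExp j₀).info_finite (hExp j₀).info_nonsingular htrue.2 (hIdent ϑ₁ ⟨htrue, hres⟩)
  have hsres : ϑs M₀ ∈ restrictedSpace Θ c M₀ :=
    true_mem_restrictedSpace hM1 hM₀ hs hres hb hw hsurj
  obtain ⟨τ, hτ⟩ : (tauSpace c.c₁ j₀).Nonempty := ⟨_, _, hres.2.1, fun k => rfl⟩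
  obtain ⟨ε, hε, hbound⟩ := logLik_bounded_near hF hW hM₀ hM1 hΘ hsF c.c₁_pos (hExp j₀)
  set G : Set (MixParam F M₀) := {ϑ | ∃ q ∈ nbhdPairs Θ c.c₁ j₀ (ϑs M₀) ε,
    ∀ w, mixDensity (toParam j₀ q.1 q.2) w = mixDensity ϑ w} with hG
  refine logLik_estimator_bounded (S := paramSpace Θ M₀) (G := G) hF hW hM₀ hM₀ hsF
    (hReg.compact M₀ hM₀ le_rfl) (paramSpace_mono hΘ M₀) (fun ϑ₀ hϑ₀ hae => ?_)
    (fun η hη => ?_) (fun n ω => (hMLE n ω).1.1)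
    (Eventually.of_forall fun ω n => (hMLE n ω).2 _ hsres) hη
  · have hQ : expLogLik (dataLaw PX (ϑs M₀)) ϑ₀ = expLogLik (dataLaw PX (ϑs M₀)) (ϑs M₀) :=
      integral_congr_ae (hae.mono fun w hw => by simp only [hw])
    exact eventually_exists_nbhdPairs_of_sameUpToLabels hM1 hM₀ c.c₁_pos j₀ hτ hε
      (hReg.unique M₀ hM₀ le_rfl ϑ₀ hϑ₀ hQ)
  · obtain ⟨C, hC⟩ := hbound η hη
    refine ⟨C, hC.mono (Eventually.of_forall fun n ω hω ϑ hϑ => ?_)⟩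
    obtain ⟨q, hq, heq⟩ := hϑ
    rw [← logLik_congr (W := W) (fun i => heq (W i ω))]
    exact hω q hq

/-- With too few components no parameter reproduces the true density, and the likelihood falls
short of the true one by a multiple of `n`. -/
theorem logLik_underfitted {ϑs : (M : ℕ) → MixParam F M} (hF : F.IsRegular)
    (hW : IsSample μ PX (ϑs M₀) W) (hM : 1 ≤ M) (hMM₀ : M < M₀) (hΘ : Θ ⊆ F.domain)
    (hReg : RegularityCondition Θ (dataLaw PX (ϑs M₀)) M₀ ϑs) :
    ∃ δ : ℝ, 0 < δ ∧ ∀ η, 0 < η → HighProb μ η fun n ω => ∀ ϑ ∈ paramSpace Θ M,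
      logLik W n ω ϑ - logLik W n ω (ϑs M₀) ≤ -δ * n := by
  have hM₀ : 1 ≤ M₀ := hM.trans hMM₀.le
  have hs : ϑs M₀ ∈ paramSpace F.domain M₀ :=
    paramSpace_mono hΘ M₀ (interior_subset (hReg.mem_interior M₀ hM₀ le_rfl))
  set Q : ℕ → ℝ := fun m => expLogLik (dataLaw PX (ϑs M₀)) (ϑs m) with hQ
  have hlt : Q M < Q M₀ := by
    have hstep : ∀ m, M + 1 ≤ m → m ≤ M₀ → Q M < Q m := by
      intro m hm
      induction m, hm using Nat.le_induction with
      | base =>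
        intro _
        exact sub_pos.1 (hReg.increasing M hM hMM₀)
      | succ m hm ih =>
        intro hm'
        exact (ih (by omega)).trans (sub_pos.1 (hReg.increasing m (by omega) (by omega)))
    exact hstep M₀ hMM₀ le_rfl
  obtain ⟨δ, hδ, hsep⟩ := logLik_separated (G := ∅) hF hW hM hM₀ hs
    (hReg.compact M hM hMM₀.le) (paramSpace_mono hΘ M) (fun ϑ₀ hϑ₀ hae => by
      have h1 : expLogLik (dataLaw PX (ϑs M₀)) ϑ₀ = Q M₀ :=
        integral_congr_ae (hae.mono fun w hw => by simp only [hw])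
      have h2 := hReg.isMax M hM hMM₀.le ϑ₀ hϑ₀
      exact absurd h2 (not_le.2 (by rw [h1]; exact hlt)))
  exact ⟨δ, hδ, fun η hη => (hsep η hη).mono (Eventually.of_forall fun n ω hω ϑ hϑ =>
    hω ϑ hϑ (Set.notMem_empty ϑ))⟩

end Models

lemma numParams_strictMono {T d : ℕ} (F : ComponentFamily T d) {M M' : ℕ} (hM : 1 ≤ M)
    (h : M < M') : numParams F M < numParams F M' := by
  simp only [numParams, Fintype.card_sum, Fintype.card_prod, Fintype.card_fin]
  have := Nat.mul_le_mul_right (Fintype.card F.ι) h.le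
  omega

lemma one_le_numParams {T d : ℕ} {F : ComponentFamily T d} (hι : Nonempty F.ι) {M : ℕ}
    (hM : 1 ≤ M) : 1 ≤ numParams F M := by
  simp only [numParams, Fintype.card_sum, Fintype.card_prod, Fintype.card_fin]
  have : 1 ≤ M * Fintype.card F.ι := Nat.mul_pos hM Fintype.card_pos
  omega

end PanelMixture
end

theorem mainTheorem4
    (T d K : ℕ) (hT : 2 ≤ T) (hK : 1 ≤ K) (kind : PanelMixture.ModelKind)
    (Θ : Set (EuclideanSpace ℝ (PanelMixture.family T d K kind).ι))
    (hΘ : Θ ⊆ (PanelMixture.family T d K kind).domain)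
    (c : PanelMixture.Constants)
    (M₀ Mbar : ℕ) (hM₀ : 1 ≤ M₀) (hMbar : M₀ < Mbar)
    (ϑs : (M : ℕ) → PanelMixture.MixParam (PanelMixture.family T d K kind) M)
    (PX : MeasureTheory.Measure (Fin T → Fin d → ℝ)) [MeasureTheory.IsProbabilityMeasure PX]
    {Ω : Type*} [MeasurableSpace Ω] (μ : MeasureTheory.Measure Ω)
    [MeasureTheory.IsProbabilityMeasure μ]
    (W : ℕ → Ω → PanelMixture.Obs T d)
    (hW : PanelMixture.IsSample μ PX (ϑs M₀) W)
    (hInner : PanelMixture.InnerCondition (ϑs M₀))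
    (hIdent : PanelMixture.ComponentsIdentified Θ PX c (ϑs M₀) Mbar)
    (hCons : PanelMixture.ConsistencyCondition Θ PX c (ϑs M₀) Mbar)
    (hReg : PanelMixture.RegularityCondition Θ (PanelMixture.dataLaw PX (ϑs M₀)) M₀ ϑs)
    (p : ℕ → ℕ → ℝ)
    (hPen : PanelMixture.PenaltyCondition p
      (PanelMixture.numParams (PanelMixture.family T d K kind) Mbar))
    (hExp : ∀ M, M₀ < M → M ≤ Mbar → ∀ j : PanelMixture.BlockPartition M M₀,
      PanelMixture.ExpansionCondition μ W (PanelMixture.dataLaw PX (ϑs M₀)) Θ c.c₁ (ϑs M₀) j)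
    (θhat : (M : ℕ) → ℕ → Ω → PanelMixture.MixParam (PanelMixture.family T d K kind) M)
    (hMLE : ∀ M, 1 ≤ M → M ≤ Mbar → PanelMixture.IsMLE W Θ c (θhat M))
    (Mhat : ℕ → Ω → ℕ)
    (hMhat : PanelMixture.IsPenalizedArgmax W p Mbar θhat Mhat) :
    (∀ M, M₀ < M → M ≤ Mbar → PanelMixture.IsOpOne μ (fun n ω =>
      PanelMixture.logLik W n ω (θhat M n ω) - PanelMixture.logLik W n ω (θhat M₀ n ω))) ∧
    MeasureTheory.TendstoInMeasure μ (fun n ω => (Mhat n ω : ℝ)) Filter.atTop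
      (fun _ => (M₀ : ℝ)) := by
  open PanelMixture in
  have hF := family_isRegular (T := T) (d := d) hK kind
  have hs : ϑs M₀ ∈ paramSpace Θ M₀ := interior_subset (hReg.mem_interior M₀ hM₀ le_rfl)
  have hover : ∀ M, M₀ < M → M ≤ Mbar → ∀ η, 0 < η → ∃ C : ℝ, HighProb μ η fun n ω =>
      0 ≤ logLik W n ω (θhat M n ω) - logLik W n ω (ϑs M₀) ∧
        logLik W n ω (θhat M n ω) - logLik W n ω (ϑs M₀) ≤ C := fun M hM hMb η hη =>
    logLik_overfitted_bounded hF hW hM₀ hM hΘ hs (hCons.compact M hM hMb)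
      (hCons.nonempty M hM hMb) (hIdent M hM hMb) (hExp M hM hMb)
      (hMLE M (hM₀.trans hM.le) hMb) hη
  have htrue : ∀ η, 0 < η → ∃ C : ℝ, HighProb μ η fun n ω =>
      0 ≤ logLik W n ω (θhat M₀ n ω) - logLik W n ω (ϑs M₀) ∧
        logLik W n ω (θhat M₀ n ω) - logLik W n ω (ϑs M₀) ≤ C := fun η hη =>
    logLik_trueOrder_bounded hF hW hM₀ hMbar hΘ hReg (hCons.nonempty Mbar hMbar le_rfl)
      (hIdent Mbar hMbar le_rfl) (hExp Mbar hMbar le_rfl) (hMLE M₀ hM₀ hMbar.le) hη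
  refine ⟨fun M hM hMb η hη => ?_, ?_⟩
  · obtain ⟨C, hC⟩ := hover M hM hMb (η / 2) (half_pos hη)
    obtain ⟨C', hC'⟩ := htrue (η / 2) (half_pos hη)
    refine ⟨max C C', ?_⟩
    have hall := hC.and (half_pos hη).le (half_pos hη).le hC'
    rw [add_halves] at hall
    have hfin := hall.mono (E' := fun n ω =>
      |logLik W n ω (θhat M n ω) - logLik W n ω (θhat M₀ n ω)| ≤ max C C')
      (Eventually.of_forall fun n ω hω => by
        rw [abs_le]
        constructor <;> linarith [hω.1.1, hω.1.2, hω.2.1, hω.2.2, le_max_left C C',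
          le_max_right C C'])
    simpa [HighProb] using hfin
  · have hsel : ∀ η, 0 < η → HighProb μ η fun n ω => Mhat n ω = M₀ := by
      intro η hη
      have hk₀ := one_le_numParams hF.nonempty hM₀
      -- Every wrong order has a smaller criterion than the true parameter has with `M₀`.
      have hM_event : ∀ m : Fin (Mbar + 1), HighProb μ (η / 2 / Fintype.card (Fin (Mbar + 1)))
          fun n ω => 1 ≤ (m : ℕ) → (m : ℕ) ≠ M₀ →
            logLik W n ω (θhat m n ω) - p n (numParams (family T d K kind) m) <
              logLik W n ω (ϑs M₀) - p n (numParams (family T d K kind) M₀) := by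
        rintro ⟨M, hMlt⟩
        have hη' : 0 < η / 2 / Fintype.card (Fin (Mbar + 1)) := by
          have : 0 < Fintype.card (Fin (Mbar + 1)) := Fintype.card_pos
          positivity
        simp only
        rcases Nat.eq_zero_or_pos M with rfl | hM1
        · exact HighProb.of_ae (Eventually.of_forall fun ω n h => absurd h (by norm_num))
        rcases lt_trichotomy M M₀ with hlt | rfl | hgt
        · obtain ⟨δ, hδ, hsep⟩ := logLik_underfitted hF hW hM1 hlt hΘ hReg
          refine (hsep _ hη').mono ?_
          filter_upwards [(hPen.littleO _ hk₀).eventually (gt_mem_nhds hδ),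
            eventually_gt_atTop 1] with n hpn hn ω hω _ _
          have hn' : (0 : ℝ) < n := by exact_mod_cast (zero_lt_one.trans hn)
          have h1 := hω _ ((hMLE M hM1 (hlt.trans hMbar).le) n ω).1.1
          have h2 := hPen.pos n _ hn (one_le_numParams hF.nonempty hM1)
          rw [div_lt_iff₀ hn'] at hpn
          linarith
        · exact HighProb.of_ae (Eventually.of_forall fun ω n _ h => absurd rfl h)
        · have hMb : M ≤ Mbar := by omega
          obtain ⟨C, hC⟩ := hover M hgt hMb _ hη'
          have hkM : numParams (family T d K kind) M ≤ numParams (family T d K kind) Mbar := by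
            rcases hMb.eq_or_lt with rfl | h
            · exact le_rfl
            · exact (numParams_strictMono _ hM1 h).le
          refine hC.mono ?_
          filter_upwards [(hPen.tendsto_sub hk₀ (numParams_strictMono _ hM₀ hgt)
            hkM).eventually_gt_atTop C] with n hpn ω hω _ _
          linarith [hω.2]
      obtain ⟨C, hC⟩ := htrue (η / 2) (half_pos hη)
      have hall := (HighProb.forall_fintype (half_pos hη).le hM_event).and
        (half_pos hη).le (half_pos hη).le hC
      rw [add_halves] at hall
      refine hall.mono (Eventually.of_forall fun n ω hω => ?_)
      obtain ⟨h1, hb, hmax⟩ := hMhat n ω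
      by_contra hne
      have h2 := hω.1 ⟨Mhat n ω, by omega⟩ h1 hne
      have h3 := hmax M₀ hM₀ hMbar.le
      simp only at h2
      linarith [hω.2.1]
    intro ε hε
    rw [ENNReal.tendsto_nhds_zero]
    intro ρ hρ
    obtain ⟨η, hη0, hηρ⟩ : ∃ η : ℝ, 0 < η ∧ ENNReal.ofReal η ≤ ρ := by
      rcases eq_or_ne ρ ⊤ with rfl | hρt
      · exact ⟨1, one_pos, le_top⟩
      · exact ⟨ρ.toReal, ENNReal.toReal_pos hρ.ne' hρt, ENNReal.ofReal_toReal_le⟩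
    filter_upwards [hsel η hη0] with n hn
    refine (measure_mono fun ω hω h => ?_).trans (hn.trans hηρ)
    have hω' : ε ≤ edist ((Mhat n ω : ℕ) : ℝ) (M₀ : ℝ) := hω
    rw [h, edist_self] at hω'
    exact absurd hω' (not_le.2 hε)
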